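/- **Theorem (approximate basis for regular distributions).** Let $\Pr[\cdot]$ be a distribution over sequences $x_1,\dots,x_T$ of observations from a finite alphabet $\mathcal O$, given together with a consistent choice of its conditionals, i.e. by one-step conditional laws $\Pr[o\mid h]$ for all histories $h$ of length $<T$, with $\Pr[of\mid h]=\Pr[o\mid h]\Pr[f\mid ho]$. It has *rank $r$* if for every $t\in\{1,\dots,T\}$ the matrix $\big(\Pr[f\mid h]\big)_{f\in\mathcal O^{\le T-t},\,h\in\mathcal O^t}$ has rank at most $r$. It is *$\alpha$-regular* if $\Pr[o\mid h]\ge\alpha$ for all histories $h$ of length $<T$ and observations $o$ with $\Pr[o\mid h]\ne0$. A set $B\subseteq\mathcal O^t$ is an *$\varepsilon$-basis at length $t$* if for every $x\in\mathcal O^t$ there is $\beta(x)\in\mathbb R^{B}$ with $\|\beta(x)\|_2\le1$ such that $$\mathbb E_{x\sim\Pr}\Big[\sum_{f\in\mathcal O^{T-t}}\Big|\Pr[f\mid x]-\sum_{b\in B}\Pr[f\mid b]\,\beta(x)_b\Big|\Big]\le\varepsilon ,$$ where $x$ is the length-$t$ prefix of a sample from $\Pr$. The *conditional sampling oracle* takes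 a history $h$ of length $s\le T$ and returns a fresh sample $f\in\mathcal O^{T-s}$ from $\Pr[\cdot\mid h]$. There are a single algorithm with access to the conditional sampling oracle (a program of a real random access machine with unit-cost elementary operations and oracle calls), a polynomial $Q$ and an absolute constant $K$ such that the following holds for every finite alphabet $\mathcal O$, all $T,r,t$ with $1\le t\le T$, every $\alpha$-regular distribution $\Pr[\cdot]$ of rank $r$ over sequences of length $T$ from $\mathcal O$, all $0<\varepsilon<\alpha/(Tr)$ and all $0<\delta<1$. On input $T,t,r,\varepsilon,\alpha,\delta$ the algorithm always halts within $Q\big(r,T,1/\varepsilon,1/\alpha,\log(1/\delta)\big)$ steps, and with probability at least $1-\delta$ it outputs a set $B\subseteq\mathcal O^t$ that is an $\varepsilon$-basis for $\Pr[\cdot]$ at length $t$ and has size $$|B|\le\max\Big\{1,\;K\,r^2T^3\log\frac1{\alpha\varepsilon}\Big\}.$$ -/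

import Mathlib

namespace CondSampling

noncomputable section

/-! ### Distributions over observation sequences

A distribution over sequences of length `T` over the alphabet `Fin O` is given by its one-step
conditionals: `p h` is the law of the next observation after the history `h`.  Only histories of
length `< T` matter.  This fixes a consistent choice of conditional probabilities, also for histories
of probability zero. -/

/-- The law of the next `k` observations after the history `h`. -/
def futureLaw {O : ℕ} (p : List (Fin O) → PMF (Fin O)) : List (Fin O) → ℕ → PMF (List (Fin O))
  | _, 0 => PMF.pure []
  | h, k + 1 => (p h).bind fun o => (futureLaw p (h ++ [o]) k).map (List.cons o)

/-- The conditional probability `Pr[f | h]` of seeing the future `f` right after the history `h`. -/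
def condProb {O : ℕ} (p : List (Fin O) → PMF (Fin O)) (h f : List (Fin O)) : ℝ :=
  (futureLaw p h f.length f).toReal

theorem condProb_nil {O : ℕ} (p : List (Fin O) → PMF (Fin O)) (h : List (Fin O)) :
    condProb p h [] = 1 := by
  simp [condProb, futureLaw]

/-- The chain rule `Pr[o f | h] = Pr[o | h] * Pr[f | h o]`. -/
theorem condProb_cons {O : ℕ} (p : List (Fin O) → PMF (Fin O)) (h f : List (Fin O)) (o : Fin O) :
    condProb p h (o :: f) = (p h o).toReal * condProb p (h ++ [o]) f := by
  have hmap : ∀ a : Fin O, (PMF.map (List.cons a) (futureLaw p (h ++ [a]) f.length)) (o :: f)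
      = if a = o then futureLaw p (h ++ [o]) f.length f else 0 := by
    intro a
    rw [PMF.map_apply]
    split_ifs with ha
    · subst ha
      rw [tsum_eq_single f]
      · simp
      · intro g hg
        simp [Ne.symm hg]
    · have : ∀ g : List (Fin O), ¬ (o :: f = a :: g) := by
        intro g hg
        exact ha (List.cons.inj hg).1.symm
      simp [this]
  simp only [condProb, List.length_cons, futureLaw, PMF.bind_apply, hmap]
  rw [tsum_eq_single o]
  · simp
  · intro a ha
    simp [ha]

/-- The distribution has rank (at most) `r`: for every `t ∈ {1, …, T}` the matrix of the conditional
probabilities `Pr[f | h]`, with rows the futures `f` of length at most `T - t` and columns the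
histories `h` of length `t`, has rank at most `r`. -/
def HasRank {O : ℕ} (p : List (Fin O) → PMF (Fin O)) (T r : ℕ) : Prop :=
  ∀ t : ℕ, 1 ≤ t → t ≤ T →
    (Matrix.of fun (f : Σ k : Fin (T - t + 1), (Fin k → Fin O)) (h : Fin t → Fin O) =>
      condProb p (List.ofFn h) (List.ofFn f.2)).rank ≤ r

/-- `α`-regularity: every nonzero one-step conditional probability is at least `α`. -/
def IsRegular {O : ℕ} (p : List (Fin O) → PMF (Fin O)) (T : ℕ) (α : ℝ) : Prop :=
  ∀ h : List (Fin O), h.length < T → ∀ o : Fin O, p h o ≠ 0 → α ≤ (p h o).toReal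

/-- The set `B` of histories of length `t` is an `ε`-basis: there are coefficient vectors `β x` of
Euclidean norm at most one such that the expectation over `x ∼ Pr` (of length `t`) of
`‖Pr[F | x] - Pr[F | B] β x‖₁` is at most `ε`, where `F` is the set of futures of length `T - t`. -/
def IsApproxBasis {O : ℕ} (p : List (Fin O) → PMF (Fin O)) (T t : ℕ) (ε : ℝ)
    (B : Finset (Fin t → Fin O)) : Prop :=
  ∃ β : (Fin t → Fin O) → EuclideanSpace ℝ B,
    (∀ x, ‖β x‖ ≤ 1) ∧
    ∑ x : Fin t → Fin O, condProb p [] (List.ofFn x) *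
      ∑ f : Fin (T - t) → Fin O,
        |condProb p (List.ofFn x) (List.ofFn f)
          - ∑ b : B, condProb p (List.ofFn b.1) (List.ofFn f) * β x b| ≤ ε

/-! ### The machine model

A real random access machine with a conditional sampling oracle, programmed in a small imperative
language.  The memory consists of natural-number arrays and real arrays, named by numbers and indexed
by pairs of naturals.  Observations are stored as natural numbers.  Programs may only use natural
number constants, addition and truncated subtraction of naturals, and the four field operations and
the order on the reals (no rounding; division by zero gives zero).  Every elementary command, test and oracle call is one step. -/

/-- Memory contents: `nat a i j` and `real a i j` are the `(i, j)` cells of the arrays named `a`. -/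
structure Store where
  nat : ℕ → ℕ → ℕ → ℕ
  real : ℕ → ℕ → ℕ → ℝ

/-- Natural-number expressions. -/
inductive NExpr where
  | lit (n : ℕ)
  | cell (a : ℕ) (i j : NExpr)
  | plus (e₁ e₂ : NExpr)
  | minus (e₁ e₂ : NExpr)

/-- Real expressions. -/
inductive RExpr where
  | ofNExpr (e : NExpr)
  | cell (a : ℕ) (i j : NExpr)
  | plus (e₁ e₂ : RExpr)
  | minus (e₁ e₂ : RExpr)
  | times (e₁ e₂ : RExpr)
  | over (e₁ e₂ : RExpr)

/-- Tests. -/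
inductive Test where
  | natLT (e₁ e₂ : NExpr)
  | realLT (e₁ e₂ : RExpr)
  | neg (b : Test)
  | both (b₁ b₂ : Test)

def NExpr.eval (s : Store) : NExpr → ℕ
  | .lit n => n
  | .cell a i j => s.nat a (i.eval s) (j.eval s)
  | .plus e₁ e₂ => e₁.eval s + e₂.eval s
  | .minus e₁ e₂ => e₁.eval s - e₂.eval s

def RExpr.eval (s : Store) : RExpr → ℝ
  | .ofNExpr e => (e.eval s : ℝ)
  | .cell a i j => s.real a (i.eval s) (j.eval s)
  | .plus e₁ e₂ => e₁.eval s + e₂.eval s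
  | .minus e₁ e₂ => e₁.eval s - e₂.eval s
  | .times e₁ e₂ => e₁.eval s * e₂.eval s
  | .over e₁ e₂ => e₁.eval s / e₂.eval s

def Test.eval (s : Store) : Test → Prop
  | .natLT e₁ e₂ => e₁.eval s < e₂.eval s
  | .realLT e₁ e₂ => e₁.eval s < e₂.eval s
  | .neg b => ¬ b.eval s
  | .both b₁ b₂ => b₁.eval s ∧ b₂.eval s

/-- Programs.  `query a i n a' i'` asks the oracle for a conditional sample: the history consists of
the first `n` cells of row `i` of the array `a`, the answer is written to row `i'` of `a'`. -/
inductive Prog where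
  | skip
  | setNat (a : ℕ) (i j e : NExpr)
  | setReal (a : ℕ) (i j : NExpr) (e : RExpr)
  | query (a : ℕ) (i n : NExpr) (a' : ℕ) (i' : NExpr)
  | seq (c₁ c₂ : Prog)
  | ite (b : Test) (c₁ c₂ : Prog)
  | loop (b : Test) (c : Prog)

def Store.setNat (s : Store) (a i j v : ℕ) : Store :=
  { s with nat := fun a' i' j' => if a' = a ∧ i' = i ∧ j' = j then v else s.nat a' i' j' }

def Store.setReal (s : Store) (a i j : ℕ) (v : ℝ) : Store :=
  { s with real := fun a' i' j' => if a' = a ∧ i' = i ∧ j' = j then v else s.real a' i' j' }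

/-- Writes the sequence `f` to the first `f.length` cells of row `i` of the array `a`. -/
def Store.writeSeq {O : ℕ} (s : Store) (a i : ℕ) (f : List (Fin O)) : Store :=
  { s with nat := fun a' i' j' =>
      if a' = a ∧ i' = i ∧ j' < f.length then (f.map Fin.val).getD j' 0 else s.nat a' i' j' }

/-- A configuration: the stack of programs still to be run, and the memory.  The machine has halted
when the stack is empty. -/
abbrev Config := List Prog × Store

open Classical in
/-- One step of the machine whose oracle answers according to `p` on sequences of length `T`.  A query
with a history of length `n ≤ T` returns a fresh sample of length `T - n` from `Pr[· | history]`.  An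
ill-formed query (too long, or containing a number that is not an observation) never returns. -/
def step {O : ℕ} (p : List (Fin O) → PMF (Fin O)) (T : ℕ) : Config → PMF Config
  | ([], s) => PMF.pure ([], s)
  | (.skip :: k, s) => PMF.pure (k, s)
  | (.setNat a i j e :: k, s) =>
      PMF.pure (k, s.setNat a (i.eval s) (j.eval s) (e.eval s))
  | (.setReal a i j e :: k, s) =>
      PMF.pure (k, s.setReal a (i.eval s) (j.eval s) (e.eval s))
  | (.seq c₁ c₂ :: k, s) => PMF.pure (c₁ :: c₂ :: k, s)
  | (.ite b c₁ c₂ :: k, s) => PMF.pure (if b.eval s then (c₁ :: k, s) else (c₂ :: k, s))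
  | (.loop b c :: k, s) =>
      PMF.pure (if b.eval s then (c :: .loop b c :: k, s) else (k, s))
  | (.query a i n a' i' :: k, s) =>
      if hv : n.eval s ≤ T ∧ ∀ j : Fin (n.eval s), s.nat a (i.eval s) j < O then
        (futureLaw p (List.ofFn fun j : Fin (n.eval s) => ⟨s.nat a (i.eval s) j, hv.2 j⟩)
          (T - n.eval s)).map fun f => (k, s.writeSeq a' (i'.eval s) f)
      else PMF.pure (.query a i n a' i' :: k, s)

/-- The law of the configuration after `n` steps. -/
def run {O : ℕ} (p : List (Fin O) → PMF (Fin O)) (T : ℕ) : ℕ → Config → PMF Config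
  | 0, c => PMF.pure c
  | n + 1, c => (step p T c).bind (run p T n)

/-- The initial memory: row `0` of the natural-number array `0` starts with `T, t, r`, row `0` of the
real array `0` starts with `ε, α, δ`, and all other cells are zero. -/
def inputStore (T t r : ℕ) (ε α δ : ℝ) : Store where
  nat := fun a i j => if a = 0 ∧ i = 0 then [T, t, r].getD j 0 else 0
  real := fun a i j => if a = 0 ∧ i = 0 then [ε, α, δ].getD j 0 else 0

/-- The memory `s` holds the output `B`: the cell `(0, 0)` of the natural-number array `1` is the
number of output rows, and these rows of the natural-number array `2` hold exactly the sequences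
in `B`. -/
def Outputs {O t : ℕ} (s : Store) (B : Finset (Fin t → Fin O)) : Prop :=
  (∀ i < s.nat 1 0 0, ∃ b ∈ B, ∀ j : Fin t, s.nat 2 i j = (b j : ℕ)) ∧
  (∀ b ∈ B, ∃ i < s.nat 1 0 0, ∀ j : Fin t, s.nat 2 i j = (b j : ℕ))

/-- On the given input, every run of the program `c` halts within `n` steps. -/
def HaltsWithin {O : ℕ} (p : List (Fin O) → PMF (Fin O)) (T : ℕ) (c : Prog) (s : Store)
    (n : ℕ) : Prop :=
  ∀ cfg ∈ (run p T n ([c], s)).support, cfg.1 = []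

/-- The probability that after `n` steps the program `c` has halted with a memory in `E`. -/
def haltProb {O : ℕ} (p : List (Fin O) → PMF (Fin O)) (T : ℕ) (c : Prog) (s : Store)
    (n : ℕ) (E : Set Store) : ENNReal :=
  (run p T n ([c], s)).toOuterMeasure {cfg | cfg.1 = [] ∧ cfg.2 ∈ E}

end

end CondSampling

/-! View the conditional law of the futures of length T - t after a history x as a vector v_x.
Histories are collected greedily: draw x from Pr and keep it unless v_x is ℓ¹-close to a
combination, with coefficient vector of norm at most one, of the vectors already kept.

Few histories are kept. By regularity the nonzero entries of v_x are at least α^T, so a kept vector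
has squared ℓ² distance at least μ, of order α^T ε³ / m, from all short combinations of its
predecessors (`Spread`). Each such vector at least doubles det(1 + μ⁻¹ ∑ v_j v_jᵀ)
(`two_mul_det_moment_le`), whereas rank r bounds this determinant by (1 + m/μ)^r (`det_one_add_le`).
Hence m = O(r T (1 + log(1/(αε)))) (`two_pow_le_of_spread`, `le_of_two_pow_le`): the exponentially
small μ costs only a logarithm.

The test needs only polynomially many samples. It uses the Gram matrix whose entries are weighted by
the reciprocal of ∑_k v_k(f). For n vectors its quadratic form is at least 1/n times the squared ℓ¹
norm (`sq_sum_abs_le_quad_gram`) and at most α^{-T} times the squared ℓ² norm (`quad_gram_le`). Its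
entries are sums of means of quantities in [0, 1] under futures drawn after the rows. The densities
in these quantities are estimated to small relative error, factor by factor along the chain rule;
regularity makes this possible. Ridge regression on the estimated matrix, done by elimination, then
certifies one of two alternatives: the candidate is close to the kept vectors in ℓ¹
(`near_of_elim_le`) or separated from them in ℓ² (`apart_of_lt_elim`).

Enough histories are kept. While the missed probability exceeds ε/2, a draw is kept with probability
at least ε/2, up to estimation failures. Accordingly `loss` charges A · 2^{-m} to a family of m rows
that still misses too much, and this charge shrinks by the factor 1 - ε/4 per round (`runs_round`).
With A at least 2^m for every spread family, failure at the end means loss at least one.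

All probability is handled in one way: a function of the memory whose expectation is bounded
backwards through the program (`Runs`). It is a second moment for counts, a union bound for
densities, an exponential moment for the Gram matrix and `loss` for the main loop. Markov's
inequality concludes (`Runs.le_haltProb`). -/

namespace CondSampling

noncomputable section

/-! ### Expectation bounds for programs -/

section Semantics

variable {O : ℕ} (p : List (Fin O) → PMF (Fin O)) (T : ℕ)

/-- The expectation of a nonnegative function. -/
def ex {A : Type} (μ : PMF A) (f : A → ENNReal) : ENNReal := ∑' a, μ a * f a

theorem ex_pure {A : Type} (a : A) (f : A → ENNReal) : ex (PMF.pure a) f = f a := by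
  unfold ex
  rw [tsum_eq_single a]
  · simp
  · intro b hb
    simp [PMF.pure_apply, hb]

theorem ex_bind {A B : Type} (μ : PMF A) (ν : A → PMF B) (f : B → ENNReal) :
    ex (μ.bind ν) f = ex μ fun a => ex (ν a) f := by
  unfold ex
  simp only [PMF.bind_apply, ← ENNReal.tsum_mul_right, ← ENNReal.tsum_mul_left, mul_assoc]
  exact ENNReal.tsum_comm

theorem ex_map {A B : Type} (μ : PMF A) (g : A → B) (f : B → ENNReal) :
    ex (μ.map g) f = ex μ fun a => f (g a) := by
  rw [← PMF.bind_pure_comp, ex_bind]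
  simp [ex_pure]

theorem ex_mono {A : Type} (μ : PMF A) {f g : A → ENNReal} (h : ∀ a ∈ μ.support, f a ≤ g a) :
    ex μ f ≤ ex μ g := by
  refine ENNReal.tsum_le_tsum fun a => ?_
  by_cases ha : a ∈ μ.support
  · exact mul_le_mul_right (h a ha) _
  · rw [PMF.mem_support_iff, not_not] at ha
    simp [ha]

theorem ex_add {A : Type} (μ : PMF A) (f g : A → ENNReal) :
    ex μ (fun a => f a + g a) = ex μ f + ex μ g := by
  simp only [ex, mul_add, ENNReal.tsum_add]

theorem ex_const_mul {A : Type} (μ : PMF A) (C : ENNReal) (f : A → ENNReal) :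
    ex μ (fun a => C * f a) = C * ex μ f := by
  simp only [ex, ← ENNReal.tsum_mul_left]
  exact tsum_congr fun a => mul_left_comm _ _ _

theorem ex_const {A : Type} (μ : PMF A) (C : ENNReal) : ex μ (fun _ => C) = C := by
  simp [ex, ENNReal.tsum_mul_right, μ.tsum_coe]

theorem bind_congr_support {A B : Type} (μ : PMF A) {f g : A → PMF B}
    (h : ∀ a ∈ μ.support, f a = g a) : μ.bind f = μ.bind g := by
  ext b
  simp only [PMF.bind_apply]
  refine tsum_congr fun a => ?_
  by_cases ha : a ∈ μ.support
  · rw [h a ha]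
  · rw [PMF.mem_support_iff, not_not] at ha
    simp [ha]

theorem run_add (m n : ℕ) (c : Config) :
    run p T (m + n) c = (run p T m c).bind (run p T n) := by
  induction m generalizing c with
  | zero => simp [run]
  | succ m ih =>
    rw [Nat.succ_add]
    simp only [run, PMF.bind_bind]
    congr 1
    funext c'
    exact ih c'

theorem run_halted (n : ℕ) (s : Store) : run p T n ([], s) = PMF.pure ([], s) := by
  induction n with
  | zero => rfl
  | succ n ih => simp [run, step, ih]

/-- Every run from `c` has halted after `n` steps. -/
def SurelyHalts (n : ℕ) (c : Config) : Prop := ∀ c' ∈ (run p T n c).support, c'.1 = []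

variable {p T} in
theorem SurelyHalts.run_add_eq {n : ℕ} {c : Config} (h : SurelyHalts p T n c) (d : ℕ) :
    run p T (n + d) c = run p T n c := by
  rw [run_add]
  conv_rhs => rw [← PMF.bind_pure (run p T n c)]
  refine bind_congr_support _ fun c' hc' => ?_
  obtain ⟨k, s⟩ := c'
  obtain rfl : k = [] := h _ hc'
  exact run_halted p T d s

/-- Within at most `n` steps the machine passes from `c` to a configuration with law `ν`; the number
of steps may depend on the run. -/
def Reach (n : ℕ) (c : Config) (ν : PMF Config) : Prop :=
  -- Different runs may need different numbers of steps, so the two laws are compared only at times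
  -- by which every continuation has halted; from then on the configuration is stationary.
  ∀ d, (∀ c' ∈ ν.support, SurelyHalts p T d c') → run p T (n + d) c = ν.bind (run p T d)

theorem Reach.refl (n : ℕ) (c : Config) : Reach p T n c (PMF.pure c) := by
  intro d hd
  rw [PMF.pure_bind, add_comm]
  exact (hd c (by simp)).run_add_eq n

variable {p T}

theorem Reach.trans {m n : ℕ} {c : Config} {ν : PMF Config} {ξ : Config → PMF Config}
    (h : Reach p T m c ν) (h' : ∀ c' ∈ ν.support, Reach p T n c' (ξ c')) :
    Reach p T (m + n) c (ν.bind ξ) := by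
  intro d hd
  have key : ∀ c' ∈ ν.support, run p T (n + d) c' = (ξ c').bind (run p T d) := fun c' hc' =>
    h' c' hc' d fun c'' hc'' => hd c'' ((PMF.mem_support_bind_iff _ _ _).2 ⟨c', hc', hc''⟩)
  rw [add_assoc, h (n + d), PMF.bind_bind]
  · exact bind_congr_support _ key
  · intro c' hc' c'' hc''
    rw [key c' hc', PMF.mem_support_bind_iff] at hc''
    obtain ⟨e, he, hce⟩ := hc''
    exact hd e ((PMF.mem_support_bind_iff _ _ _).2 ⟨c', hc', he⟩) c'' hce

theorem Reach.mono {m n : ℕ} {c : Config} {ν : PMF Config} (h : Reach p T m c ν) (hmn : m ≤ n) :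
    Reach p T n c ν := by
  obtain ⟨d, rfl⟩ := Nat.exists_eq_add_of_le hmn
  have := h.trans (n := d) (ξ := PMF.pure) fun c' _ => Reach.refl p T d c'
  rwa [PMF.bind_pure] at this

variable (p T) in
theorem Reach.step (c : Config) : Reach p T 1 c (step p T c) := by
  intro d _
  rw [add_comm]
  rfl

variable (p T) in
/-- Started in the memory `s`, the program `c` terminates within `n` steps in a memory that satisfies
`S`, and the expectation of `f` over the final memory is at most `b`. -/
def Runs (c : Prog) (n : ℕ) (s : Store) (S : Store → Prop) (f : Store → ENNReal)
    (b : ENNReal) : Prop :=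
  -- A single final law serves every stack `k` of pending programs, which is what makes programs
  -- composable.
  ∃ μ : PMF Store, (∀ k, Reach p T n (c :: k, s) (μ.map fun s' => (k, s'))) ∧
    (∀ s' ∈ μ.support, S s') ∧ ex μ f ≤ b

/-- The affine form covers the uses made of it: `A` carries failures already charged, `C` rescales,
and `C = 0` leaves a deterministic bound. -/
theorem Runs.mono {c : Prog} {n n' : ℕ} {s : Store} {S S' : Store → Prop} {f f' : Store → ENNReal}
    {b b' : ENNReal} (A C : ENNReal) (h : Runs p T c n s S f b) (hn : n ≤ n')
    (hS : ∀ s', S s' → S' s') (hf : ∀ s', S s' → f' s' ≤ A + C * f s') (hb : A + C * b ≤ b') :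
    Runs p T c n' s S' f' b' := by
  obtain ⟨μ, h1, h2, h3⟩ := h
  refine ⟨μ, fun k => (h1 k).mono hn, fun s' hs' => hS _ (h2 _ hs'), le_trans ?_ hb⟩
  calc ex μ f' ≤ ex μ fun s' => A + C * f s' := ex_mono μ fun s' hs' => hf s' (h2 s' hs')
    _ = A + C * ex μ f := by rw [ex_add, ex_const, ex_const_mul]
    _ ≤ A + C * b := by gcongr

/-- Change of the postcondition and of the function. -/
theorem Runs.conseq {c : Prog} {n n' : ℕ} {s : Store} {S S' : Store → Prop}
    {f f' : Store → ENNReal} {b b' : ENNReal} (h : Runs p T c n s S f b) (hn : n ≤ n')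
    (hS : ∀ s', S s' → S' s') (hf : ∀ s', S s' → f' s' ≤ f s') (hb : b ≤ b') :
    Runs p T c n' s S' f' b' :=
  h.mono 0 1 hn hS (by simpa using hf) (by simpa using hb)

/-- A function that the postcondition bounds. -/
theorem Runs.ofPost {c : Prog} {n n' : ℕ} {s : Store} {S S' : Store → Prop}
    {f f' : Store → ENNReal} {b b' : ENNReal} (h : Runs p T c n s S f b) (hn : n ≤ n')
    (hS : ∀ s', S s' → S' s') (hf : ∀ s', S s' → f' s' ≤ b') :
    Runs p T c n' s S' f' b' :=
  h.mono b' 0 hn hS (by simpa using hf) (by simp)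

/-- Backward reasoning: the bound `g` for the second program, as a function of the intermediate
memory, is the function whose expectation the first program controls. -/
theorem Runs.seq {c₁ c₂ : Prog} {n₁ n₂ : ℕ} {s : Store} {S₁ S₂ : Store → Prop}
    {f g : Store → ENNReal} {b : ENNReal} (h₁ : Runs p T c₁ n₁ s S₁ g b)
    (h₂ : ∀ s', S₁ s' → Runs p T c₂ n₂ s' S₂ f (g s')) :
    Runs p T (.seq c₁ c₂) (1 + n₁ + n₂) s S₂ f b := by
  classical
  obtain ⟨μ, hμ, hS, hb⟩ := h₁
  choose ξ hξ using h₂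
  -- Memories violating `S₁` have probability zero under `μ`, so the default law never matters.
  let ζ : Store → PMF Store := fun s' => if h : S₁ s' then ξ s' h else PMF.pure s'
  refine ⟨μ.bind ζ, fun k => ?_, ?_, ?_⟩
  · have h0 : Reach p T 1 (.seq c₁ c₂ :: k, s) (PMF.pure (c₁ :: c₂ :: k, s)) := Reach.step p T _
    have h1 := h0.trans (n := n₁) (ξ := fun _ => μ.map fun s' => (c₂ :: k, s')) (by
      intro c' hc'
      obtain rfl : c' = (c₁ :: c₂ :: k, s) := by simpa using hc'
      exact hμ (c₂ :: k))
    rw [PMF.pure_bind] at h1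
    have h2 := h1.trans (n := n₂) (ξ := fun c' => (ζ c'.2).map fun s' => (k, s')) (by
      intro c' hc'
      rw [PMF.mem_support_map_iff] at hc'
      obtain ⟨s', hs', rfl⟩ := hc'
      have : ζ s' = ξ s' (hS s' hs') := dif_pos (hS s' hs')
      simp only [this]
      exact (hξ s' (hS s' hs')).1 k)
    rw [PMF.bind_map] at h2
    rw [PMF.map_bind]
    exact h2
  · intro s' hs'
    rw [PMF.mem_support_bind_iff] at hs'
    obtain ⟨a, ha, hs'⟩ := hs'
    have : ζ a = ξ a (hS a ha) := dif_pos (hS a ha)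
    rw [this] at hs'
    exact (hξ a (hS a ha)).2.1 s' hs'
  · rw [ex_bind]
    refine le_trans (ex_mono μ fun a ha => ?_) hb
    have : ζ a = ξ a (hS a ha) := dif_pos (hS a ha)
    rw [this]
    exact (hξ a (hS a ha)).2.2

theorem Runs.pure_step {c : Prog} {s s' : Store} {S : Store → Prop} {f : Store → ENNReal}
    {b : ENNReal} (h : ∀ k, CondSampling.step p T (c :: k, s) = PMF.pure (k, s')) (hS : S s')
    (hf : f s' ≤ b) : Runs p T c 1 s S f b := by
  refine ⟨PMF.pure s', fun k => ?_, ?_, ?_⟩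
  · rw [PMF.pure_map, ← h k]
    exact Reach.step p T _
  · intro a ha
    obtain rfl : a = s' := by simpa using ha
    exact hS
  · rwa [ex_pure]

theorem Runs.skip {s : Store} {S : Store → Prop} {f : Store → ENNReal}
    {b : ENNReal} (hS : S s) (hf : f s ≤ b) : Runs p T .skip 1 s S f b :=
  Runs.pure_step (fun _ => rfl) hS hf

theorem Runs.setNat {a : ℕ} {i j e : NExpr} {s : Store} {S : Store → Prop} {f : Store → ENNReal}
    {b : ENNReal} (hS : S (s.setNat a (i.eval s) (j.eval s) (e.eval s)))
    (hf : f (s.setNat a (i.eval s) (j.eval s) (e.eval s)) ≤ b) :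
    Runs p T (.setNat a i j e) 1 s S f b :=
  Runs.pure_step (fun _ => rfl) hS hf

theorem Runs.setReal {a : ℕ} {i j : NExpr} {e : RExpr} {s : Store} {S : Store → Prop}
    {f : Store → ENNReal} {b : ENNReal} (hS : S (s.setReal a (i.eval s) (j.eval s) (e.eval s)))
    (hf : f (s.setReal a (i.eval s) (j.eval s) (e.eval s)) ≤ b) :
    Runs p T (.setReal a i j e) 1 s S f b :=
  Runs.pure_step (fun _ => rfl) hS hf

theorem Runs.setNat_seq {a : ℕ} {i j e : NExpr} {c : Prog} {n : ℕ} {s : Store} {S : Store → Prop}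
    {f : Store → ENNReal} {b : ENNReal}
    (h : Runs p T c n (s.setNat a (i.eval s) (j.eval s) (e.eval s)) S f b) :
    Runs p T (.seq (.setNat a i j e) c) (n + 2) s S f b := by
  have := Runs.seq (c₁ := .setNat a i j e) (n₁ := 1) (n₂ := n) (s := s)
    (S₁ := fun s' => s' = s.setNat a (i.eval s) (j.eval s) (e.eval s)) (g := fun _ => b) (b := b)
    (Runs.setNat rfl le_rfl) (by rintro _ rfl; exact h)
  exact this.conseq (by omega) (fun _ h => h) (fun _ _ => le_rfl) le_rfl

theorem Runs.setReal_seq {a : ℕ} {i j : NExpr} {e : RExpr} {c : Prog} {n : ℕ} {s : Store}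
    {S : Store → Prop} {f : Store → ENNReal} {b : ENNReal}
    (h : Runs p T c n (s.setReal a (i.eval s) (j.eval s) (e.eval s)) S f b) :
    Runs p T (.seq (.setReal a i j e) c) (n + 2) s S f b := by
  have := Runs.seq (c₁ := .setReal a i j e) (n₁ := 1) (n₂ := n) (s := s)
    (S₁ := fun s' => s' = s.setReal a (i.eval s) (j.eval s) (e.eval s)) (g := fun _ => b) (b := b)
    (Runs.setReal rfl le_rfl) (by rintro _ rfl; exact h)
  exact this.conseq (by omega) (fun _ h => h) (fun _ _ => le_rfl) le_rfl

theorem Runs.of_reach_pure {c c' : Prog} {n : ℕ} {s : Store} {S : Store → Prop}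
    {f : Store → ENNReal} {b : ENNReal}
    (hstep : ∀ k, CondSampling.step p T (c :: k, s) = PMF.pure (c' :: k, s))
    (h : Runs p T c' n s S f b) : Runs p T c (n + 1) s S f b := by
  obtain ⟨μ, hμ, hS, hb⟩ := h
  refine ⟨μ, fun k => ?_, hS, hb⟩
  have h0 : Reach p T 1 (c :: k, s) (PMF.pure (c' :: k, s)) := by
    rw [← hstep k]
    exact Reach.step p T _
  have h1 := h0.trans (n := n) (ξ := fun _ => μ.map fun s' => (k, s')) (by
    intro e he
    obtain rfl : e = (c' :: k, s) := by simpa using he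
    exact hμ k)
  rw [PMF.pure_bind, add_comm] at h1
  exact h1

theorem Runs.ite {t : Test} {c₁ c₂ : Prog} {n : ℕ} {s : Store} {S : Store → Prop}
    {f : Store → ENNReal} {b : ENNReal} (h₁ : t.eval s → Runs p T c₁ n s S f b)
    (h₂ : ¬ t.eval s → Runs p T c₂ n s S f b) : Runs p T (.ite t c₁ c₂) (n + 1) s S f b := by
  by_cases ht : t.eval s
  · exact Runs.of_reach_pure (fun k => by simp [CondSampling.step, ht]) (h₁ ht)
  · exact Runs.of_reach_pure (fun k => by simp [CondSampling.step, ht]) (h₂ ht)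

theorem Runs.loop_false {t : Test} {c : Prog} {s : Store} {S : Store → Prop}
    {f : Store → ENNReal} {b : ENNReal} (ht : ¬ t.eval s) (hS : S s) (hf : f s ≤ b) :
    Runs p T (.loop t c) 1 s S f b :=
  Runs.pure_step (fun k => by simp [CondSampling.step, ht]) hS hf

theorem Runs.loop_true {t : Test} {c : Prog} {n₁ n₂ : ℕ} {s : Store} {S₁ S₂ : Store → Prop}
    {f g : Store → ENNReal} {b : ENNReal} (ht : t.eval s) (h₁ : Runs p T c n₁ s S₁ g b)
    (h₂ : ∀ s', S₁ s' → Runs p T (.loop t c) n₂ s' S₂ f (g s')) :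
    Runs p T (.loop t c) (1 + n₁ + n₂) s S₂ f b := by
  obtain ⟨μ, hμ, hS, hb⟩ := Runs.seq h₁ h₂
  refine ⟨μ, fun k => ?_, hS, hb⟩
  intro d hd
  have := hμ k d hd
  rw [← this]
  have e : 1 + n₁ + n₂ + d = (n₁ + n₂ + d) + 1 := by ring
  rw [e]
  -- A loop whose test holds and the sequence of its body with the loop reach the same configuration
  -- in one step.
  simp only [run, CondSampling.step, ht, if_true]

/-- A loop whose potential decreases in expectation. -/
theorem Runs.loop {t : Test} {c : Prog} {n K : ℕ} {I : ℕ → Store → Prop} {g : ℕ → Store → ENNReal}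
    (ht : ∀ i s, i ≤ K → I i s → (t.eval s ↔ i < K))
    (hc : ∀ i s, i < K → I i s → Runs p T c n s (I (i + 1)) (g (i + 1)) (g i s)) (i : ℕ)
    (hi : i ≤ K) (s : Store) (hs : I i s) :
    Runs p T (.loop t c) ((K - i) * (n + 1) + 1) s (I K) (g K) (g i s) := by
  induction h : K - i generalizing i s with
  | zero =>
    obtain rfl : i = K := by omega
    have : ¬ t.eval s := by rw [ht i s le_rfl hs]; omega
    simpa using Runs.loop_false (c := c) this hs le_rfl
  | succ d ih =>
    have hiK : i < K := by omega
    have := Runs.loop_true ((ht i s hi hs).2 hiK) (hc i s hiK hs)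
      (fun s' hs' => ih (i + 1) (by omega) s' hs' (by omega))
    exact this.conseq (by rw [add_mul]; omega) (fun _ h => h) (fun _ _ => le_rfl) le_rfl

theorem Runs.query {a : ℕ} {i n : NExpr} {a' : ℕ} {i' : NExpr} {s : Store} {S : Store → Prop}
    {f : Store → ENNReal} {b : ENNReal} (h : List (Fin O)) (hn : h.length = n.eval s)
    (hT : h.length ≤ T) (hrow : ∀ j (hj : j < h.length), s.nat a (i.eval s) j = h[j])
    (hS : ∀ l ∈ (futureLaw p h (T - h.length)).support, S (s.writeSeq a' (i'.eval s) l))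
    (hf : ex (futureLaw p h (T - h.length)) (fun l => f (s.writeSeq a' (i'.eval s) l)) ≤ b) :
    Runs p T (.query a i n a' i') 1 s S f b := by
  have hv : n.eval s ≤ T ∧ ∀ j : Fin (n.eval s), s.nat a (i.eval s) j < O :=
    ⟨hn ▸ hT, fun j => by rw [hrow j (j.2.trans_eq hn.symm)]; exact Fin.is_lt _⟩
  have hh : (List.ofFn fun j : Fin (n.eval s) => (⟨s.nat a (i.eval s) j, hv.2 j⟩ : Fin O)) = h := by
    apply List.ext_getElem
    · simp [hn]
    · intro j h1 h2
      rw [List.getElem_ofFn]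
      exact Fin.ext (hrow j h2)
  refine ⟨(futureLaw p h (T - h.length)).map fun l => s.writeSeq a' (i'.eval s) l,
    fun k => ?_, ?_, ?_⟩
  · have := Reach.step p T (.query a i n a' i' :: k, s)
    simp only [CondSampling.step, dif_pos hv] at this
    rw [PMF.map_comp]
    rw [hh, ← hn] at this
    exact this
  · intro s' hs'
    rw [PMF.mem_support_map_iff] at hs'
    obtain ⟨l, hl, rfl⟩ := hs'
    exact hS l hl
  · rwa [ex_map]

/-- The counting loop: the cell `(0, 0)` of the array `a` runs from `0` to `K - 1`. -/
def forLoop (a : ℕ) (t : Test) (c : Prog) : Prog :=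
  .seq (.setNat a (.lit 0) (.lit 0) (.lit 0))
    (.loop t (.seq c (.setNat a (.lit 0) (.lit 0) (.plus (.cell a (.lit 0) (.lit 0)) (.lit 1)))))

theorem Store.setNat_same (s : Store) (a i j v : ℕ) : (s.setNat a i j v).nat a i j = v := by
  simp [Store.setNat]

/-- Invariant and potential must ignore the counter cell, and the body must return it unchanged;
then resetting and incrementing it disturb neither. -/
theorem Runs.forLoop {a : ℕ} {t : Test} {c : Prog} {n K : ℕ} {I : ℕ → Store → Prop}
    {g : ℕ → Store → ENNReal} {s : Store}
    (ht : ∀ i s, i ≤ K → I i s → s.nat a 0 0 = i → (t.eval s ↔ i < K))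
    (hI : ∀ i s v, I i s → I i (s.setNat a 0 0 v))
    (hg : ∀ i s v, g i (s.setNat a 0 0 v) = g i s)
    (hs : I 0 s)
    (hc : ∀ i s, i < K → I i s → s.nat a 0 0 = i →
      Runs p T c n s (fun s' => I (i + 1) s' ∧ s'.nat a 0 0 = i) (g (i + 1)) (g i s)) :
    Runs p T (forLoop a t c) (K * (n + 3) + 3) s (fun s' => I K s' ∧ s'.nat a 0 0 = K)
      (g K) (g 0 s) := by
  have hs0 := Runs.loop (p := p) (T := T) (t := t) (n := n + 2) (K := K)
    (c := .seq c (.setNat a (.lit 0) (.lit 0) (.plus (.cell a (.lit 0) (.lit 0)) (.lit 1))))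
    (I := fun i s => I i s ∧ s.nat a 0 0 = i) (g := g)
    (fun i s hi h => ht i s hi h.1 h.2)
    (fun i s hi h => by
      have h1 := Runs.seq (hc i s hi h.1 h.2) (n₂ := 1) (f := g (i + 1))
        (c₂ := .setNat a (.lit 0) (.lit 0) (.plus (.cell a (.lit 0) (.lit 0)) (.lit 1)))
        (S₂ := fun s' => I (i + 1) s' ∧ s'.nat a 0 0 = i + 1)
        (fun s' hs' => Runs.setNat ⟨hI _ _ _ hs'.1, by simp [NExpr.eval, Store.setNat, hs'.2]⟩
          (hg _ _ _).le)
      exact h1.conseq (by omega) (fun _ h => h) (fun _ _ => le_rfl) le_rfl)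
    0 (Nat.zero_le _) (s.setNat a 0 0 0) ⟨hI _ _ _ hs, Store.setNat_same _ _ _ _ _⟩
  have := Runs.setNat_seq (a := a) (i := .lit 0) (j := .lit 0) (e := .lit 0) hs0
  exact this.conseq (by simp [add_assoc]) (fun _ h => h) (fun _ _ => le_rfl) (hg _ _ _).le

/-- The total-correctness part of a terminating run. -/
theorem Runs.halts {c : Prog} {n : ℕ} {s : Store} {S : Store → Prop} {f : Store → ENNReal}
    {b : ENNReal} (h : Runs p T c n s S f b) : HaltsWithin p T c s n := by
  obtain ⟨μ, hμ, -, -⟩ := h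
  have hd : ∀ c' ∈ (μ.map fun s' => (([] : List Prog), s')).support, SurelyHalts p T 0 c' := by
    intro c' hc' c'' hc''
    rw [PMF.mem_support_map_iff] at hc'
    obtain ⟨s', -, rfl⟩ := hc'
    obtain rfl : c'' = ([], s') := by simpa [run] using hc''
    rfl
  have h0 := hμ [] 0 hd
  intro cfg hcfg
  rw [add_zero] at h0
  rw [h0, PMF.mem_support_bind_iff] at hcfg
  obtain ⟨c', hc', hcfg⟩ := hcfg
  exact hd c' hc' cfg hcfg

/-- Markov's inequality: `f` dominates the indicator of the complement of `E`. -/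
theorem Runs.le_haltProb {c : Prog} {n : ℕ} {s : Store} {S : Store → Prop} {f : Store → ENNReal}
    {b : ENNReal} {E : Set Store} (h : Runs p T c n s S f b)
    (hE : ∀ s', S s' → s' ∉ E → 1 ≤ f s') : 1 - b ≤ haltProb p T c s n E := by
  classical
  obtain ⟨μ, hμ, hS, hb⟩ := h
  have hrun : run p T n ([c], s) = μ.map fun s' => (([] : List Prog), s') := by
    have h0 := hμ [] 0 (by
      intro c' hc' c'' hc''
      rw [PMF.mem_support_map_iff] at hc'
      obtain ⟨s', -, rfl⟩ := hc'
      obtain rfl : c'' = ([], s') := by simpa [run] using hc''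
      rfl)
    rw [add_zero] at h0
    rw [h0]
    exact PMF.bind_pure _
  rw [haltProb, hrun, PMF.toOuterMeasure_map_apply]
  have hset : (fun s' => (([] : List Prog), s')) ⁻¹' {cfg : Config | cfg.1 = [] ∧ cfg.2 ∈ E}
      = E := by
    ext s'
    simp
  rw [hset, PMF.toOuterMeasure_apply]
  rw [tsub_le_iff_right]
  calc (1 : ENNReal) = ∑' s', μ s' := μ.tsum_coe.symm
    _ ≤ ∑' s', (E.indicator μ s' + μ s' * f s') := by
        refine ENNReal.tsum_le_tsum fun s' => ?_
        by_cases hs' : s' ∈ E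
        · simp [hs']
        · by_cases hm : s' ∈ μ.support
          · calc μ s' = μ s' * 1 := (mul_one _).symm
              _ ≤ μ s' * f s' := mul_le_mul_right (hE s' (hS s' hm) hs') _
              _ ≤ _ := le_add_self
          · rw [PMF.mem_support_iff, not_not] at hm
            simp [hm]
    _ = ∑' s', E.indicator μ s' + ex μ f := ENNReal.tsum_add
    _ ≤ _ := by gcongr

end Semantics

/-! ### The conditional laws -/

section Laws

variable {O : ℕ} (p : List (Fin O) → PMF (Fin O))

theorem ex_futureLaw_succ (h : List (Fin O)) (k : ℕ) (φ : List (Fin O) → ENNReal) :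
    ex (futureLaw p h (k + 1)) φ =
      ex (p h) fun o => ex (futureLaw p (h ++ [o]) k) fun l => φ (o :: l) := by
  simp only [futureLaw, ex_bind, ex_map]

theorem ex_futureLaw_head (h : List (Fin O)) (k : ℕ) (ψ : List (Fin O) → ENNReal)
    (φ : Fin O → ENNReal) (hψ : ∀ o l, ψ (o :: l) = φ o) :
    ex (futureLaw p h (k + 1)) ψ = ex (p h) φ := by
  simp only [ex_futureLaw_succ, hψ, ex_const]

theorem ex_futureLaw_take (h : List (Fin O)) (a b : ℕ) (φ : List (Fin O) → ENNReal) :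
    ex (futureLaw p h (a + b)) (fun l => φ (l.take a)) = ex (futureLaw p h a) φ := by
  induction a generalizing h φ with
  | zero => simp [futureLaw, ex_pure, ex_const]
  | succ a ih =>
    rw [Nat.succ_add]
    simp only [ex_futureLaw_succ, List.take_succ_cons]
    congr 1
    funext o
    exact ih (h ++ [o]) fun l => φ (o :: l)

theorem length_of_mem_futureLaw {h : List (Fin O)} {k : ℕ} {l : List (Fin O)}
    (hl : l ∈ (futureLaw p h k).support) : l.length = k := by
  induction k generalizing h l with
  | zero =>
    obtain rfl : l = [] := by simpa [futureLaw] using hl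
    rfl
  | succ k ih =>
    simp only [futureLaw, PMF.mem_support_bind_iff, PMF.mem_support_map_iff] at hl
    obtain ⟨o, -, l', hl', rfl⟩ := hl
    simp [ih hl']

theorem futureLaw_ofFn (h : List (Fin O)) {k : ℕ} (f : Fin k → Fin O) :
    futureLaw p h k (List.ofFn f) = ENNReal.ofReal (condProb p h (List.ofFn f)) := by
  rw [condProb, ENNReal.ofReal_toReal (PMF.apply_ne_top _ _), List.length_ofFn]

theorem ex_futureLaw (h : List (Fin O)) (k : ℕ) (φ : List (Fin O) → ENNReal) :
    ex (futureLaw p h k) φ =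
      ∑ f : Fin k → Fin O, ENNReal.ofReal (condProb p h (List.ofFn f)) * φ (List.ofFn f) := by
  have hinj : Function.Injective (List.ofFn : (Fin k → Fin O) → List (Fin O)) :=
    List.ofFn_injective
  rw [ex, ← hinj.tsum_eq, tsum_fintype]
  · simp only [futureLaw_ofFn]
  · intro l hl
    have hl' : l ∈ (futureLaw p h k).support := by
      rw [PMF.mem_support_iff]
      exact left_ne_zero_of_mul hl
    obtain rfl := length_of_mem_futureLaw p hl'
    exact ⟨l.get, List.ofFn_get l⟩

theorem condProb_nonneg (h l : List (Fin O)) : 0 ≤ condProb p h l := ENNReal.toReal_nonneg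

theorem sum_condProb (h : List (Fin O)) (k : ℕ) :
    ∑ f : Fin k → Fin O, condProb p h (List.ofFn f) = 1 := by
  have := ex_futureLaw p h k fun _ => 1
  rw [ex_const] at this
  simp only [mul_one] at this
  rw [← ENNReal.ofReal_sum_of_nonneg fun _ _ => condProb_nonneg p _ _] at this
  have h2 := congrArg ENNReal.toReal this
  rw [ENNReal.toReal_ofReal (Finset.sum_nonneg fun _ _ => condProb_nonneg p _ _)] at h2
  simpa using h2.symm

theorem condProb_le_one (h l : List (Fin O)) : condProb p h l ≤ 1 := by
  have := (futureLaw p h l.length).coe_le_one l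
  exact ENNReal.toReal_le_of_le_ofReal zero_le_one (by simpa using this)

theorem condProb_append (h l l' : List (Fin O)) :
    condProb p h (l ++ l') = condProb p h l * condProb p (h ++ l) l' := by
  induction l generalizing h with
  | nil => simp [condProb_nil]
  | cons o l ih => simp [condProb_cons, ih, mul_assoc]

theorem condProb_concat (h l : List (Fin O)) (o : Fin O) :
    condProb p h (l ++ [o]) = condProb p h l * (p (h ++ l) o).toReal := by
  rw [condProb_append, condProb_cons, condProb_nil, mul_one]

variable {p} in
theorem IsRegular.pow_le_condProb {T : ℕ} {α : ℝ} (hp : IsRegular p T α) (hα : 0 ≤ α)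
    (h l : List (Fin O)) (hl : h.length + l.length ≤ T) (hne : condProb p h l ≠ 0) :
    α ^ l.length ≤ condProb p h l := by
  induction l generalizing h with
  | nil => simp [condProb_nil]
  | cons o l ih =>
    rw [condProb_cons] at hne ⊢
    rw [List.length_cons, pow_succ, mul_comm]
    have h1 : p h o ≠ 0 := by
      rintro h0
      simp [h0] at hne
    have hlen : (o :: l).length = l.length + 1 := rfl
    refine mul_le_mul (hp h (by omega) o h1) (ih _ ?_ (right_ne_zero_of_mul hne)) (by positivity)
      ENNReal.toReal_nonneg
    simp only [List.length_append, List.length_singleton]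
    omega

theorem ex_ite_eq (μ : PMF (Fin O)) (o : Fin O) {a b : ℝ} (ha : 0 ≤ a) (hb : 0 ≤ b) :
    ex μ (fun o' => if o' = o then ENNReal.ofReal a else ENNReal.ofReal b) =
      ENNReal.ofReal ((μ o).toReal * a + (1 - (μ o).toReal) * b) := by
  have hsum : ∑ o' : Fin O, (μ o').toReal = 1 := by
    have := μ.tsum_coe
    rw [tsum_fintype] at this
    rw [← ENNReal.toReal_sum fun o' _ => μ.apply_ne_top o', this]
    rfl
  have h1 : ∀ o', μ o' * (if o' = o then ENNReal.ofReal a else ENNReal.ofReal b) =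
      ENNReal.ofReal ((μ o').toReal * if o' = o then a else b) := by
    intro o'
    rw [ENNReal.ofReal_mul ENNReal.toReal_nonneg, ENNReal.ofReal_toReal (μ.apply_ne_top o')]
    split_ifs <;> rfl
  simp only [ex, h1]
  rw [tsum_fintype, ← ENNReal.ofReal_sum_of_nonneg]
  · congr 1
    rw [← Finset.add_sum_erase _ _ (Finset.mem_univ o)] at hsum ⊢
    have h2 : ∀ o' ∈ Finset.univ.erase o, (μ o').toReal * (if o' = o then a else b) =
        (μ o').toReal * b := by
      intro o' ho'
      rw [if_neg (Finset.ne_of_mem_erase ho')]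
    rw [Finset.sum_congr rfl h2, ← Finset.sum_mul, if_pos rfl, ← hsum]
    ring
  · intro o' _
    split_ifs <;> positivity

theorem toReal_pmf_le_one {A : Type} (μ : PMF A) (a : A) : (μ a).toReal ≤ 1 :=
  ENNReal.toReal_le_of_le_ofReal zero_le_one (by simpa using μ.coe_le_one a)

end Laws

/-! ### Indicators -/

open Classical in
/-- The indicator of a proposition. -/
def ind (A : Prop) : ENNReal := if A then 1 else 0

theorem ind_of {A : Prop} (h : A) : ind A = 1 := by simp [ind, h]

theorem ind_of_not {A : Prop} (h : ¬ A) : ind A = 0 := by simp [ind, h]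

theorem ind_le_one (A : Prop) : ind A ≤ 1 := by
  by_cases h : A <;> simp [ind, h]

theorem ind_le {A : Prop} {x : ENNReal} (h : A → 1 ≤ x) : ind A ≤ x := by
  by_cases hA : A
  · rw [ind_of hA]
    exact h hA
  · simp [ind_of_not hA]

theorem ind_mono {A B : Prop} (h : A → B) : ind A ≤ ind B :=
  ind_le fun hA => (ind_of (h hA)).ge

theorem ind_or_le (A B : Prop) : ind (A ∨ B) ≤ ind A + ind B :=
  ind_le fun h => by
    rcases h with h | h
    · simp [ind_of h]
    · simp [ind_of h]

/-! ### The determinant potential -/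

section Potential

open Matrix

/-- The determinant is the product of 1 + λ over the eigenvalues; at most r of them are nonzero, and
each is at most the trace. -/
theorem det_one_add_le {F : Type} [Fintype F] [DecidableEq F] {X : Matrix F F ℝ}
    (hX : X.PosSemidef) {r : ℕ} (hr : X.rank ≤ r) : (1 + X).det ≤ (1 + X.trace) ^ r := by
  have hdet : (1 + X).det = ∏ i, (1 + hX.1.eigenvalues i) := by
    -- The characteristic polynomial at -1 is det(1 + X) up to the sign (-1)^|F|, which cancels.
    have h1 := Matrix.eval_charpoly X (-1)
    rw [hX.1.charpoly_eq, Polynomial.eval_prod] at h1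
    have h2 : scalar F (-1 : ℝ) - X = -(1 + X) := by
      rw [map_neg, map_one]
      abel
    rw [h2, det_neg] at h1
    have h3 : ∏ i, Polynomial.eval (-1 : ℝ) (Polynomial.X - Polynomial.C (hX.1.eigenvalues i : ℝ)) =
        (-1) ^ Fintype.card F * ∏ i, (1 + hX.1.eigenvalues i) := by
      rw [← Finset.card_univ, ← Finset.prod_const, ← Finset.prod_mul_distrib]
      refine Finset.prod_congr rfl fun i _ => ?_
      simp
      ring
    have h4 := h3.symm.trans h1
    exact (mul_left_cancel₀ (pow_ne_zero _ (by norm_num)) h4).symm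
  have htr : X.trace = ∑ i, hX.1.eigenvalues i := by
    simpa using hX.1.trace_eq_sum_eigenvalues
  have h0 := hX.eigenvalues_nonneg
  have hle : ∀ i, hX.1.eigenvalues i ≤ X.trace := fun i => by
    rw [htr]
    exact Finset.single_le_sum (fun j _ => h0 j) (Finset.mem_univ i)
  have htr0 : 0 ≤ X.trace := hX.trace_nonneg
  rw [hdet, ← Finset.prod_filter_mul_prod_filter_not Finset.univ
    (fun i => hX.1.eigenvalues i ≠ 0)]
  have h1 : ∏ i ∈ Finset.univ.filter (fun i => ¬ hX.1.eigenvalues i ≠ 0),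
      (1 + hX.1.eigenvalues i) = 1 := by
    refine Finset.prod_eq_one fun i hi => ?_
    have := (Finset.mem_filter.1 hi).2
    rw [not_not] at this
    simp [this]
  rw [h1, mul_one]
  calc ∏ i ∈ Finset.univ.filter (fun i => hX.1.eigenvalues i ≠ 0), (1 + hX.1.eigenvalues i)
      ≤ ∏ _i ∈ Finset.univ.filter (fun i => hX.1.eigenvalues i ≠ 0), (1 + X.trace) := by
        refine Finset.prod_le_prod (fun i _ => by linarith [h0 i]) fun i _ => by linarith [hle i]
    _ = (1 + X.trace) ^ X.rank := by
        rw [Finset.prod_const, hX.1.rank_eq_card_non_zero_eigs, Fintype.card_subtype]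
    _ ≤ _ := pow_le_pow_right₀ (by linarith) hr

theorem posSemidef_sum_vecMulVec {F : Type} [Fintype F] {c : ℝ} (hc : 0 ≤ c) (v : ℕ → F → ℝ) (i : ℕ) :
    (c • ∑ j ∈ Finset.range i, vecMulVec (v j) (v j)).PosSemidef := by
  refine PosSemidef.smul (Matrix.posSemidef_sum _ fun j _ => ?_) hc
  simpa using posSemidef_vecMulVec_self_star (v j)

variable {F : Type} [Fintype F] [DecidableEq F]

/-- The regularized second-moment matrix of the first `i` vectors. -/
def moment (c : ℝ) (v : ℕ → F → ℝ) (i : ℕ) : Matrix F F ℝ :=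
  1 + c • ∑ j ∈ Finset.range i, vecMulVec (v j) (v j)

theorem moment_posDef {c : ℝ} (hc : 0 ≤ c) (v : ℕ → F → ℝ) (i : ℕ) : (moment c v i).PosDef :=
  PosDef.one.add_posSemidef (posSemidef_sum_vecMulVec hc v i)

theorem moment_mulVec (c : ℝ) (v : ℕ → F → ℝ) (i : ℕ) (w : F → ℝ) :
    moment c v i *ᵥ w = w + ∑ j ∈ Finset.range i, (c * (v j ⬝ᵥ w)) • v j := by
  simp only [moment, add_mulVec, one_mulVec, smul_mulVec, sum_mulVec, vecMulVec_mulVec,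
    Finset.smul_sum]
  congr 1
  refine Finset.sum_congr rfl fun j _ => ?_
  ext f
  simp
  ring

/-- By the matrix determinant lemma the determinant grows by the factor 1 + μ⁻¹ vᵀA⁻¹v. With w =
A⁻¹v and β_j = μ⁻¹⟨v_j, w⟩, the equation Aw = v says that w is the residual of v after subtracting ∑
β_j v_j, and μ⁻¹ vᵀA⁻¹v = μ⁻¹‖w‖² + ‖β‖². If this were below one, β would be a short coefficient
vector with residual below μ. -/
theorem two_mul_det_moment_le {v : ℕ → F → ℝ} {i : ℕ} {μ : ℝ} (hμ : 0 < μ)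
    (hs : ∀ β : ℕ → ℝ, ∑ j ∈ Finset.range i, β j ^ 2 ≤ 1 →
      μ ≤ ∑ f, (v i f - ∑ j ∈ Finset.range i, β j * v j f) ^ 2) :
    2 * (moment μ⁻¹ v i).det ≤ (moment μ⁻¹ v (i + 1)).det := by
  have hA := moment_posDef (inv_nonneg.2 hμ.le) v i
  set A := moment μ⁻¹ v i with hAdef
  have hunit : IsUnit A.det := isUnit_iff_ne_zero.2 hA.det_pos.ne'
  have hstep : moment μ⁻¹ v (i + 1) =
      A + replicateCol Unit (μ⁻¹ • v i) * replicateRow Unit (v i) := by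
    rw [hAdef, moment, moment, Finset.sum_range_succ, smul_add, add_assoc,
      ← vecMulVec_eq, smul_vecMulVec]
  rw [hstep, det_add_replicateCol_mul_replicateRow hunit, mul_comm]
  refine mul_le_mul_of_nonneg_left ?_ hA.det_pos.le
  set w := A⁻¹ *ᵥ v i with hw
  have hq : (1 + replicateRow Unit (v i) * A⁻¹ * replicateCol Unit (μ⁻¹ • v i)).det =
      1 + μ⁻¹ * (v i ⬝ᵥ w) := by
    rw [det_unique, Matrix.mul_assoc, ← replicateCol_mulVec, mulVec_smul]
    simp [Matrix.mul_apply, dotProduct, hw, Finset.mul_sum]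
  rw [hq]
  have hAw : v i = w + ∑ j ∈ Finset.range i, (μ⁻¹ * (v j ⬝ᵥ w)) • v j := by
    rw [← moment_mulVec, ← hAdef, hw, mulVec_mulVec, mul_nonsing_inv _ hunit, one_mulVec]
  have hres : ∀ f, v i f - ∑ j ∈ Finset.range i, (μ⁻¹ * (v j ⬝ᵥ w)) * v j f = w f := by
    intro f
    have := congrFun hAw f
    simp only [Pi.add_apply, Finset.sum_apply, Pi.smul_apply, smul_eq_mul] at this
    linarith
  have hdot : μ⁻¹ * (v i ⬝ᵥ w) = μ⁻¹ * ∑ f, w f ^ 2 +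
      ∑ j ∈ Finset.range i, (μ⁻¹ * (v j ⬝ᵥ w)) ^ 2 := by
    conv_lhs => rw [hAw]
    rw [add_dotProduct, sum_dotProduct, mul_add, Finset.mul_sum]
    congr 1
    · congr 1
      exact Finset.sum_congr rfl fun _ _ => (sq _).symm
    · refine Finset.sum_congr rfl fun j _ => ?_
      rw [smul_dotProduct, smul_eq_mul]
      ring
  by_contra hlt
  have hq1 : μ⁻¹ * (v i ⬝ᵥ w) < 1 := by linarith
  have hw0 : 0 ≤ μ⁻¹ * ∑ f, w f ^ 2 := by positivity
  have hb0 : 0 ≤ ∑ j ∈ Finset.range i, (μ⁻¹ * (v j ⬝ᵥ w)) ^ 2 := by positivity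
  have := hs (fun j => μ⁻¹ * (v j ⬝ᵥ w)) (by linarith)
  simp only [hres] at this
  have h2 : μ⁻¹ * μ ≤ μ⁻¹ * ∑ f, w f ^ 2 := by gcongr
  rw [inv_mul_cancel₀ hμ.ne'] at h2
  linarith

/-- The determinant is squeezed between the m doublings and the bound by rank and trace;
unit-bounded vectors give trace at most m/μ. -/
theorem two_pow_le_of_spread {v : ℕ → F → ℝ} {m r : ℕ} {μ : ℝ} (hμ : 0 < μ)
    (hnorm : ∀ i < m, ∑ f, v i f ^ 2 ≤ 1)
    (hrank : (Matrix.of fun (f : F) (j : Fin m) => v j f).rank ≤ r)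
    (hs : ∀ i < m, ∀ β : ℕ → ℝ, ∑ j ∈ Finset.range i, β j ^ 2 ≤ 1 →
      μ ≤ ∑ f, (v i f - ∑ j ∈ Finset.range i, β j * v j f) ^ 2) :
    (2 : ℝ) ^ m ≤ (1 + m / μ) ^ r := by
  have hlow : ∀ i ≤ m, (2 : ℝ) ^ i ≤ (moment μ⁻¹ v i).det := by
    intro i
    induction i with
    | zero => simp [moment]
    | succ i ih =>
      intro hi
      have := two_mul_det_moment_le hμ (hs i (by omega))
      have := ih (by omega)
      rw [pow_succ']
      linarith
  have hps := posSemidef_sum_vecMulVec (inv_nonneg.2 hμ.le) v m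
  set V : Matrix F (Fin m) ℝ := Matrix.of fun f j => v j f with hV
  have hVV : ∑ j ∈ Finset.range m, vecMulVec (v j) (v j) = V * Vᵀ := by
    ext f g
    simp only [Matrix.sum_apply, vecMulVec_apply, Matrix.mul_apply, hV, transpose_apply, of_apply]
    exact Finset.sum_range fun j => v j f * v j g
  have hrk : (μ⁻¹ • ∑ j ∈ Finset.range m, vecMulVec (v j) (v j)).rank ≤ r := by
    rw [hVV, ← Matrix.mul_smul]
    exact ((rank_mul_le _ _).trans (min_le_left _ _)).trans hrank
  have htr : (μ⁻¹ • ∑ j ∈ Finset.range m, vecMulVec (v j) (v j)).trace ≤ m / μ := by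
    rw [trace_smul, trace_sum, smul_eq_mul, div_eq_inv_mul]
    gcongr
    calc ∑ j ∈ Finset.range m, (vecMulVec (v j) (v j)).trace
        ≤ ∑ j ∈ Finset.range m, (1 : ℝ) := by
          refine Finset.sum_le_sum fun j hj => ?_
          have := hnorm j (Finset.mem_range.1 hj)
          rw [trace_vecMulVec, dotProduct]
          simpa [sq] using this
      _ = m := by simp
  calc (2 : ℝ) ^ m ≤ (moment μ⁻¹ v m).det := hlow m le_rfl
    _ ≤ _ := det_one_add_le hps hrk
    _ ≤ _ := by
        have := hps.trace_nonneg
        gcongr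

end Potential

/-! ### Ridge regression by elimination -/

section Elimination

/-- The quadratic form of a matrix, on the first `n` coordinates. -/
def quad (n : ℕ) (G : ℕ → ℕ → ℝ) (w : ℕ → ℝ) : ℝ :=
  ∑ j ∈ Finset.range n, ∑ l ∈ Finset.range n, w j * w l * G j l

/-- Regularized symmetric elimination of the first `i` coordinates. -/
def elim (c : ℝ) (G : ℕ → ℕ → ℝ) : ℕ → ℕ → ℕ → ℝ
  | 0 => G
  | i + 1 => fun j l => elim c G i j l - elim c G i j i * elim c G i l i / (c + elim c G i i i)

theorem elim_symm {n : ℕ} {c : ℝ} {G : ℕ → ℕ → ℝ} (hG : ∀ j < n, ∀ l < n, G j l = G l j) (i : ℕ)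
    {j l : ℕ} (hj : j < n) (hl : l < n) : elim c G i j l = elim c G i l j := by
  induction i with
  | zero => exact hG j hj l hl
  | succ i ih =>
    simp only [elim, ih]
    ring

theorem quad_sub_single {n : ℕ} {G : ℕ → ℕ → ℝ} (hG : ∀ j < n, ∀ l < n, G j l = G l j) {i : ℕ}
    (hi : i < n) (w : ℕ → ℝ) (γ : ℝ) :
    quad n G (fun j => w j - if j = i then γ else 0) =
      quad n G w - 2 * γ * ∑ j ∈ Finset.range n, w j * G j i + γ ^ 2 * G i i := by
  have hmem : i ∈ Finset.range n := Finset.mem_range.2 hi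
  have h1 : quad n G (fun j => w j - if j = i then γ else 0) = quad n G w
      - (∑ j ∈ Finset.range n, ∑ l ∈ Finset.range n, w j * (if l = i then γ else 0) * G j l)
      - (∑ j ∈ Finset.range n, ∑ l ∈ Finset.range n, (if j = i then γ else 0) * w l * G j l)
      + ∑ j ∈ Finset.range n, ∑ l ∈ Finset.range n,
        (if j = i then γ else 0) * (if l = i then γ else 0) * G j l := by
    simp only [quad, ← Finset.sum_sub_distrib, ← Finset.sum_add_distrib]
    exact Finset.sum_congr rfl fun j _ => Finset.sum_congr rfl fun l _ => by ring
  have h2 : ∑ l ∈ Finset.range n, w l * G i l = ∑ j ∈ Finset.range n, w j * G j i :=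
    Finset.sum_congr rfl fun l hl => by rw [hG i hi l (Finset.mem_range.1 hl)]
  rw [h1]
  simp only [mul_ite, ite_mul, mul_zero, zero_mul, Finset.sum_ite_eq', hmem, if_true,
    Finset.sum_ite_irrel, Finset.sum_const_zero]
  have h3 : ∑ j ∈ Finset.range n, w j * γ * G j i = γ * ∑ j ∈ Finset.range n, w j * G j i := by
    rw [Finset.mul_sum]
    exact Finset.sum_congr rfl fun _ _ => by ring
  have h4 : ∑ j ∈ Finset.range n, γ * w j * G i j = γ * ∑ j ∈ Finset.range n, w j * G j i := by
    rw [← h2, Finset.mul_sum]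
    exact Finset.sum_congr rfl fun _ _ => by ring
  rw [h3, h4]
  ring

theorem quad_elim_succ {n : ℕ} {c : ℝ} {G : ℕ → ℕ → ℝ} (i : ℕ) (w : ℕ → ℝ) :
    quad n (elim c G (i + 1)) w = quad n (elim c G i) w -
      (∑ j ∈ Finset.range n, w j * elim c G i j i) ^ 2 / (c + elim c G i i i) := by
  rw [sq, Finset.sum_mul_sum, Finset.sum_div]
  simp only [quad, elim, Finset.sum_div, ← Finset.sum_sub_distrib]
  exact Finset.sum_congr rfl fun j _ => Finset.sum_congr rfl fun l _ => by ring

/-- Together with `quad_elim_le`: after i eliminations the quadratic form is the minimum over β of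
the ridge objective in the first i coordinates. Each elimination completes the square in one
coordinate. -/
theorem exists_quad_add_le {n : ℕ} {c : ℝ} (hc : 0 < c) {G : ℕ → ℕ → ℝ}
    (hG : ∀ j < n, ∀ l < n, G j l = G l j) (hpsd : ∀ w, 0 ≤ quad n G w) {i : ℕ} (hi : i ≤ n)
    (w : ℕ → ℝ) : ∃ β : ℕ → ℝ, quad n G (fun j => if j < i then w j - β j else w j) +
      c * ∑ j ∈ Finset.range i, β j ^ 2 ≤ quad n (elim c G i) w := by
  induction i generalizing w with
  | zero => exact ⟨0, by simp [elim]⟩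
  | succ i ih =>
    have hin : i < n := hi
    have hsymm : ∀ j < n, ∀ l < n, elim c G i j l = elim c G i l j :=
      fun j hj l hl => elim_symm hG i hj hl
    -- The pivot dominates a value of the nonnegative ridge objective, so the divisor c + pivot is
    -- positive.
    have hpos : 0 ≤ elim c G i i i := by
      obtain ⟨β, hβ⟩ := ih hin.le fun j => if j = i then 1 else 0
      have h1 := hpsd fun j => if j < i then (if j = i then 1 else 0) - β j
        else if j = i then 1 else 0
      have h2 : quad n (elim c G i) (fun j => if j = i then 1 else 0) = elim c G i i i := by
        simp [quad, hin]
      have h3 : 0 ≤ c * ∑ j ∈ Finset.range i, β j ^ 2 := by positivity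
      linarith
    set u := ∑ j ∈ Finset.range n, w j * elim c G i j i with hu
    set d := c + elim c G i i i with hd
    have hd0 : 0 < d := by linarith
    -- The minimizer of the quadratic polynomial in the coefficient of coordinate i.
    set γ := u / d with hγ
    have hγd : γ * d = u := by rw [hγ, div_mul_cancel₀ _ hd0.ne']
    obtain ⟨β, hβ⟩ := ih hin.le fun j => w j - if j = i then γ else 0
    refine ⟨fun j => if j = i then γ else β j, ?_⟩
    rw [quad_elim_succ, ← hu, ← hd]
    rw [quad_sub_single hsymm hin, ← hu] at hβ
    have h1 : (fun j => if j < i + 1 then w j - (if j = i then γ else β j) else w j) =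
        fun j => if j < i then (w j - if j = i then γ else 0) - β j
          else w j - if j = i then γ else 0 := by
      funext j
      rcases lt_trichotomy j i with h | h | h
      · simp [h, h.ne, Nat.lt_succ_of_lt h]
      · simp [h]
      · simp [h.ne', not_lt.2 h.le, show ¬ j < i + 1 by omega]
    have h2 : ∑ j ∈ Finset.range (i + 1), (if j = i then γ else β j) ^ 2 =
        ∑ j ∈ Finset.range i, β j ^ 2 + γ ^ 2 := by
      rw [Finset.sum_range_succ, if_pos rfl]
      congr 1
      exact Finset.sum_congr rfl fun j hj => by rw [if_neg (Finset.mem_range.1 hj).ne]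
    rw [h1, h2]
    have h3 : u ^ 2 / d = γ * u := by rw [hγ]; ring
    have h4 : elim c G i i i = d - c := by rw [hd]; ring
    rw [h3]
    rw [h4] at hβ
    have h5 : γ ^ 2 * (d - c) = γ * u - c * γ ^ 2 := by rw [← hγd]; ring
    rw [h5] at hβ
    linarith

/-- An arbitrary coefficient β_i exceeds the minimum of its quadratic polynomial by (u - β_i d)² / d
≥ 0. -/
theorem quad_elim_le {n : ℕ} {c : ℝ} (hc : 0 < c) {G : ℕ → ℕ → ℝ}
    (hG : ∀ j < n, ∀ l < n, G j l = G l j) (hpsd : ∀ w, 0 ≤ quad n G w) {i : ℕ} (hi : i ≤ n)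
    (w β : ℕ → ℝ) : quad n (elim c G i) w ≤
      quad n G (fun j => if j < i then w j - β j else w j) +
        c * ∑ j ∈ Finset.range i, β j ^ 2 := by
  induction i generalizing w with
  | zero => simp [elim]
  | succ i ih =>
    have hin : i < n := hi
    have hsymm : ∀ j < n, ∀ l < n, elim c G i j l = elim c G i l j :=
      fun j hj l hl => elim_symm hG i hj hl
    have hpos : 0 ≤ elim c G i i i := by
      obtain ⟨β, hβ⟩ := exists_quad_add_le hc hG hpsd hin.le fun j => if j = i then 1 else 0
      have h1 := hpsd fun j => if j < i then (if j = i then 1 else 0) - β j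
        else if j = i then 1 else 0
      have h2 : quad n (elim c G i) (fun j => if j = i then 1 else 0) = elim c G i i i := by
        simp [quad, hin]
      have h3 : 0 ≤ c * ∑ j ∈ Finset.range i, β j ^ 2 := by positivity
      linarith
    have hβ := ih hin.le fun j => w j - if j = i then β i else 0
    rw [quad_sub_single hsymm hin] at hβ
    rw [quad_elim_succ]
    have h1 : (fun j => if j < i + 1 then w j - β j else w j) =
        fun j => if j < i then (w j - if j = i then β i else 0) - β j
          else w j - if j = i then β i else 0 := by
      funext j
      rcases lt_trichotomy j i with h | h | h
      · simp [h, h.ne, Nat.lt_succ_of_lt h]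
      · simp [h]
      · simp [h.ne', not_lt.2 h.le, show ¬ j < i + 1 by omega]
    rw [h1, Finset.sum_range_succ]
    set u := ∑ j ∈ Finset.range n, w j * elim c G i j i with hu
    set d := c + elim c G i i i with hd
    have hd0 : 0 < d := by linarith
    have h3 : 0 ≤ (u - β i * d) ^ 2 / d := by positivity
    have h4 : (u - β i * d) ^ 2 / d = u ^ 2 / d - 2 * β i * u + β i ^ 2 * d := by
      field_simp
      ring
    have h5 : elim c G i i i = d - c := by rw [hd]; ring
    rw [h5] at hβ
    linarith

/-- At the last unit vector the eliminated form is one diagonal entry: the ridge regression value of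
the last row on all others, which the program reads off. -/
theorem quad_single_last (m : ℕ) (G : ℕ → ℕ → ℝ) :
    quad (m + 1) G (fun j => if j = m then 1 else 0) = G m m := by
  simp [quad]

end Elimination

/-! ### The approximation test -/

section ApproxTest

variable {F : Type} [Fintype F]

/-- The Gram matrix of the first `n` vectors, weighted by the reciprocal of their sum. -/
def gram (n : ℕ) (v : ℕ → F → ℝ) (j l : ℕ) : ℝ :=
  ∑ f, v j f * v l f / ∑ k ∈ Finset.range n, v k f

theorem quad_gram (n : ℕ) (v : ℕ → F → ℝ) (w : ℕ → ℝ) :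
    quad n (gram n v) w =
      ∑ f, (∑ j ∈ Finset.range n, w j * v j f) ^ 2 / ∑ k ∈ Finset.range n, v k f := by
  simp only [quad, gram, Finset.mul_sum]
  rw [Finset.sum_congr rfl fun j _ => Finset.sum_comm, Finset.sum_comm]
  refine Finset.sum_congr rfl fun f _ => ?_
  rw [sq, Finset.sum_mul_sum, Finset.sum_div]
  refine Finset.sum_congr rfl fun j _ => ?_
  rw [Finset.sum_div]
  exact Finset.sum_congr rfl fun l _ => by ring

theorem abs_quad_sub_le {n : ℕ} {G H : ℕ → ℕ → ℝ} {e : ℝ}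
    (h : ∀ j < n, ∀ l < n, |G j l - H j l| ≤ e) (w : ℕ → ℝ) :
    |quad n G w - quad n H w| ≤ e * n * ∑ j ∈ Finset.range n, w j ^ 2 := by
  have h1 : quad n G w - quad n H w =
      ∑ j ∈ Finset.range n, ∑ l ∈ Finset.range n, w j * w l * (G j l - H j l) := by
    simp only [quad, ← Finset.sum_sub_distrib]
    exact Finset.sum_congr rfl fun j _ => Finset.sum_congr rfl fun l _ => by ring
  rcases Nat.eq_zero_or_pos n with rfl | hn
  · simp [quad]
  have he : 0 ≤ e := (abs_nonneg _).trans (h 0 hn 0 hn)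
  rw [h1]
  calc |∑ j ∈ Finset.range n, ∑ l ∈ Finset.range n, w j * w l * (G j l - H j l)|
      ≤ ∑ j ∈ Finset.range n, ∑ l ∈ Finset.range n, |w j| * |w l| * e := by
        refine (Finset.abs_sum_le_sum_abs _ _).trans (Finset.sum_le_sum fun j hj => ?_)
        refine (Finset.abs_sum_le_sum_abs _ _).trans (Finset.sum_le_sum fun l hl => ?_)
        rw [abs_mul, abs_mul]
        exact mul_le_mul_of_nonneg_left (h j (Finset.mem_range.1 hj) l (Finset.mem_range.1 hl))
          (by positivity)
    _ = e * (∑ j ∈ Finset.range n, |w j|) ^ 2 := by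
        rw [sq, Finset.sum_mul_sum, Finset.mul_sum]
        refine Finset.sum_congr rfl fun j _ => ?_
        rw [Finset.mul_sum]
        exact Finset.sum_congr rfl fun l _ => by ring
    _ ≤ e * (n * ∑ j ∈ Finset.range n, |w j| ^ 2) := by
        have := sq_sum_le_card_mul_sum_sq (s := Finset.range n) (f := fun j => |w j|)
        rw [Finset.card_range] at this
        exact mul_le_mul_of_nonneg_left this he
    _ = _ := by simp only [sq_abs]; ring

/-- Cauchy–Schwarz with the weights ∑_k v_k(f), whose total mass is n. Where a weight vanishes, all
the vectors vanish, so division by zero does no harm. -/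
theorem sq_sum_abs_le_quad_gram {n : ℕ} {v : ℕ → F → ℝ} (hv : ∀ j < n, ∀ f, 0 ≤ v j f)
    (hsum : ∀ j < n, ∑ f, v j f = 1) (w : ℕ → ℝ) :
    (∑ f, |∑ j ∈ Finset.range n, w j * v j f|) ^ 2 ≤ n * quad n (gram n v) w := by
  have hS : ∀ f, 0 ≤ ∑ k ∈ Finset.range n, v k f := fun f =>
    Finset.sum_nonneg fun k hk => hv k (Finset.mem_range.1 hk) f
  have h1 : ∑ f, ∑ k ∈ Finset.range n, v k f = (n : ℝ) := by
    rw [Finset.sum_comm, Finset.sum_congr rfl fun j hj => hsum j (Finset.mem_range.1 hj)]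
    simp
  rw [quad_gram, mul_comm, ← h1]
  refine Finset.sum_sq_le_sum_mul_sum_of_sq_le_mul _ (fun f _ => ?_) (fun f _ => hS f)
    fun f _ => ?_
  · exact div_nonneg (sq_nonneg _) (hS f)
  · rw [sq_abs]
    rcases (hS f).eq_or_lt with h0 | h0
    · have h2 : ∀ j ∈ Finset.range n, v j f = 0 :=
        (Finset.sum_eq_zero_iff_of_nonneg fun k hk => hv k (Finset.mem_range.1 hk) f).1 h0.symm
      rw [Finset.sum_eq_zero fun j hj => by rw [h2 j hj, mul_zero], ← h0]
      simp
    · rw [div_mul_cancel₀ _ h0.ne']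

/-- Wherever some vector is nonzero, the weight is at least a. -/
theorem quad_gram_le {n : ℕ} {v : ℕ → F → ℝ} {a : ℝ} (ha : 0 < a)
    (hv : ∀ j < n, ∀ f, v j f = 0 ∨ a ≤ v j f) (w : ℕ → ℝ) :
    a * quad n (gram n v) w ≤ ∑ f, (∑ j ∈ Finset.range n, w j * v j f) ^ 2 := by
  rw [quad_gram, Finset.mul_sum]
  refine Finset.sum_le_sum fun f _ => ?_
  have hv0 : ∀ k ∈ Finset.range n, 0 ≤ v k f := fun k hk => by
    rcases hv k (Finset.mem_range.1 hk) f with h | h <;> linarith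
  by_cases h : ∀ j ∈ Finset.range n, v j f = 0
  · rw [Finset.sum_eq_zero fun j hj => by rw [h j hj, mul_zero]]
    simp
  · push Not at h
    obtain ⟨j, hj, hne⟩ := h
    have h1 : a ≤ v j f := (hv j (Finset.mem_range.1 hj) f).resolve_left hne
    have h2 : a ≤ ∑ k ∈ Finset.range n, v k f :=
      h1.trans (Finset.single_le_sum hv0 hj)
    rw [mul_div_assoc', div_le_iff₀ (ha.trans_le h2), mul_comm]
    exact mul_le_mul_of_nonneg_left h2 (sq_nonneg _)

/-- The residual coefficients. -/
def resid (m : ℕ) (β : ℕ → ℝ) (j : ℕ) : ℝ := if j < m then -β j else if j = m then 1 else 0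

theorem sum_resid (m : ℕ) (β x : ℕ → ℝ) :
    ∑ j ∈ Finset.range (m + 1), resid m β j * x j = x m - ∑ j ∈ Finset.range m, β j * x j := by
  rw [Finset.sum_range_succ]
  simp only [resid, lt_irrefl, if_false, if_true, one_mul]
  rw [Finset.sum_congr rfl fun j hj => by rw [if_pos (Finset.mem_range.1 hj)]]
  simp only [neg_mul, Finset.sum_neg_distrib]
  ring

theorem sum_resid_sq (m : ℕ) (β : ℕ → ℝ) :
    ∑ j ∈ Finset.range (m + 1), resid m β j ^ 2 = 1 + ∑ j ∈ Finset.range m, β j ^ 2 := by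
  rw [Finset.sum_range_succ]
  simp only [resid, lt_irrefl, if_false, if_true]
  rw [Finset.sum_congr rfl fun j hj => by rw [if_pos (Finset.mem_range.1 hj)]]
  simp [add_comm]

/-- The vector `v m` has small distance to a short combination of its predecessors. -/
def Near (ε : ℝ) (m : ℕ) (v : ℕ → F → ℝ) : Prop :=
  ∃ β : ℕ → ℝ, ∑ j ∈ Finset.range m, β j ^ 2 ≤ 1 ∧
    ∑ f, |v m f - ∑ j ∈ Finset.range m, β j * v j f| ≤ ε / 2

/-- The vector `v m` is separated from all short combinations of its predecessors. -/
def Apart (κ : ℝ) (m : ℕ) (v : ℕ → F → ℝ) : Prop :=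
  ∀ β : ℕ → ℝ, ∑ j ∈ Finset.range m, β j ^ 2 ≤ 1 →
    κ / (m + 1) ≤ ∑ f, (v m f - ∑ j ∈ Finset.range m, β j * v j f) ^ 2

variable {m : ℕ} {v : ℕ → F → ℝ} {G : ℕ → ℕ → ℝ} {ε e M c a : ℝ}

/-- A small ridge value yields β with ‖β‖² ≤ 1 + ε/8 and quadratic form at most 2c. The ridge c is
scaled so that 2c(m+1)/M = ε²/24; with the noise added this stays below (ε/4)², hence the ℓ¹
residual is at most ε/4. -/
theorem near_of_elim_le (hv : ∀ j < m + 1, ∀ f, 0 ≤ v j f)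
    (hsum : ∀ j < m + 1, ∑ f, v j f = 1)
    (hG : ∀ j < m + 1, ∀ l < m + 1, G j l = G l j) (hpsd : ∀ w, 0 ≤ quad (m + 1) G w)
    (hε : 0 < ε) (hε1 : ε ≤ 1) (hM : 0 < M) (he : 3 * (m + 1 : ℝ) ^ 2 * e ≤ ε ^ 3 / 768)
    (hc : c = ε ^ 2 / 48 * (M / (m + 1)))
    (hclose : ∀ j < m + 1, ∀ l < m + 1, |G j l - M * gram (m + 1) v j l| ≤ M * e)
    (hq : elim c G m m m ≤ (1 + ε / 8) * c) : Near ε m v := by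
  have hm : (0 : ℝ) < m + 1 := by positivity
  have hc0 : 0 < c := by rw [hc]; positivity
  obtain ⟨β, hβ⟩ := exists_quad_add_le hc0 hG hpsd (Nat.le_succ m) fun j => if j = m then 1 else 0
  rw [quad_single_last] at hβ
  have hw : (fun j => if j < m then (if j = m then 1 else 0) - β j else if j = m then 1 else 0) =
      resid m β := by
    funext j
    simp only [resid]
    split_ifs with h1 h2 <;> first | omega | simp
  rw [hw] at hβ
  have hQ0 := hpsd (resid m β)
  have hB0 : 0 ≤ ∑ j ∈ Finset.range m, β j ^ 2 := by positivity
  have hB : ∑ j ∈ Finset.range m, β j ^ 2 ≤ 1 + ε / 8 := by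
    have : c * ∑ j ∈ Finset.range m, β j ^ 2 ≤ c * (1 + ε / 8) := by linarith
    exact le_of_mul_le_mul_left this hc0
  have hQ : quad (m + 1) G (resid m β) ≤ 2 * c := by
    have h1 : 0 ≤ c * ∑ j ∈ Finset.range m, β j ^ 2 := by positivity
    have h2 : (1 + ε / 8) * c ≤ 2 * c := mul_le_mul_of_nonneg_right (by linarith) hc0.le
    linarith
  have he0 : 0 ≤ M * e := (abs_nonneg _).trans (hclose 0 (by omega) 0 (by omega))
  have hnoise := abs_quad_sub_le (H := fun j l => M * gram (m + 1) v j l) hclose (resid m β)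
  have hMq : quad (m + 1) (fun j l => M * gram (m + 1) v j l) (resid m β) =
      M * quad (m + 1) (gram (m + 1) v) (resid m β) := by
    simp only [quad, Finset.mul_sum]
    exact Finset.sum_congr rfl fun j _ => Finset.sum_congr rfl fun l _ => by ring
  rw [hMq, sum_resid_sq] at hnoise
  have h3 : M * e * ((m + 1 : ℕ) : ℝ) * (1 + ∑ j ∈ Finset.range m, β j ^ 2) ≤
      M * e * (m + 1) * 3 := by
    push_cast
    exact mul_le_mul_of_nonneg_left (by linarith) (by positivity)
  have h4 : M * quad (m + 1) (gram (m + 1) v) (resid m β) ≤ 2 * c + M * e * (m + 1) * 3 := by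
    have := (abs_le.1 hnoise).1
    linarith
  have h5 : (m + 1) * quad (m + 1) (gram (m + 1) v) (resid m β) ≤ (ε / 4) ^ 2 := by
    have h6 : M * ((m + 1) * quad (m + 1) (gram (m + 1) v) (resid m β)) ≤ M * (ε / 4) ^ 2 := by
      calc M * ((m + 1) * quad (m + 1) (gram (m + 1) v) (resid m β))
          = (m + 1) * (M * quad (m + 1) (gram (m + 1) v) (resid m β)) := by ring
        _ ≤ (m + 1) * (2 * c + M * e * (m + 1) * 3) := by gcongr
        _ = M * (ε ^ 2 / 24 + 3 * (m + 1 : ℝ) ^ 2 * e) := by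
          rw [hc]; field_simp; ring
        _ ≤ M * (ε / 4) ^ 2 := by
          refine mul_le_mul_of_nonneg_left ?_ hM.le
          have : ε ^ 3 ≤ ε ^ 2 := pow_le_pow_of_le_one hε.le hε1 (by norm_num)
          nlinarith
    exact le_of_mul_le_mul_left h6 hM
  have h7 := sq_sum_abs_le_quad_gram hv hsum (resid m β)
  push_cast at h7
  have h8 : ∑ f, |v m f - ∑ j ∈ Finset.range m, β j * v j f| ≤ ε / 4 := by
    have := abs_le_of_sq_le_sq (h7.trans h5) (by positivity)
    simp only [sum_resid] at this
    exact (le_abs_self _).trans this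
  -- Rescaling restores ‖β‖ ≤ 1 and costs at most (1 - κ)‖v_m‖₁ ≤ ε/8.
  set κ := 1 / (1 + ε / 8) with hκ
  have hκ0 : 0 < κ := by positivity
  have hκ1 : κ ≤ 1 := by rw [hκ, div_le_one (by positivity)]; linarith
  have hκ2 : 1 - κ ≤ ε / 8 := by
    have : κ * (1 + ε / 8) = 1 := by rw [hκ]; field_simp
    nlinarith
  refine ⟨fun j => κ * β j, ?_, ?_⟩
  · simp only [mul_pow, ← Finset.mul_sum]
    calc κ ^ 2 * ∑ j ∈ Finset.range m, β j ^ 2 ≤ κ ^ 2 * (1 + ε / 8) := by gcongr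
      _ = κ := by rw [hκ]; field_simp
      _ ≤ 1 := hκ1
  · calc ∑ f, |v m f - ∑ j ∈ Finset.range m, κ * β j * v j f|
        ≤ ∑ f, (κ * |v m f - ∑ j ∈ Finset.range m, β j * v j f| + (1 - κ) * v m f) := by
          refine Finset.sum_le_sum fun f _ => ?_
          have h9 : v m f - ∑ j ∈ Finset.range m, κ * β j * v j f =
              κ * (v m f - ∑ j ∈ Finset.range m, β j * v j f) + (1 - κ) * v m f := by
            rw [mul_sub, Finset.mul_sum]
            simp only [mul_assoc]
            ring
          rw [h9]
          refine (abs_add_le _ _).trans ?_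
          rw [abs_mul, abs_of_pos hκ0, abs_mul, abs_of_nonneg (sub_nonneg.2 hκ1),
            abs_of_nonneg (hv m (by omega) f)]
      _ = κ * ∑ f, |v m f - ∑ j ∈ Finset.range m, β j * v j f| + (1 - κ) := by
          rw [Finset.sum_add_distrib, ← Finset.mul_sum, ← Finset.mul_sum, hsum m (by omega),
            mul_one]
      _ ≤ 1 * (ε / 4) + ε / 8 := by gcongr
      _ ≤ ε / 2 := by linarith

/-- For ‖β‖ ≤ 1 the ridge term uses up at most c of the value, so at least (ε/8)c is left for the
residual form. Divided by M this is ε³/384/(m+1), of which the noise takes at most half. The slack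
ε/8 in the common threshold is what separates the two alternatives. -/
theorem apart_of_lt_elim (hv : ∀ j < m + 1, ∀ f, v j f = 0 ∨ a ≤ v j f) (ha : 0 < a)
    (hG : ∀ j < m + 1, ∀ l < m + 1, G j l = G l j) (hpsd : ∀ w, 0 ≤ quad (m + 1) G w)
    (hε : 0 < ε) (hM : 0 < M) (he : 3 * (m + 1 : ℝ) ^ 2 * e ≤ ε ^ 3 / 768)
    (hc : c = ε ^ 2 / 48 * (M / (m + 1)))
    (hclose : ∀ j < m + 1, ∀ l < m + 1, |G j l - M * gram (m + 1) v j l| ≤ M * e)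
    (hq : (1 + ε / 8) * c < elim c G m m m) : Apart (a * ε ^ 3 / 768) m v := by
  intro β hB
  have hm : (0 : ℝ) < m + 1 := by positivity
  have hc0 : 0 < c := by rw [hc]; positivity
  have hβ := quad_elim_le hc0 hG hpsd (Nat.le_succ m) (fun j => if j = m then 1 else 0) β
  rw [quad_single_last] at hβ
  have hw : (fun j => if j < m then (if j = m then 1 else 0) - β j else if j = m then 1 else 0) =
      resid m β := by
    funext j
    simp only [resid]
    split_ifs with h1 h2 <;> first | omega | simp
  rw [hw] at hβ
  have he0 : 0 ≤ M * e := (abs_nonneg _).trans (hclose 0 (by omega) 0 (by omega))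
  have hnoise := abs_quad_sub_le (H := fun j l => M * gram (m + 1) v j l) hclose (resid m β)
  have hMq : quad (m + 1) (fun j l => M * gram (m + 1) v j l) (resid m β) =
      M * quad (m + 1) (gram (m + 1) v) (resid m β) := by
    simp only [quad, Finset.mul_sum]
    exact Finset.sum_congr rfl fun j _ => Finset.sum_congr rfl fun l _ => by ring
  rw [hMq, sum_resid_sq] at hnoise
  have h3 : M * e * ((m + 1 : ℕ) : ℝ) * (1 + ∑ j ∈ Finset.range m, β j ^ 2) ≤
      M * e * (m + 1) * 3 := by
    push_cast
    exact mul_le_mul_of_nonneg_left (by linarith) (by positivity)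
  have h2 : c * ∑ j ∈ Finset.range m, β j ^ 2 ≤ c * 1 := by gcongr
  have h4 : ε / 8 * c - M * e * (m + 1) * 3 ≤ M * quad (m + 1) (gram (m + 1) v) (resid m β) := by
    have := (abs_le.1 hnoise).2
    linarith
  have h5 : ε ^ 3 / 768 / (m + 1) ≤ quad (m + 1) (gram (m + 1) v) (resid m β) := by
    refine le_of_mul_le_mul_left (le_trans ?_ h4) hM
    have h6 : ε / 8 * c - M * e * (m + 1) * 3 =
        M * ((ε ^ 3 / 384 - 3 * (m + 1 : ℝ) ^ 2 * e) / (m + 1)) := by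
      rw [hc]; field_simp; ring
    rw [h6]
    gcongr
    linarith
  calc a * ε ^ 3 / 768 / (m + 1) = a * (ε ^ 3 / 768 / (m + 1)) := by ring
    _ ≤ a * quad (m + 1) (gram (m + 1) v) (resid m β) := by gcongr
    _ ≤ _ := quad_gram_le ha hv _
    _ = _ := by simp only [sum_resid]

end ApproxTest

/-! ### Spread families of histories -/

section Families

variable {O : ℕ} (p : List (Fin O) → PMF (Fin O)) (T t : ℕ) (α ε : ℝ)

/-- The vector of conditional probabilities of the futures of length `T - t`. -/
def fut (x : Fin t → Fin O) (f : Fin (T - t) → Fin O) : ℝ :=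
  condProb p (List.ofFn x) (List.ofFn f)

/-- The history `x` is approximated by the first `m` members of the family `bs`. -/
def Good (m : ℕ) (bs : ℕ → Fin t → Fin O) (x : Fin t → Fin O) : Prop :=
  ∃ β : ℕ → ℝ, ∑ j ∈ Finset.range m, β j ^ 2 ≤ 1 ∧
    ∑ f, |fut p T t x f - ∑ j ∈ Finset.range m, β j * fut p T t (bs j) f| ≤ ε / 2

open Classical in
/-- The probability of a history that is not approximated. -/
def missProb (m : ℕ) (bs : ℕ → Fin t → Fin O) : ℝ :=
  ∑ x : Fin t → Fin O, condProb p [] (List.ofFn x) * if Good p T t ε m bs x then 0 else 1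

/-- Every member of the family is separated from its predecessors. -/
def Spread (m : ℕ) (bs : ℕ → Fin t → Fin O) : Prop :=
  ∀ i < m, Apart (α ^ T * ε ^ 3 / 768) i fun j => fut p T t (bs j)

variable {p T t α ε}

theorem fut_nonneg (x : Fin t → Fin O) (f : Fin (T - t) → Fin O) : 0 ≤ fut p T t x f :=
  condProb_nonneg p _ _

theorem sum_fut (x : Fin t → Fin O) : ∑ f, fut p T t x f = 1 := sum_condProb p _ _

theorem fut_eq_zero_or (hp : IsRegular p T α) (hα : 0 ≤ α) (hα1 : α ≤ 1) (ht : t ≤ T)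
    (x : Fin t → Fin O) (f : Fin (T - t) → Fin O) :
    fut p T t x f = 0 ∨ α ^ T ≤ fut p T t x f := by
  by_cases h : fut p T t x f = 0
  · exact Or.inl h
  · refine Or.inr (le_trans ?_ (hp.pow_le_condProb hα _ _ ?_ h))
    · rw [List.length_ofFn]
      exact pow_le_pow_of_le_one hα hα1 (Nat.sub_le _ _)
    · simp only [List.length_ofFn]
      omega

theorem Good.congr {m : ℕ} {bs bs' : ℕ → Fin t → Fin O} (h : ∀ j < m, bs' j = bs j)
    (x : Fin t → Fin O) : Good p T t ε m bs' x ↔ Good p T t ε m bs x := by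
  have : ∀ (β : ℕ → ℝ) f, ∑ j ∈ Finset.range m, β j * fut p T t (bs' j) f =
      ∑ j ∈ Finset.range m, β j * fut p T t (bs j) f := fun β f =>
    Finset.sum_congr rfl fun j hj => by rw [h j (Finset.mem_range.1 hj)]
  simp only [Good, this]

theorem Good.succ {m : ℕ} {bs : ℕ → Fin t → Fin O} {x : Fin t → Fin O}
    (h : Good p T t ε m bs x) : Good p T t ε (m + 1) bs x := by
  obtain ⟨β, h1, h2⟩ := h
  have hs : ∀ g : ℕ → ℝ → ℝ, (∀ j, g j 0 = 0) →
      ∑ j ∈ Finset.range (m + 1), g j (if j = m then 0 else β j) =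
        ∑ j ∈ Finset.range m, g j (β j) := by
    intro g hg
    rw [Finset.sum_range_succ, if_pos rfl, hg, add_zero]
    exact Finset.sum_congr rfl fun j hj => by rw [if_neg (Finset.mem_range.1 hj).ne]
  refine ⟨fun j => if j = m then 0 else β j, ?_, ?_⟩
  · rw [hs (fun _ y => y ^ 2) (by simp)]
    exact h1
  · have e : ∀ f, ∑ j ∈ Finset.range (m + 1), (if j = m then 0 else β j) * fut p T t (bs j) f =
        ∑ j ∈ Finset.range m, β j * fut p T t (bs j) f := fun f =>
      hs (fun j y => y * fut p T t (bs j) f) (by simp)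
    simp only [e]
    exact h2

theorem missProb_congr {m : ℕ} {bs bs' : ℕ → Fin t → Fin O} (h : ∀ j < m, bs' j = bs j) :
    missProb p T t ε m bs' = missProb p T t ε m bs := by
  have e : Good p T t ε m bs' = Good p T t ε m bs := funext fun x => propext (Good.congr h x)
  rw [missProb, e, missProb]

/-- Padding coefficients by zero keeps every approximated history approximated, whatever the new row
is. -/
theorem missProb_succ_le {m : ℕ} {bs bs' : ℕ → Fin t → Fin O} (h : ∀ j < m, bs' j = bs j) :
    missProb p T t ε (m + 1) bs' ≤ missProb p T t ε m bs := by
  rw [← missProb_congr h]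
  refine Finset.sum_le_sum fun x _ => mul_le_mul_of_nonneg_left ?_ (condProb_nonneg p _ _)
  by_cases h1 : Good p T t ε m bs' x
  · simp [h1, h1.succ]
  · simp only [h1, if_false]
    split_ifs <;> norm_num

theorem Spread.congr {m : ℕ} {bs bs' : ℕ → Fin t → Fin O} (h : ∀ j < m, bs' j = bs j)
    (hs : Spread p T t α ε m bs) : Spread p T t α ε m bs' := by
  intro i hi β hβ
  have h1 := hs i hi β hβ
  have h2 : ∀ f, ∑ j ∈ Finset.range i, β j * fut p T t (bs' j) f =
      ∑ j ∈ Finset.range i, β j * fut p T t (bs j) f := fun f =>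
    Finset.sum_congr rfl fun j hj => by rw [h j ((Finset.mem_range.1 hj).trans hi)]
  simp only [h2, h i hi]
  exact h1

theorem Spread.succ {m : ℕ} {bs : ℕ → Fin t → Fin O} (hs : Spread p T t α ε m bs)
    (h : Apart (α ^ T * ε ^ 3 / 768) m fun j => fut p T t (bs j)) :
    Spread p T t α ε (m + 1) bs := by
  intro i hi
  rcases Nat.lt_succ_iff_lt_or_eq.1 hi with hi | rfl
  · exact hs i hi
  · exact h

/-- A repeated history is a combination of its predecessors with one unit coefficient, at distance
zero. -/
theorem Spread.injOn {m : ℕ} {bs : ℕ → Fin t → Fin O} (hs : Spread p T t α ε m bs) (hα : 0 < α)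
    (hε : 0 < ε) : Set.InjOn bs (Finset.range m) := by
  have key : ∀ i j, i < j → j < m → bs i ≠ bs j := by
    intro i j hij hj heq
    have hmem : i ∈ Finset.range j := Finset.mem_range.2 hij
    have := hs j hj (fun k => if k = i then 1 else 0) (by simp [hmem])
    simp only [ite_mul, one_mul, zero_mul, Finset.sum_ite_eq', hmem, if_true, heq, sub_self] at this
    have h2 : 0 < α ^ T * ε ^ 3 / 768 / ((j : ℝ) + 1) := by positivity
    norm_num at this
    linarith
  intro i hi j hj heq
  have hi' : i < m := by simpa using hi
  have hj' : j < m := by simpa using hj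
  rcases lt_trichotomy i j with h | h | h
  · exact absurd heq (key i j h hj')
  · exact h
  · exact absurd heq.symm (key j i h hi')

theorem isApproxBasis_image {m : ℕ} {bs : ℕ → Fin t → Fin O}
    (hinj : Set.InjOn bs (Finset.range m)) (hmiss : missProb p T t ε m bs ≤ ε / 2) (hε : 0 < ε) :
    IsApproxBasis p T t ε ((Finset.range m).image bs) := by
  classical
  set B := (Finset.range m).image bs with hB
  let idx : (Fin t → Fin O) → ℕ := Function.invFunOn bs (Finset.range m : Set ℕ)
  have hidx : ∀ j ∈ Finset.range m, idx (bs j) = j := fun j hj =>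
    hinj.leftInvOn_invFunOn (Finset.mem_coe.2 hj)
  have hsum : ∀ g : (Fin t → Fin O) → ℝ, ∑ b : B, g b = ∑ j ∈ Finset.range m, g (bs j) := by
    intro g
    rw [Finset.sum_coe_sort B g, hB, Finset.sum_image hinj]
  have hcoef : ∀ x : Fin t → Fin O, ∃ β : ℕ → ℝ, ∑ j ∈ Finset.range m, β j ^ 2 ≤ 1 ∧
      ∑ f, |fut p T t x f - ∑ j ∈ Finset.range m, β j * fut p T t (bs j) f| ≤
        ε / 2 + if Good p T t ε m bs x then 0 else 1 := by
    intro x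
    by_cases hx : Good p T t ε m bs x
    · obtain ⟨β, h1, h2⟩ := hx
      exact ⟨β, h1, h2.trans (by split_ifs <;> linarith)⟩
    -- Histories that are not approximated get zero coefficients and error at most one, so together
    -- they contribute at most `missProb`.
    · refine ⟨0, by simp, ?_⟩
      have h3 : ∀ f, |fut p T t x f| = fut p T t x f := fun f => abs_of_nonneg (fut_nonneg x f)
      simp only [Pi.zero_apply, zero_mul, Finset.sum_const_zero, sub_zero, h3, sum_fut, hx, if_false]
      linarith
  choose β hβ1 hβ2 using hcoef
  refine ⟨fun x => WithLp.toLp 2 fun b => β x (idx b), fun x => ?_, ?_⟩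
  · rw [EuclideanSpace.norm_eq, Real.sqrt_le_one]
    simp only [Real.norm_eq_abs, sq_abs]
    rw [hsum fun b => β x (idx b) ^ 2]
    rw [Finset.sum_congr rfl fun j hj => by rw [hidx j hj]]
    exact hβ1 x
  · calc ∑ x : Fin t → Fin O, condProb p [] (List.ofFn x) *
          ∑ f : Fin (T - t) → Fin O, |condProb p (List.ofFn x) (List.ofFn f)
            - ∑ b : B, condProb p (List.ofFn b.1) (List.ofFn f) * β x (idx b)|
        = ∑ x : Fin t → Fin O, condProb p [] (List.ofFn x) *
          ∑ f, |fut p T t x f - ∑ j ∈ Finset.range m, β x j * fut p T t (bs j) f| := by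
          refine Finset.sum_congr rfl fun x _ => ?_
          congr 1
          refine Finset.sum_congr rfl fun f _ => ?_
          rw [hsum fun b => condProb p (List.ofFn b) (List.ofFn f) * β x (idx b)]
          rw [Finset.sum_congr rfl fun j hj => by rw [hidx j hj, mul_comm]]
          rfl
      _ ≤ ∑ x : Fin t → Fin O, condProb p [] (List.ofFn x) *
          (ε / 2 + if Good p T t ε m bs x then 0 else 1) :=
          Finset.sum_le_sum fun x _ =>
            mul_le_mul_of_nonneg_left (hβ2 x) (condProb_nonneg p _ _)
      _ = ε / 2 + missProb p T t ε m bs := by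
          simp only [mul_add, Finset.sum_add_distrib, ← Finset.sum_mul, sum_condProb, one_mul]
          rfl
      _ ≤ ε := by linarith

theorem Spread.two_pow_le {r m : ℕ} {bs : ℕ → Fin t → Fin O} (hs : Spread p T t α ε m bs)
    (hr : HasRank p T r) (ht1 : 1 ≤ t) (ht : t ≤ T) (hα : 0 < α) (hε : 0 < ε) (hm : 1 ≤ m) :
    (2 : ℝ) ^ m ≤ (1 + 768 * m ^ 2 / (α ^ T * ε ^ 3)) ^ r := by
  have hm0 : (0 : ℝ) < m := by exact_mod_cast hm
  have h1 := two_pow_le_of_spread (v := fun j => fut p T t (bs j)) (m := m) (r := r)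
    (μ := α ^ T * ε ^ 3 / 768 / m) (by positivity) ?_ ?_ ?_
  · convert h1 using 2
    field_simp
  · intro i _
    calc ∑ f, fut p T t (bs i) f ^ 2 ≤ ∑ f, fut p T t (bs i) f := by
          refine Finset.sum_le_sum fun f _ => ?_
          have h2 := fut_nonneg (p := p) (T := T) (bs i) f
          have h3 : fut p T t (bs i) f ≤ 1 := condProb_le_one p _ _
          nlinarith
      _ = 1 := sum_fut _
  · have h2 := hr t ht1 ht
    set A := Matrix.of fun (f : Σ k : Fin (T - t + 1), (Fin k → Fin O)) (h : Fin t → Fin O) =>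
      condProb p (List.ofFn h) (List.ofFn f.2) with hA
    -- Only the rows for futures of full length T - t and the columns of the kept histories are
    -- needed.
    exact (Matrix.rank_submatrix_le A (fun f : Fin (T - t) → Fin O =>
      ⟨⟨T - t, Nat.lt_succ_self _⟩, f⟩) fun j : Fin m => bs j).trans h2
  · intro i hi β hβ
    refine le_trans ?_ (hs i hi β hβ)
    have : (i : ℝ) + 1 ≤ m := by exact_mod_cast hi
    gcongr

/-- Taking logarithms leaves m log 2 ≤ r (7 + 2 log m + T log(1/α) + 3 log(1/ε)). The log m on the
right is traded for a small multiple of m / r. -/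
theorem le_of_two_pow_le {r T m : ℕ} {α ε : ℝ} (hr : 1 ≤ r) (hT : 1 ≤ T) (hm : 1 ≤ m) (hα : 0 < α)
    (hα1 : α ≤ 1) (hε : 0 < ε) (hεα : ε < α / (T * r))
    (h : (2 : ℝ) ^ m ≤ (1 + 768 * m ^ 2 / (α ^ T * ε ^ 3)) ^ r) :
    (m : ℝ) ≤ 23 * (r * T * (1 + Real.log (1 / (α * ε)))) := by
  have hr0 : (1 : ℝ) ≤ r := by exact_mod_cast hr
  have hT0 : (1 : ℝ) ≤ T := by exact_mod_cast hT
  have hm0 : (1 : ℝ) ≤ m := by exact_mod_cast hm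
  -- The upper bound on ε is used here: it gives log r ≤ log(1/ε), so no separate log r survives.
  have hrε : (r : ℝ) * ε ≤ 1 := by
    have h1 : (r : ℝ) ≤ T * r := by nlinarith
    rw [lt_div_iff₀ (by positivity)] at hεα
    nlinarith
  have hε1 : ε ≤ 1 := by nlinarith
  have ha : 0 ≤ -Real.log α := by
    have := Real.log_nonpos hα.le hα1
    linarith
  have hb : 0 ≤ -Real.log ε := by
    have := Real.log_nonpos hε.le hε1
    linarith
  have hlogr : Real.log r ≤ -Real.log ε := by
    rw [← Real.log_inv]
    refine Real.log_le_log (by positivity) ?_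
    rw [← one_div, le_div_iff₀ hε]
    exact hrε
  have hΛ : Real.log (1 / (α * ε)) = -Real.log α + -Real.log ε := by
    rw [one_div, Real.log_inv, Real.log_mul hα.ne' hε.ne']
    ring
  have hden : α ^ T * ε ^ 3 ≤ 1 := by
    have h1 : α ^ T ≤ 1 := pow_le_one₀ hα.le hα1
    have h2 : ε ^ 3 ≤ 1 := pow_le_one₀ hε.le hε1
    nlinarith [pow_pos hα T, pow_pos hε 3]
  have hbase : 1 + 768 * m ^ 2 / (α ^ T * ε ^ 3) ≤ 769 * (m : ℝ) ^ 2 / (α ^ T * ε ^ 3) := by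
    have hd : 0 < α ^ T * ε ^ 3 := by positivity
    have : (1 : ℝ) ≤ m ^ 2 / (α ^ T * ε ^ 3) := by
      rw [le_div_iff₀ hd]
      nlinarith
    have h2 : 769 * (m : ℝ) ^ 2 / (α ^ T * ε ^ 3) =
      m ^ 2 / (α ^ T * ε ^ 3) + 768 * m ^ 2 / (α ^ T * ε ^ 3) := by ring
    linarith
  have hlog := Real.log_le_log (by positivity) h
  rw [Real.log_pow, Real.log_pow] at hlog
  have hlb := Real.log_le_log (by positivity) hbase
  rw [Real.log_div (by positivity) (by positivity), Real.log_mul (by norm_num) (by positivity),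
    Real.log_mul (by positivity) (by positivity), Real.log_pow, Real.log_pow, Real.log_pow] at hlb
  push_cast at hlb
  have h769 : Real.log 769 ≤ 7 := by
    rw [Real.log_le_iff_le_exp (by norm_num)]
    have h1 : (2.7 : ℝ) ≤ Real.exp 1 := by
      have := Real.exp_one_gt_d9
      linarith
    calc (769 : ℝ) ≤ 2.7 ^ 7 := by norm_num
      _ ≤ Real.exp 1 ^ 7 := by gcongr
      _ = Real.exp 7 := by rw [← Real.exp_nat_mul]; norm_num
  -- From log x ≤ x - 1 at x = m/(10r). Multiplied by 2r the linear term is m/5, safely below m log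
  -- 2.
  have hlogm : Real.log m ≤ m / (10 * r) + 2 + -Real.log ε := by
    have h10 : Real.log 10 ≤ 3 := by
      rw [Real.log_le_iff_le_exp (by norm_num)]
      have h1 : (2.7 : ℝ) ≤ Real.exp 1 := by
        have := Real.exp_one_gt_d9
        linarith
      calc (10 : ℝ) ≤ 2.7 ^ 3 := by norm_num
        _ ≤ Real.exp 1 ^ 3 := by gcongr
        _ = Real.exp 3 := by rw [← Real.exp_nat_mul]; norm_num
    have h1 : (m : ℝ) = m / (10 * r) * (10 * r) := by field_simp
    have h2 := Real.log_le_sub_one_of_pos (x := (m : ℝ) / (10 * r)) (by positivity)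
    have h3 : Real.log m = Real.log (m / (10 * r)) + (Real.log 10 + Real.log r) := by
      rw [← Real.log_mul (by norm_num) (by positivity),
        ← Real.log_mul (by positivity) (by positivity), ← h1]
    linarith
  have hl2 := Real.log_two_gt_d9
  rw [hΛ]
  set a := -Real.log α
  set b := -Real.log ε
  have hub : Real.log (1 + 768 * m ^ 2 / (α ^ T * ε ^ 3)) ≤
      7 + 2 * (m / (10 * r) + 2 + b) + (T * a + 3 * b) := by
    have : (T : ℝ) * Real.log α = -(T * a) := by simp [a]
    have h2 : Real.log ε = -b := by simp [b]
    rw [this, h2] at hlb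
    linarith
  have h5 : (m : ℝ) * Real.log 2 ≤ r * (7 + 2 * (m / (10 * r) + 2 + b) + (T * a + 3 * b)) :=
    hlog.trans (mul_le_mul_of_nonneg_left hub (by positivity))
  have h6 : r * (7 + 2 * (m / (10 * r) + 2 + b) + (T * a + 3 * b)) =
      m / 5 + r * (11 + 5 * b + T * a) := by
    field_simp
    ring
  have h7 : (r : ℝ) * (11 + 5 * b + T * a) ≤ r * (T * (11 * (1 + (a + b)))) := by
    refine mul_le_mul_of_nonneg_left ?_ (by positivity)
    nlinarith
  have h8 : (m : ℝ) * 0.69 ≤ m * Real.log 2 := by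
    refine mul_le_mul_of_nonneg_left ?_ (by positivity)
    linarith
  nlinarith

/-- A regular law with `α > 1/2` is deterministic. -/
theorem IsRegular.futureLaw_unique (hp : IsRegular p T α) (hα : 1 / 2 < α) {h : List (Fin O)} {k : ℕ}
    (hk : h.length + k ≤ T) {l l' : List (Fin O)} (hl : l ∈ (futureLaw p h k).support)
    (hl' : l' ∈ (futureLaw p h k).support) : l = l' := by
  induction k generalizing h l l' with
  | zero =>
    have h1 : l = [] := by simpa [futureLaw] using hl
    have h2 : l' = [] := by simpa [futureLaw] using hl'
    rw [h1, h2]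
  | succ k ih =>
    simp only [futureLaw, PMF.mem_support_bind_iff, PMF.mem_support_map_iff] at hl hl'
    obtain ⟨o, ho, a, ha, rfl⟩ := hl
    obtain ⟨o', ho', a', ha', rfl⟩ := hl'
    have hoo : o = o' := by
      by_contra hne
      have h1 := hp h (by omega) o ((PMF.mem_support_iff _ _).1 ho)
      have h2 := hp h (by omega) o' ((PMF.mem_support_iff _ _).1 ho')
      have hsum : ∑ o' : Fin O, (p h o').toReal = 1 := by
        have := (p h).tsum_coe
        rw [tsum_fintype] at this
        rw [← ENNReal.toReal_sum fun o' _ => (p h).apply_ne_top o', this]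
        rfl
      have h3 : ∑ x ∈ {o, o'}, (p h x).toReal ≤ ∑ x : Fin O, (p h x).toReal :=
        Finset.sum_le_sum_of_subset_of_nonneg (Finset.subset_univ _)
          fun _ _ _ => ENNReal.toReal_nonneg
      rw [Finset.sum_pair hne, hsum] at h3
      linarith
    subst hoo
    have hlen : (h ++ [o]).length + k ≤ T := by
      simp only [List.length_append, List.length_singleton]
      omega
    rw [ih hlen ha ha']

end Families

/-! ### The algorithm -/

-- Natural-number arrays: 0 input, 1 number m of kept rows, 2 rows (row m is the candidate), 3
-- sampled future, 4 current history, 5 oracle answer, 6 size parameter P, 13 count of hits; the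
-- others are loop counters. Real arrays: 0 input, 1 Gram matrix, 2 density estimates, 3 their sum,
-- 4 the doubled δ, 5 pivot column, 6 pivot. Loop bounds that are powers of P are tested over the
-- reals, since natural expressions have no product.
section Algorithm

/-- The scalar variable stored in the array `a`. -/
def nv (a : ℕ) : NExpr := .cell a (.lit 0) (.lit 0)

/-- The length `T` of the sequences. -/
def lenE : NExpr := .cell 0 (.lit 0) (.lit 0)

/-- The length `t` of the histories. -/
def cutE : NExpr := .cell 0 (.lit 0) (.lit 1)

/-- Powers of real expressions. -/
def RExpr.pow (e : RExpr) : ℕ → RExpr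
  | 0 => .ofNExpr (.lit 1)
  | k + 1 => .times (e.pow k) e

/-- A power of the size parameter, which is stored in the array `6`. -/
def sizePow (k : ℕ) : RExpr := (RExpr.ofNExpr (nv 6)).pow k

/-- The test of a counting loop of length a power of the size parameter. -/
def ltPow (a k : ℕ) : Test := .realLT (.ofNExpr (nv a)) (sizePow k)

/-- The test of a counting loop over the current rows, including the candidate row. -/
def ltRows (a : ℕ) : Test := .natLT (nv a) (.plus (nv 1) (.lit 1))

/-- Counts how often the next symbol after the current history is the next symbol of the future. -/
def countProg (kW : ℕ) : Prog :=
  .seq (.setNat 13 (.lit 0) (.lit 0) (.lit 0))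
    (forLoop 12 (ltPow 12 kW)
      (.seq (.query 4 (.lit 0) (.plus cutE (nv 11)) 5 (.lit 0))
        (.ite (.both (.neg (.natLT (nv 5) (.cell 3 (.lit 0) (nv 11))))
            (.neg (.natLT (.cell 3 (.lit 0) (nv 11)) (nv 5))))
          (.setNat 13 (.lit 0) (.lit 0) (.plus (nv 13) (.lit 1)))
          .skip)))

/-- Estimates the probability of the future after row `nv 10`. -/
def densProg (kW : ℕ) : Prog :=
  .seq (forLoop 14 (.natLT (nv 14) cutE)
      (.setNat 4 (.lit 0) (nv 14) (.cell 2 (nv 10) (nv 14))))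
    (.seq (.setReal 2 (.lit 0) (nv 10) (.ofNExpr (.lit 1)))
      (forLoop 11 (.natLT (nv 11) (.minus lenE cutE))
        (.seq (countProg kW)
          (.seq (.setReal 2 (.lit 0) (nv 10)
              (.times (.cell 2 (.lit 0) (nv 10)) (.over (.ofNExpr (nv 13)) (sizePow kW))))
            (.setNat 4 (.lit 0) (.plus cutE (nv 11)) (.cell 3 (.lit 0) (nv 11)))))))

/-- Estimates the probabilities of the future after all rows. -/
def allDensProg (kW : ℕ) : Prog := forLoop 10 (ltRows 10) (densProg kW)

/-- Sums the estimates. -/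
def sumProg : Prog :=
  .seq (.setReal 3 (.lit 0) (.lit 0) (.ofNExpr (.lit 0)))
    (forLoop 10 (ltRows 10)
      (.setReal 3 (.lit 0) (.lit 0)
        (.plus (.cell 3 (.lit 0) (.lit 0)) (.cell 2 (.lit 0) (nv 10)))))

/-- Runs over all entries of the Gram matrix and replaces them. -/
def entriesProg (e : RExpr) : Prog :=
  forLoop 10 (ltRows 10) (forLoop 15 (ltRows 15) (.setReal 1 (nv 10) (nv 15) e))

/-- The current entry of the Gram matrix. -/
def entryE : RExpr := .cell 1 (nv 10) (nv 15)

/-- One sample for the Gram matrix. -/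
def sampleProg (kW : ℕ) : Prog :=
  .seq (.query 2 (nv 8) cutE 3 (.lit 0))
    (.seq (allDensProg kW)
      (.seq sumProg
        (entriesProg (.plus entryE
          (.over (.times (.cell 2 (.lit 0) (nv 10)) (.cell 2 (.lit 0) (nv 15)))
            (.times (.cell 3 (.lit 0) (.lit 0)) (.cell 3 (.lit 0) (.lit 0))))))))

/-- Estimates the Gram matrix of the rows. -/
def gramProg (kM kW : ℕ) : Prog :=
  .seq (entriesProg (.ofNExpr (.lit 0)))
    (forLoop 8 (ltRows 8) (forLoop 9 (ltPow 9 kM) (sampleProg kW)))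

/-- The regularization parameter. -/
def ridgeE (kM : ℕ) : RExpr :=
  .times
    (.over (.times (.cell 0 (.lit 0) (.lit 0)) (.cell 0 (.lit 0) (.lit 0))) (.ofNExpr (.lit 48)))
    (.over (sizePow kM) (.plus (.ofNExpr (nv 1)) (.ofNExpr (.lit 1))))

/-- Symmetric elimination in the Gram matrix. -/
def elimProg (kM : ℕ) : Prog :=
  forLoop 16 (.natLT (nv 16) (nv 1))
    (.seq (.setReal 6 (.lit 0) (.lit 0) (.plus (ridgeE kM) (.cell 1 (nv 16) (nv 16))))
      (.seq (forLoop 10 (ltRows 10) (.setReal 5 (.lit 0) (nv 10) (.cell 1 (nv 10) (nv 16))))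
        (entriesProg (.minus entryE
          (.over (.times (.cell 5 (.lit 0) (nv 10)) (.cell 5 (.lit 0) (nv 15)))
            (.cell 6 (.lit 0) (.lit 0)))))))

/-- Keeps the candidate row if it is not approximated by the others. -/
def decideProg (kM : ℕ) : Prog :=
  .ite (.realLT
      (.times (.plus (.ofNExpr (.lit 1))
        (.over (.cell 0 (.lit 0) (.lit 0)) (.ofNExpr (.lit 8)))) (ridgeE kM))
      (.cell 1 (nv 1) (nv 1)))
    -- Keeping the candidate just moves the row count past it; a rejected one is overwritten in the
    -- next round.
    (.setNat 1 (.lit 0) (.lit 0) (.plus (nv 1) (.lit 1)))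
    .skip

/-- Samples a candidate and decides whether to keep it. -/
def roundProg (kM kW : ℕ) : Prog :=
  -- The empty history gives a whole sequence; only the first t cells of its row are read as a
  -- history.
  .seq (.query 0 (.lit 0) (.lit 0) 2 (nv 1))
    (.seq (gramProg kM kW) (.seq (elimProg kM) (decideProg kM)))

/-- Computes the size parameter. -/
def sizeProg (n : ℕ) : Prog :=
  .seq (.loop (.realLT (.ofNExpr (nv 6))
        (.plus (.over (.ofNExpr (.lit 1)) (.cell 0 (.lit 0) (.lit 0)))
          (.over (.ofNExpr (.lit 1)) (.cell 0 (.lit 0) (.lit 1)))))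
      (.setNat 6 (.lit 0) (.lit 0) (.plus (nv 6) (.lit 1))))
    (.seq (.setReal 4 (.lit 0) (.lit 0) (.cell 0 (.lit 0) (.lit 2)))
      -- Doubling δ until it reaches one takes ⌈log₂(1/δ)⌉ passes, which avoids computing a
      -- logarithm.
      (.seq (.loop (.realLT (.cell 4 (.lit 0) (.lit 0)) (.ofNExpr (.lit 1)))
          (.seq (.setReal 4 (.lit 0) (.lit 0)
              (.plus (.cell 4 (.lit 0) (.lit 0)) (.cell 4 (.lit 0) (.lit 0))))
            (.setNat 6 (.lit 0) (.lit 0) (.plus (nv 6) (.lit 1)))))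
        (.setNat 6 (.lit 0) (.lit 0)
          (.plus (nv 6) (.plus (.plus lenE (.cell 0 (.lit 0) (.lit 2))) (.lit n))))))

/-- The algorithm. -/
def basisProg (n kN kM kW : ℕ) : Prog :=
  .seq (sizeProg n) (forLoop 7 (ltPow 7 kN) (roundProg kM kW))

end Algorithm

/-! ### Frames -/

section Frames

/-- At most the natural-number arrays in `A` and the real arrays in `R` differ. -/
structure Frame (A R : List ℕ) (s s' : Store) : Prop where
  nat : ∀ a ∉ A, s'.nat a = s.nat a
  real : ∀ a ∉ R, s'.real a = s.real a

@[simp] theorem Store.setNat_real (s : Store) (a i j v : ℕ) : (s.setNat a i j v).real = s.real :=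
  rfl

@[simp] theorem Store.setReal_nat (s : Store) (a i j : ℕ) (v : ℝ) :
    (s.setReal a i j v).nat = s.nat := rfl

theorem Store.setNat_nat_of_ne (s : Store) {a a' : ℕ} (h : a' ≠ a) (i j v : ℕ) :
    (s.setNat a i j v).nat a' = s.nat a' := by
  funext i' j'
  simp [Store.setNat, h]

theorem Store.setReal_real_of_ne (s : Store) {a a' : ℕ} (h : a' ≠ a) (i j : ℕ) (v : ℝ) :
    (s.setReal a i j v).real a' = s.real a' := by
  funext i' j'
  simp [Store.setReal, h]

theorem Store.setNat_nat (s : Store) (a i j v i' j' : ℕ) :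
    (s.setNat a i j v).nat a i' j' = if i' = i ∧ j' = j then v else s.nat a i' j' := by
  simp [Store.setNat]

theorem Store.setReal_real (s : Store) (a i j : ℕ) (v : ℝ) (i' j' : ℕ) :
    (s.setReal a i j v).real a i' j' = if i' = i ∧ j' = j then v else s.real a i' j' := by
  simp [Store.setReal]

theorem Store.writeSeq_nat_of_ne {O : ℕ} (s : Store) {a a' : ℕ} (h : a' ≠ a) (i : ℕ)
    (f : List (Fin O)) : (s.writeSeq a i f).nat a' = s.nat a' := by
  funext i' j'
  simp [Store.writeSeq, h]

theorem Store.writeSeq_nat_row {O : ℕ} (s : Store) (a i : ℕ) (f : List (Fin O)) (j : ℕ)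
    (hj : j < f.length) : (s.writeSeq a i f).nat a i j = f[j] := by
  simp [Store.writeSeq, hj]

theorem Store.writeSeq_nat_of_row_ne {O : ℕ} (s : Store) (a : ℕ) {i i' : ℕ} (h : i' ≠ i)
    (f : List (Fin O)) : (s.writeSeq a i f).nat a i' = s.nat a i' := by
  funext j'
  simp [Store.writeSeq, h]

variable {A A' R R' : List ℕ} {s s' s'' : Store}

theorem Frame.refl (A R : List ℕ) (s : Store) : Frame A R s s := ⟨fun _ _ => rfl, fun _ _ => rfl⟩

theorem Frame.trans (h : Frame A R s s') (h' : Frame A R s' s'') : Frame A R s s'' :=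
  ⟨fun a ha => (h'.nat a ha).trans (h.nat a ha), fun a ha => (h'.real a ha).trans (h.real a ha)⟩

theorem Frame.mono (h : Frame A R s s') (hA : A ⊆ A') (hR : R ⊆ R') : Frame A' R' s s' :=
  ⟨fun a ha => h.nat a fun h' => ha (hA h'), fun a ha => h.real a fun h' => ha (hR h')⟩

theorem Frame.setNat (h : Frame A R s s') {a : ℕ} (ha : a ∈ A) (i j v : ℕ) :
    Frame A R s (s'.setNat a i j v) := by
  refine ⟨fun a' ha' => ?_, h.real⟩
  rw [Store.setNat_nat_of_ne _ (by rintro rfl; exact ha' ha)]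
  exact h.nat a' ha'

theorem Frame.setReal (h : Frame A R s s') {a : ℕ} (ha : a ∈ R) (i j : ℕ) (v : ℝ) :
    Frame A R s (s'.setReal a i j v) := by
  refine ⟨h.nat, fun a' ha' => ?_⟩
  rw [Store.setReal_real_of_ne _ (by rintro rfl; exact ha' ha)]
  exact h.real a' ha'

theorem Frame.writeSeq {O : ℕ} (h : Frame A R s s') {a : ℕ} (ha : a ∈ A) (i : ℕ)
    (f : List (Fin O)) : Frame A R s (s'.writeSeq a i f) := by
  refine ⟨fun a' ha' => ?_, h.real⟩
  rw [Store.writeSeq_nat_of_ne _ (by rintro rfl; exact ha' ha)]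
  exact h.nat a' ha'

/-- The memory holds the input `T`, `t`, `ε` and the size parameter `P`. -/
structure Ctx (T t P : ℕ) (ε : ℝ) (s : Store) : Prop where
  len : s.nat 0 0 0 = T
  cut : s.nat 0 0 1 = t
  size : s.nat 6 0 0 = P
  eps : s.real 0 0 0 = ε

theorem Ctx.frame {T t P : ℕ} {ε : ℝ} (h : Ctx T t P ε s) (hf : Frame A R s s') (h0 : 0 ∉ A)
    (h6 : 6 ∉ A) (hR : 0 ∉ R) : Ctx T t P ε s' :=
  ⟨by rw [hf.nat 0 h0]; exact h.len, by rw [hf.nat 0 h0]; exact h.cut,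
    by rw [hf.nat 6 h6]; exact h.size, by rw [hf.real 0 hR]; exact h.eps⟩

theorem RExpr.eval_pow (s : Store) (e : RExpr) (k : ℕ) : (e.pow k).eval s = e.eval s ^ k := by
  induction k with
  | zero => simp [RExpr.pow, RExpr.eval, NExpr.eval]
  | succ k ih => simp [RExpr.pow, RExpr.eval, ih, pow_succ]

theorem Ctx.sizePow {T t P : ℕ} {ε : ℝ} (h : Ctx T t P ε s) (k : ℕ) :
    (sizePow k).eval s = (P : ℝ) ^ k := by
  simp [CondSampling.sizePow, RExpr.eval_pow, RExpr.eval, NExpr.eval, nv, h.size]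

theorem Ctx.ltPow {T t P : ℕ} {ε : ℝ} (h : Ctx T t P ε s) {a k i : ℕ} (hi : s.nat a 0 0 = i) :
    (ltPow a k).eval s ↔ i < P ^ k := by
  simp only [CondSampling.ltPow, Test.eval, h.sizePow, RExpr.eval, nv, NExpr.eval, hi]
  exact_mod_cast Iff.rfl

theorem ltRows_eval {a i m : ℕ} (hi : s.nat a 0 0 = i) (hm : s.nat 1 0 0 = m) :
    (ltRows a).eval s ↔ i < m + 1 := by
  simp [ltRows, Test.eval, nv, NExpr.eval, hi, hm]

end Frames

/-! ### Estimation of conditional probabilities -/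

section Estimation

variable {O : ℕ} {p : List (Fin O) → PMF (Fin O)} {T t P : ℕ} {ε : ℝ} {s : Store}

/-- Chebyshev's inequality. The clause that an impossible symbol is never counted is what makes
relative accuracy possible at probability zero. -/
theorem runs_count (hc : Ctx T t P ε s) {u : ℕ} (hu : s.nat 11 0 0 = u) (hT : t + u < T)
    (h : List (Fin O)) (hlen : h.length = t + u)
    (hrow : ∀ j (hj : j < h.length), s.nat 4 0 j = h[j]) (o : Fin O) (ho : s.nat 3 0 u = o)
    (kW : ℕ) (hP : 0 < P) {a : ℝ} (ha : 0 < a) :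
    Runs p T (countProg kW) (P ^ kW * 7 + 5) s
      (fun s' => Frame [5, 12, 13] [] s s' ∧ ((p h o).toReal = 0 → s'.nat 13 0 0 = 0))
      (fun s' => ind (¬ |(s'.nat 13 0 0 : ℝ) - (P : ℝ) ^ kW * (p h o).toReal| ≤ (P : ℝ) ^ kW * a))
      (ENNReal.ofReal (1 / ((P : ℝ) ^ kW * a ^ 2))) := by
  set q := (p h o).toReal with hq
  set W : ℝ := (P : ℝ) ^ kW with hW
  have hP' : (0 : ℝ) < P := by exact_mod_cast hP
  have hW0 : 0 < W := by positivity
  have hq0 : 0 ≤ q := ENNReal.toReal_nonneg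
  have hq1 : q ≤ 1 := toReal_pmf_le_one _ _
  obtain ⟨k, hk⟩ : ∃ k, T - h.length = k + 1 := ⟨T - h.length - 1, by omega⟩
  -- Each sample adds variance q(1 - q) ≤ 1 to the squared deviation, paid for by the decrease of W
  -- - i. The initial value W/(Wa)² is the Chebyshev bound.
  let val : ℕ → ℕ → ℝ := fun i x => ((x - i * q) ^ 2 + (W - i)) / (W * a) ^ 2
  have hval : ∀ i x : ℕ, (i : ℝ) ≤ W → 0 ≤ val i x := fun i x hi =>
    div_nonneg (add_nonneg (sq_nonneg _) (by linarith)) (by positivity)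
  have hloop := Runs.forLoop (p := p) (T := T) (a := 12) (t := ltPow 12 kW) (n := 4) (K := P ^ kW)
    (c := .seq (.query 4 (.lit 0) (.plus cutE (nv 11)) 5 (.lit 0))
        (.ite (.both (.neg (.natLT (nv 5) (.cell 3 (.lit 0) (nv 11))))
            (.neg (.natLT (.cell 3 (.lit 0) (nv 11)) (nv 5))))
          (.setNat 13 (.lit 0) (.lit 0) (.plus (nv 13) (.lit 1)))
          .skip))
    (I := fun _ s' => Frame [5, 12, 13] [] s s' ∧ (q = 0 → s'.nat 13 0 0 = 0))
    (g := fun i s' => ENNReal.ofReal (val i (s'.nat 13 0 0)))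
    (s := s.setNat 13 0 0 0)
    (fun i s' _ hI hi => (hc.frame hI.1 (by decide) (by decide) (by decide)).ltPow hi)
    (fun i s' v hI => ⟨hI.1.setNat (by decide) _ _ _, by
      rw [Store.setNat_nat_of_ne _ (by decide)]; exact hI.2⟩)
    (fun i s' v => by rw [Store.setNat_nat_of_ne _ (by decide)])
    ⟨(Frame.refl _ _ _).setNat (by decide) _ _ _, fun _ => Store.setNat_same _ _ _ _ _⟩
    (by
      intro i s1 hi hI hi1
      have hc1 := hc.frame hI.1 (by decide) (by decide) (by decide)
      have h11 : s1.nat 11 0 0 = u := by rw [hI.1.nat 11 (by decide)]; exact hu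
      have h3 : s1.nat 3 0 u = o := by rw [hI.1.nat 3 (by decide)]; exact ho
      have hiW : ((i + 1 : ℕ) : ℝ) ≤ W := by
        rw [hW]
        exact_mod_cast hi
      have hquery : Runs p T (.query 4 (.lit 0) (.plus cutE (nv 11)) 5 (.lit 0)) 1 s1
          (fun s2 => Frame [5] [] s1 s2 ∧ ∃ o' : Fin O, p h o' ≠ 0 ∧ s2.nat 5 0 0 = o')
          (fun s2 => if s2.nat 5 0 0 = o then ENNReal.ofReal (val (i + 1) (s2.nat 13 0 0 + 1))
            else ENNReal.ofReal (val (i + 1) (s2.nat 13 0 0)))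
          (ENNReal.ofReal (val i (s1.nat 13 0 0))) := by
        refine Runs.query h ?_ (by omega) ?_ ?_ ?_
        · simp [NExpr.eval, cutE, nv, hc1.cut, h11, hlen]
        · intro j hj
          rw [NExpr.eval, hI.1.nat 4 (by decide)]
          exact hrow j hj
        · intro l hl
          refine ⟨(Frame.refl _ _ _).writeSeq (by decide) _ _, ?_⟩
          rw [hk] at hl
          simp only [futureLaw, PMF.mem_support_bind_iff, PMF.mem_support_map_iff] at hl
          obtain ⟨o', ho', l', -, rfl⟩ := hl
          refine ⟨o', (PMF.mem_support_iff _ _).1 ho', ?_⟩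
          exact Store.writeSeq_nat_row _ _ _ _ _ (by simp)
        · rw [hk, ex_futureLaw_head p h k _ (fun o' => if o' = o
              then ENNReal.ofReal (val (i + 1) (s1.nat 13 0 0 + 1))
              else ENNReal.ofReal (val (i + 1) (s1.nat 13 0 0))),
            ex_ite_eq _ _ (hval _ _ hiW) (hval _ _ hiW)]
          · refine ENNReal.ofReal_le_ofReal ?_
            rw [← hq]
            simp only [val]
            rw [mul_div_assoc', mul_div_assoc', ← add_div]
            refine div_le_div_of_nonneg_right ?_ (by positivity)
            push_cast
            nlinarith [mul_nonneg hq0 hq0]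
          · intro o' l
            have h5 : (s1.writeSeq 5 (NExpr.eval s1 (.lit 0)) (o' :: l)).nat 5 0 0 = o' :=
              Store.writeSeq_nat_row _ _ _ _ _ (by simp)
            rw [h5, Store.writeSeq_nat_of_ne _ (by decide)]
            simp only [Fin.val_inj]
      refine (Runs.seq hquery (n₂ := 2) (fun s2 hs2 => ?_)).conseq (n := 1 + 1 + 2) le_rfl
        (fun _ h => h) (fun _ _ => le_rfl) le_rfl
      obtain ⟨hf2, o', ho', h5⟩ := hs2
      have h112 : s2.nat 11 0 0 = u := by rw [hf2.nat 11 (by decide)]; exact h11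
      have h32 : s2.nat 3 0 u = o := by rw [hf2.nat 3 (by decide)]; exact h3
      have h12 : s2.nat 12 0 0 = i := by rw [hf2.nat 12 (by decide)]; exact hi1
      have hfr : Frame [5, 12, 13] [] s s2 := hI.1.trans (hf2.mono (by decide) (by decide))
      have htest : (Test.both (.neg (.natLT (nv 5) (.cell 3 (.lit 0) (nv 11))))
            (.neg (.natLT (.cell 3 (.lit 0) (nv 11)) (nv 5)))).eval s2 ↔ s2.nat 5 0 0 = o := by
        simp only [Test.eval, nv, NExpr.eval, h112, h32]
        omega
      refine Runs.ite (fun hb => ?_) (fun hb => ?_)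
      · rw [htest] at hb
        refine Runs.setNat ⟨⟨hfr.setNat (by decide) _ _ _, fun hq00 => ?_⟩, ?_⟩ ?_
        · exfalso
          have : o' = o := Fin.ext (h5.symm.trans hb)
          rw [this] at ho'
          rw [hq, ENNReal.toReal_eq_zero_iff] at hq00
          rcases hq00 with h0 | h0
          · exact ho' h0
          · exact PMF.apply_ne_top _ _ h0
        · rw [Store.setNat_nat_of_ne _ (by decide)]
          exact h12
        · simp only [NExpr.eval, nv]
          rw [if_pos hb, Store.setNat_same]
      · rw [htest] at hb
        refine Runs.skip ⟨⟨hfr, fun hq00 => ?_⟩, h12⟩ ?_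
        · rw [hf2.nat 13 (by decide)]
          exact hI.2 hq00
        · rw [if_neg hb])
  refine (Runs.setNat_seq (i := .lit 0) (j := .lit 0) (e := .lit 0) hloop).conseq (by omega)
    (fun s' hs' => hs'.1) (fun s' _ => ind_le fun hbad => ?_) ?_
  · rw [ENNReal.one_le_ofReal]
    simp only [val]
    push_cast
    rw [le_div_iff₀ (by positivity), one_mul, ← hW, sub_self, add_zero]
    rw [not_le] at hbad
    rw [sq_le_sq, abs_of_pos (by positivity : 0 < W * a)]
    exact hbad.le
  · refine ENNReal.ofReal_le_ofReal (le_of_eq ?_)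
    simp only [val, Store.setNat_same]
    simp only [Nat.cast_zero, zero_mul, sub_self, sub_zero]
    field_simp
    ring

end Estimation

/-! ### Relative estimates of the probability of a whole future. -/

section Density

variable {O : ℕ} {p : List (Fin O) → PMF (Fin O)} {T t P : ℕ} {ε : ℝ} {s : Store}

/-- Relative approximation with `k` factors. -/
def Within (η : ℝ) (k : ℕ) (v d : ℝ) : Prop := (1 - η) ^ k * v ≤ d ∧ d ≤ (1 + η) ^ k * v

theorem Within.mul {η : ℝ} (hη : 0 ≤ η) (hη1 : η ≤ 1) {k : ℕ} {v d q c : ℝ} (hv : 0 ≤ v)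
    (hd : 0 ≤ d) (h : Within η k v d) (hq : 0 ≤ q) (hc1 : (1 - η) * q ≤ c)
    (hc2 : c ≤ (1 + η) * q) : Within η (k + 1) (v * q) (d * c) := by
  have h0 : 0 ≤ 1 - η := by linarith
  have hc : 0 ≤ c := (mul_nonneg h0 hq).trans hc1
  constructor
  · calc (1 - η) ^ (k + 1) * (v * q) = ((1 - η) ^ k * v) * ((1 - η) * q) := by ring
      _ ≤ d * c := mul_le_mul h.1 hc1 (mul_nonneg h0 hq) hd
  · calc d * c ≤ ((1 + η) ^ k * v) * ((1 + η) * q) :=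
        mul_le_mul h.2 hc2 hc (mul_nonneg (by positivity) hv)
      _ = _ := by ring

/-- A one-step probability is zero or at least α, so additive error αη is relative error η. -/
theorem within_of_count {α η q W c : ℝ} (hη : 0 ≤ η) (hW : 0 < W)
    (hq : q = 0 ∨ α ≤ q) (h0 : q = 0 → c = 0) (hc : |c - W * q| ≤ W * (α * η)) :
    (1 - η) * q ≤ c / W ∧ c / W ≤ (1 + η) * q := by
  rcases hq with hq | hq
  · simp [hq, h0 hq]
  · have h1 : α * η ≤ q * η := mul_le_mul_of_nonneg_right hq hη
    have h2 : W * (α * η) ≤ W * (q * η) := mul_le_mul_of_nonneg_left h1 hW.le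
    rw [abs_le] at hc
    rw [le_div_iff₀ hW, div_le_iff₀ hW]
    constructor <;> nlinarith

/-- The chain rule multiplies the T - t one-step estimates while the history buffer is extended
along f. The potential is the indicator that the partial product is already off, plus the failure
probabilities of the steps still to come. -/
theorem runs_dens {α : ℝ} (hp : IsRegular p T α) (hα : 0 < α) (ht : t ≤ T)
    (hc : Ctx T t P ε s) {j : ℕ} (hj : s.nat 10 0 0 = j) (x : Fin t → Fin O)
    (hx : ∀ i : Fin t, s.nat 2 j i = x i) (f : Fin (T - t) → Fin O)
    (hf : ∀ i : Fin (T - t), s.nat 3 0 i = f i) (kW : ℕ) (hP : 0 < P) {η : ℝ} (hη : 0 < η)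
    (hη1 : η ≤ 1) :
    Runs p T (densProg kW) (t * 4 + (T - t) * (P ^ kW * 7 + 12) + 9) s
      (fun s' => Frame [4, 5, 11, 12, 13, 14] [2] s s' ∧ 0 ≤ s'.real 2 0 j ∧
        ∀ j' ≠ j, s'.real 2 0 j' = s.real 2 0 j')
      (fun s' => ind (¬ Within η (T - t) (fut p T t x f) (s'.real 2 0 j)))
      (ENNReal.ofReal ((T - t : ℕ) * (1 / ((P : ℝ) ^ kW * (α * η) ^ 2)))) := by
  set δ := 1 / ((P : ℝ) ^ kW * (α * η) ^ 2) with hδ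
  have hP' : (0 : ℝ) < P := by exact_mod_cast hP
  have hδ0 : 0 ≤ δ := by positivity
  set l := List.ofFn x ++ List.ofFn f with hl
  have hllen : l.length = T := by
    simp only [hl, List.length_append, List.length_ofFn]
    omega
  have hcopy : Runs p T (forLoop 14 (.natLT (nv 14) cutE)
      (.setNat 4 (.lit 0) (nv 14) (.cell 2 (nv 10) (nv 14)))) (t * 4 + 3) s
      (fun s' => Frame [4, 14] [] s s' ∧ ∀ k < t, s'.nat 4 0 k = s.nat 2 j k) (fun _ => 0) 0 := by
    refine (Runs.forLoop (n := 1) (K := t)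
      (I := fun i s' => Frame [4, 14] [] s s' ∧ ∀ k < i, s'.nat 4 0 k = s.nat 2 j k)
      (g := fun _ _ => 0) ?_ ?_ ?_ ?_ ?_).conseq le_rfl (fun _ h => h.1) (fun _ _ => le_rfl) le_rfl
    · intro i s1 _ hI hi
      have := (hc.frame hI.1 (by decide) (by decide) (by decide)).cut
      simp [Test.eval, nv, NExpr.eval, cutE, hi, this]
    · intro i s1 v hI
      exact ⟨hI.1.setNat (by decide) _ _ _, by
        rw [Store.setNat_nat_of_ne _ (by decide)]; exact hI.2⟩
    · intros; rfl
    · exact ⟨Frame.refl _ _ _, by omega⟩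
    · intro i s1 hi hI hi1
      refine Runs.setNat ⟨⟨hI.1.setNat (by decide) _ _ _, fun k hk => ?_⟩, ?_⟩ le_rfl
      · have h10 : s1.nat 10 0 0 = j := by rw [hI.1.nat 10 (by decide)]; exact hj
        simp only [NExpr.eval, nv, hi1, h10, Store.setNat_nat, true_and]
        split_ifs with h
        · rw [h, hI.1.nat 2 (by decide)]
        · exact hI.2 k (by omega)
      · rw [Store.setNat_nat_of_ne _ (by decide)]
        exact hi1
  let V : ℕ → ℝ := fun u => condProb p (List.ofFn x) ((List.ofFn f).take u)
  have hV : ∀ u (hu : u < T - t),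
      V (u + 1) = V u * (p (l.take (t + u)) (f ⟨u, hu⟩)).toReal := by
    intro u hu
    have h1 : (List.ofFn f).take (u + 1) = (List.ofFn f).take u ++ [f ⟨u, hu⟩] := by
      rw [List.take_succ_eq_append_getElem (by simpa using hu)]
      simp
    have h2 : l.take (t + u) = List.ofFn x ++ (List.ofFn f).take u := by
      rw [hl, List.take_append, List.length_ofFn, Nat.add_sub_cancel_left,
        List.take_of_length_le (by simp)]
    simp only [V]
    rw [h1, condProb_concat, h2]
  have hloop : ∀ s1, (Frame [4, 14] [] s s1 ∧ ∀ k < t, s1.nat 4 0 k = s.nat 2 j k) →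
      Runs p T (forLoop 11 (.natLT (nv 11) (.minus lenE cutE))
        (.seq (countProg kW)
          (.seq (.setReal 2 (.lit 0) (nv 10)
              (.times (.cell 2 (.lit 0) (nv 10)) (.over (.ofNExpr (nv 13)) (sizePow kW))))
            (.setNat 4 (.lit 0) (.plus cutE (nv 11)) (.cell 3 (.lit 0) (nv 11))))))
      ((T - t) * (P ^ kW * 7 + 12) + 3) (s1.setReal 2 0 j 1)
      (fun s' => Frame [4, 5, 11, 12, 13, 14] [2] s s' ∧ 0 ≤ s'.real 2 0 j ∧
        ∀ j' ≠ j, s'.real 2 0 j' = s.real 2 0 j')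
      (fun s' => ind (¬ Within η (T - t) (fut p T t x f) (s'.real 2 0 j)))
      (ENNReal.ofReal ((T - t : ℕ) * δ)) := by
    intro s1 hs1
    refine (Runs.forLoop (n := P ^ kW * 7 + 9) (K := T - t)
      (I := fun u s' => (Frame [4, 5, 11, 12, 13, 14] [2] s s' ∧ 0 ≤ s'.real 2 0 j ∧
        ∀ j' ≠ j, s'.real 2 0 j' = s.real 2 0 j') ∧
        ∀ k (hk : k < l.length), k < t + u → s'.nat 4 0 k = l[k])
      (g := fun u s' => ind (¬ Within η u (V u) (s'.real 2 0 j)) +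
        ENNReal.ofReal ((T - t - u : ℕ) * δ)) ?_ ?_ ?_ ?_ ?_).conseq le_rfl (fun _ h => h.1.1) ?_ ?_
    · intro u s2 _ hI hu
      have hc2 := hc.frame hI.1.1 (by decide) (by decide) (by decide)
      simp [Test.eval, nv, NExpr.eval, cutE, lenE, hu, hc2.cut, hc2.len]
    · intro u s2 v hI
      refine ⟨⟨hI.1.1.setNat (by decide) _ _ _, hI.1.2⟩, ?_⟩
      rw [Store.setNat_nat_of_ne _ (by decide)]
      exact hI.2
    · intros; rfl
    · refine ⟨⟨(hs1.1.mono (by decide) (by decide)).setReal (by decide) _ _ _, ?_, ?_⟩, ?_⟩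
      · simp [Store.setReal_real]
      · intro j' hj'
        rw [Store.setReal_real, if_neg (by simpa using hj'), hs1.1.real 2 (by decide)]
      · intro k hk hkt
        rw [add_zero] at hkt
        rw [Store.setReal_nat, hs1.2 k hkt]
        have := hx ⟨k, hkt⟩
        simp only at this
        rw [this]
        simp [hl, hkt]
    · intro u s2 hu hI hu2
      have hc2 := hc.frame hI.1.1 (by decide) (by decide) (by decide)
      have h32 : s2.nat 3 0 u = f ⟨u, hu⟩ := by
        rw [hI.1.1.nat 3 (by decide)]
        exact hf ⟨u, hu⟩
      have h102 : s2.nat 10 0 0 = j := by rw [hI.1.1.nat 10 (by decide)]; exact hj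
      have hlen : (l.take (t + u)).length = t + u := by
        rw [List.length_take, hllen]
        omega
      have hcnt := runs_count (p := p) hc2 hu2 (by omega) (l.take (t + u)) hlen
        (fun k hk => by
          rw [List.getElem_take]
          exact hI.2 k (by omega) (by omega)) (f ⟨u, hu⟩) h32 kW hP
        (a := α * η) (by positivity)
      set q := (p (l.take (t + u)) (f ⟨u, hu⟩)).toReal with hq
      have hqα : q = 0 ∨ α ≤ q := by
        by_cases h0 : p (l.take (t + u)) (f ⟨u, hu⟩) = 0
        · exact Or.inl (by simp [hq, h0])
        · exact Or.inr (hp _ (by omega) _ h0)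
      have h1 := hcnt.mono
        (f' := fun s3 => (ind (¬ Within η u (V u) (s2.real 2 0 j)) +
          ENNReal.ofReal ((T - t - (u + 1) : ℕ) * δ)) +
          ind (¬ |(s3.nat 13 0 0 : ℝ) - (P : ℝ) ^ kW * q| ≤ (P : ℝ) ^ kW * (α * η)))
        (b' := ind (¬ Within η u (V u) (s2.real 2 0 j)) +
          ENNReal.ofReal ((T - t - u : ℕ) * δ))
        (S' := fun s3 => Frame [5, 12, 13] [] s2 s3 ∧ (q = 0 → s3.nat 13 0 0 = 0))
        (ind (¬ Within η u (V u) (s2.real 2 0 j)) +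
          ENNReal.ofReal ((T - t - (u + 1) : ℕ) * δ)) 1 le_rfl
        (fun _ h => h) (fun _ _ => by rw [one_mul]) (by
          rw [one_mul, add_assoc, ← ENNReal.ofReal_add (by positivity) (by positivity)]
          refine add_le_add le_rfl (ENNReal.ofReal_le_ofReal (le_of_eq ?_))
          have : T - t - u = (T - t - (u + 1)) + 1 := by omega
          rw [this]
          push_cast
          ring)
      refine (Runs.seq h1 (n₂ := 3) (fun s3 hs3 => ?_)).conseq (by omega)
        (fun _ h => h) (fun _ _ => le_rfl) le_rfl
      obtain ⟨hf3, hz3⟩ := hs3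
      have hc3 := hc2.frame hf3 (by decide) (by decide) (by decide)
      have h103 : s3.nat 10 0 0 = j := by rw [hf3.nat 10 (by decide)]; exact h102
      have h113 : s3.nat 11 0 0 = u := by rw [hf3.nat 11 (by decide)]; exact hu2
      have h33 : s3.nat 3 0 u = f ⟨u, hu⟩ := by rw [hf3.nat 3 (by decide)]; exact h32
      have hr3 : s3.real 2 = s2.real 2 := hf3.real 2 (by decide)
      have hfr : Frame [4, 5, 11, 12, 13, 14] [2] s s3 :=
        hI.1.1.trans (hf3.mono (by decide) (by decide))
      have hrow3 : s3.nat 4 = s2.nat 4 := hf3.nat 4 (by decide)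
      refine Runs.setReal_seq (n := 1) (Runs.setNat ⟨⟨⟨?_, ?_, ?_⟩, ?_⟩, ?_⟩ ?_)
      · exact (hfr.setReal (by decide) _ _ _).setNat (by decide) _ _ _
      · simp only [NExpr.eval, RExpr.eval, nv, h103, Store.setNat_real, Store.setReal_real,
          and_self, if_true, hr3, hc3.sizePow]
        exact mul_nonneg hI.1.2.1 (by positivity)
      · intro j' hj'
        simp only [NExpr.eval, nv, h103, Store.setNat_real, Store.setReal_real, hj', and_false,
          if_false, hr3]
        exact hI.1.2.2 j' hj'
      · intro k hk hku
        simp only [NExpr.eval, nv, cutE, Store.setReal_nat, hc3.cut, h113, Store.setNat_nat,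
          true_and, h33]
        split_ifs with hkeq
        · subst hkeq
          simp [hl]
        · rw [hrow3]
          exact hI.2 k hk (by omega)
      · rw [Store.setNat_nat_of_ne _ (by decide), Store.setReal_nat]
        exact h113
      · rw [add_right_comm]
        refine add_le_add (ind_le fun hbad => ?_) le_rfl
        by_contra hcon
        have hgood : Within η u (V u) (s2.real 2 0 j) := by
          by_contra h
          rw [ind_of h] at hcon
          exact hcon (le_add_of_nonneg_right zero_le)
        have hcount : |(s3.nat 13 0 0 : ℝ) - (P : ℝ) ^ kW * q| ≤ (P : ℝ) ^ kW * (α * η) := by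
          by_contra h
          rw [ind_of h] at hcon
          exact hcon (le_add_of_nonneg_left zero_le)
        apply hbad
        have h2 := within_of_count hη.le (by positivity) hqα
          (fun h => by exact_mod_cast hz3 h) hcount
        simp only [NExpr.eval, RExpr.eval, nv, h103, Store.setNat_real, Store.setReal_real,
          and_self, if_true, hr3, hc3.sizePow]
        rw [hV u hu, ← hq]
        exact hgood.mul hη.le hη1 (condProb_nonneg p _ _) hI.1.2.1 ENNReal.toReal_nonneg h2.1 h2.2
    · intro s2 _
      have : V (T - t) = fut p T t x f := by
        simp only [V, fut]
        rw [List.take_of_length_le (by simp)]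
      rw [this]
      exact le_self_add
    · have : Within η 0 (V 0) ((s1.setReal 2 0 j 1).real 2 0 j) := by
        simp [Within, V, condProb_nil, Store.setReal_real]
      rw [ind_of_not (not_not.2 this), zero_add, Nat.sub_zero]
  have h1 := hcopy.mono (f' := fun _ => ENNReal.ofReal ((T - t : ℕ) * δ))
    (ENNReal.ofReal ((T - t : ℕ) * δ)) 0 le_rfl (fun _ h => h) (fun _ _ => by simp)
    (by simp : _ ≤ ENNReal.ofReal ((T - t : ℕ) * δ))
  refine (Runs.seq h1 fun s1 hs1 => Runs.setReal_seq (i := .lit 0) (j := nv 10)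
    (e := .ofNExpr (.lit 1)) ?_).conseq (n := 1 + (t * 4 + 3) +
      ((T - t) * (P ^ kW * 7 + 12) + 3 + 2)) (by omega) (fun _ h => h)
    (fun _ _ => le_rfl) le_rfl
  have h10 : s1.nat 10 0 0 = j := by rw [hs1.1.nat 10 (by decide)]; exact hj
  simpa [NExpr.eval, RExpr.eval, nv, h10] using hloop s1 hs1

end Density

/-! ### Density estimates for all rows and sweeps over the matrix entries. -/

section Sampling

variable {O : ℕ} {p : List (Fin O) → PMF (Fin O)} {T t P : ℕ} {ε : ℝ} {s : Store}

theorem Store.writeSeq_injective (s : Store) (a i : ℕ) {k : ℕ} :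
    Function.Injective fun f : Fin k → Fin O => s.writeSeq a i (List.ofFn f) := by
  intro f f' h
  funext j
  have h1 := Store.writeSeq_nat_row s a i (List.ofFn f) j (by simp)
  have h2 := Store.writeSeq_nat_row s a i (List.ofFn f') j (by simp)
  simp only at h
  rw [h, h2] at h1
  simp only [List.getElem_ofFn, Fin.eta] at h1
  exact (Fin.ext h1).symm

/-- A query followed by a program whose bound depends on the answer. -/
theorem Runs.query_seq {a : ℕ} {i n : NExpr} {a' : ℕ} {i' : NExpr} {c : Prog} {N : ℕ}
    {S : Store → Prop} {g : Store → ENNReal} {b : ENNReal} (h : List (Fin O))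
    (hn : h.length = n.eval s) (hT : h.length ≤ T)
    (hrow : ∀ j (hj : j < h.length), s.nat a (i.eval s) j = h[j])
    (k : ℕ) (hk : T - h.length = k) {B : (Fin k → Fin O) → ENNReal}
    (hc : ∀ f : Fin k → Fin O, List.ofFn f ∈ (futureLaw p h k).support →
      Runs p T c N (s.writeSeq a' (i'.eval s) (List.ofFn f)) S g (B f))
    (hb : ∑ f : Fin k → Fin O, ENNReal.ofReal (condProb p h (List.ofFn f)) * B f ≤ b) :
    Runs p T (.seq (.query a i n a' i') c) (N + 2) s S g b := by
  classical
  let wr : (Fin k → Fin O) → Store := fun f => s.writeSeq a' (i'.eval s) (List.ofFn f)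
  have hwr : Function.Injective wr := Store.writeSeq_injective s a' (i'.eval s)
  -- Writing the answer is injective, so the answer can be recovered from the memory and `B` becomes
  -- a function of the memory.
  let G : Store → ENNReal := fun s1 => if h : ∃ f, wr f = s1 then B h.choose else 0
  have hG : ∀ f, G (wr f) = B f := by
    intro f
    have hex : ∃ f', wr f' = wr f := ⟨f, rfl⟩
    simp only [G, dif_pos hex]
    rw [hwr hex.choose_spec]
  have hq : Runs p T (.query a i n a' i') 1 s
      (fun s1 => ∃ f, List.ofFn f ∈ (futureLaw p h k).support ∧ s1 = wr f) G b := by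
    refine Runs.query h hn hT hrow ?_ ?_
    · intro l hl
      rw [hk] at hl
      have hlen := length_of_mem_futureLaw p hl
      subst hlen
      refine ⟨l.get, ?_, ?_⟩
      · rwa [List.ofFn_get]
      · simp only [wr, List.ofFn_get]
    · rw [hk, ex_futureLaw]
      refine le_trans (le_of_eq (Finset.sum_congr rfl fun f _ => ?_)) hb
      exact congrArg _ (hG f)
  refine (Runs.seq hq (n₂ := N) ?_).conseq (by omega) (fun _ h => h) (fun _ _ => le_rfl) le_rfl
  rintro s1 ⟨f, hf, rfl⟩
  rw [hG]
  exact hc f hf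

/-- The number of steps of `densProg`. -/
def densSteps (T t W : ℕ) : ℕ := t * 4 + (T - t) * (W * 7 + 12) + 9

theorem runs_allDens {α : ℝ} (hp : IsRegular p T α) (hα : 0 < α) (ht : t ≤ T)
    (hc : Ctx T t P ε s) {m : ℕ} (hm : s.nat 1 0 0 = m) (bs : ℕ → Fin t → Fin O)
    (hbs : ∀ j < m + 1, ∀ i : Fin t, s.nat 2 j i = bs j i) (f : Fin (T - t) → Fin O)
    (hf : ∀ i : Fin (T - t), s.nat 3 0 i = f i) (kW : ℕ) (hP : 0 < P) {η : ℝ} (hη : 0 < η)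
    (hη1 : η ≤ 1) :
    Runs p T (allDensProg kW) ((m + 1) * (densSteps T t (P ^ kW) + 3) + 3) s
      (fun s' => Frame [4, 5, 10, 11, 12, 13, 14] [2] s s' ∧ ∀ j < m + 1, 0 ≤ s'.real 2 0 j)
      (fun s' => ind (¬ ∀ j < m + 1, Within η (T - t) (fut p T t (bs j) f) (s'.real 2 0 j)))
      (ENNReal.ofReal ((m + 1 : ℕ) * ((T - t : ℕ) * (1 / ((P : ℝ) ^ kW * (α * η) ^ 2))))) := by
  set δ := (T - t : ℕ) * (1 / ((P : ℝ) ^ kW * (α * η) ^ 2)) with hδ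
  have hP' : (0 : ℝ) < P := by exact_mod_cast hP
  have hδ0 : 0 ≤ δ := by positivity
  refine (Runs.forLoop (n := densSteps T t (P ^ kW)) (K := m + 1)
    (I := fun i s' => Frame [4, 5, 10, 11, 12, 13, 14] [2] s s' ∧ ∀ j < i, 0 ≤ s'.real 2 0 j)
    (g := fun i s' =>
      ind (¬ ∀ j < i, Within η (T - t) (fut p T t (bs j) f) (s'.real 2 0 j)) +
        ENNReal.ofReal ((m + 1 - i : ℕ) * δ)) ?_ ?_ ?_ ?_ ?_).conseq le_rfl (fun _ h => h.1) ?_ ?_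
  · intro i s1 _ hI hi
    exact ltRows_eval hi (by rw [hI.1.nat 1 (by decide)]; exact hm)
  · intro i s1 v hI
    exact ⟨hI.1.setNat (by decide) _ _ _, hI.2⟩
  · intros; rfl
  · exact ⟨Frame.refl _ _ _, by omega⟩
  · intro i s1 hi hI hi1
    have hc1 := hc.frame hI.1 (by decide) (by decide) (by decide)
    refine (runs_dens hp hα ht hc1 hi1 (bs i) (fun k => ?_) f (fun k => ?_) kW hP hη hη1).mono
      (ind (¬ ∀ j < i, Within η (T - t) (fut p T t (bs j) f) (s1.real 2 0 j)) +
        ENNReal.ofReal ((m + 1 - (i + 1) : ℕ) * δ)) 1 le_rfl ?_ ?_ ?_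
    · rw [hI.1.nat 2 (by decide)]
      exact hbs i hi k
    · rw [hI.1.nat 3 (by decide)]
      exact hf k
    · rintro s2 ⟨hfr, h0, hoth⟩
      refine ⟨⟨hI.1.trans (hfr.mono (by decide) (by decide)), fun j hj => ?_⟩, ?_⟩
      · rcases Nat.lt_succ_iff_lt_or_eq.1 hj with hj | rfl
        · rw [hoth j hj.ne]
          exact hI.2 j hj
        · exact h0
      · rw [hfr.nat 10 (by decide)]
        exact hi1
    · rintro s2 ⟨hfr, h0, hoth⟩
      rw [one_mul, add_right_comm]
      refine add_le_add (le_trans (ind_mono fun hbad => ?_) (ind_or_le _ _)) le_rfl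
      by_contra hcon
      push Not at hcon
      refine hbad fun j hj => ?_
      rcases Nat.lt_succ_iff_lt_or_eq.1 hj with hj | rfl
      · rw [hoth j hj.ne]
        exact hcon.1 j hj
      · exact hcon.2
    · rw [one_mul, add_assoc, ← ENNReal.ofReal_add (by positivity) (by positivity)]
      refine add_le_add le_rfl (ENNReal.ofReal_le_ofReal (le_of_eq ?_))
      have : m + 1 - i = (m + 1 - (i + 1)) + 1 := by omega
      rw [this]
      push_cast
      ring
  · intro s1 _
    exact le_self_add
  · rw [ind_of_not (by simp), zero_add, Nat.sub_zero]

theorem runs_sum {m : ℕ} (hm : s.nat 1 0 0 = m) :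
    Runs p T sumProg ((m + 1) * 4 + 5) s
      (fun s' => Frame [10] [3] s s' ∧
        s'.real 3 0 0 = ∑ j ∈ Finset.range (m + 1), s.real 2 0 j) (fun _ => 0) 0 := by
  refine (Runs.setReal_seq (n := (m + 1) * 4 + 3) (Runs.forLoop (n := 1) (K := m + 1)
    (I := fun i s' => Frame [10] [3] s s' ∧ s'.real 3 0 0 = ∑ j ∈ Finset.range i, s.real 2 0 j)
    (g := fun _ _ => 0) ?_ ?_ ?_ ?_ ?_)).conseq le_rfl (fun _ h => h.1) (fun _ _ => le_rfl) le_rfl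
  · intro i s1 _ hI hi
    exact ltRows_eval hi (by rw [hI.1.nat 1 (by decide)]; exact hm)
  · intro i s1 v hI
    exact ⟨hI.1.setNat (by decide) _ _ _, hI.2⟩
  · intros; rfl
  · exact ⟨(Frame.refl _ _ _).setReal (by decide) _ _ _, by
      simp [NExpr.eval, RExpr.eval, Store.setReal_real]⟩
  · intro i s1 hi hI hi1
    refine Runs.setReal ⟨⟨hI.1.setReal (by decide) _ _ _, ?_⟩, hi1⟩ le_rfl
    simp only [NExpr.eval, RExpr.eval, nv, Store.setReal_real, and_self, if_true, hi1]
    rw [hI.2, Finset.sum_range_succ, hI.1.real 2 (by decide)]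

/-- The matrix is updated in place, so `e` may be evaluated knowing only that its own entry still
has the initial value; everything else it reads must lie outside the frame. -/
theorem runs_entries {m : ℕ} (hm : s.nat 1 0 0 = m) (e : RExpr) (φ : ℕ → ℕ → ℝ)
    (he : ∀ j < m + 1, ∀ l < m + 1, ∀ s1, Frame [10, 15] [1] s s1 → s1.nat 10 0 0 = j →
      s1.nat 15 0 0 = l → s1.real 1 j l = s.real 1 j l → e.eval s1 = φ j l) :
    Runs p T (entriesProg e) ((m + 1) * ((m + 1) * 4 + 6) + 3) s
      (fun s' => Frame [10, 15] [1] s s' ∧ ∀ j < m + 1, ∀ l < m + 1, s'.real 1 j l = φ j l)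
      (fun _ => 0) 0 := by
  refine (Runs.forLoop (n := (m + 1) * 4 + 3) (K := m + 1)
    (I := fun i s' => Frame [10, 15] [1] s s' ∧ ∀ j < m + 1, ∀ l < m + 1,
      s'.real 1 j l = if j < i then φ j l else s.real 1 j l)
    (g := fun _ _ => 0) ?_ ?_ ?_ ?_ ?_).conseq le_rfl ?_ (fun _ _ => le_rfl) le_rfl
  · intro i s1 _ hI hi
    exact ltRows_eval hi (by rw [hI.1.nat 1 (by decide)]; exact hm)
  · intro i s1 v hI
    exact ⟨hI.1.setNat (by decide) _ _ _, hI.2⟩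
  · intros; rfl
  · exact ⟨Frame.refl _ _ _, by simp⟩
  · intro i s1 hi hI hi1
    refine (Runs.forLoop (n := 1) (K := m + 1)
      (I := fun k s' => Frame [15] [1] s1 s' ∧ ∀ j < m + 1, ∀ l < m + 1,
        s'.real 1 j l = if j < i ∨ j = i ∧ l < k then φ j l else s.real 1 j l)
      (g := fun _ _ => 0) ?_ ?_ ?_ ?_ ?_).conseq le_rfl ?_ (fun _ _ => le_rfl) le_rfl
    · intro k s2 _ hI2 hk
      exact ltRows_eval hk (by
        rw [hI2.1.nat 1 (by decide), hI.1.nat 1 (by decide)]; exact hm)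
    · intro k s2 v hI2
      exact ⟨hI2.1.setNat (by decide) _ _ _, hI2.2⟩
    · intros; rfl
    · exact ⟨Frame.refl _ _ _, by simpa using hI.2⟩
    · intro k s2 hk hI2 hk2
      have h10 : s2.nat 10 0 0 = i := by rw [hI2.1.nat 10 (by decide)]; exact hi1
      have hev := he i hi k hk s2 (hI.1.trans (hI2.1.mono (by decide) (by decide))) h10 hk2 (by
        rw [hI2.2 i hi k hk]; simp)
      refine Runs.setReal ⟨⟨hI2.1.setReal (by decide) _ _ _, fun j hj l hl => ?_⟩, hk2⟩ le_rfl
      simp only [NExpr.eval, nv, h10, hk2, hev, Store.setReal_real, hI2.2 j hj l hl]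
      by_cases h : j = i ∧ l = k
      · obtain ⟨rfl, rfl⟩ := h
        simp
      · rw [if_neg h]
        have : (j < i ∨ j = i ∧ l < k) ↔ (j < i ∨ j = i ∧ l < k + 1) := by omega
        simp only [this]
    · rintro s2 ⟨⟨hf2, h2⟩, -⟩
      refine ⟨⟨hI.1.trans (hf2.mono (by decide) (by decide)), fun j hj l hl => ?_⟩, ?_⟩
      · rw [h2 j hj l hl]
        have : (j < i ∨ j = i ∧ l < m + 1) ↔ j < i + 1 := by omega
        simp only [this]
      · rw [hf2.nat 10 (by decide)]
        exact hi1
  · rintro s1 ⟨⟨hf1, h1⟩, -⟩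
    exact ⟨hf1, fun j hj l hl => by rw [h1 j hj l hl, if_pos hj]⟩

end Sampling

/-! ### Concentration of the Gram matrix -/

section Concentration

/-- The normalized products of nonnegative weights. -/
def ratio (n : ℕ) (w : ℕ → ℝ) (j l : ℕ) : ℝ := w j * w l / (∑ k ∈ Finset.range n, w k) ^ 2

theorem ratio_mem {n : ℕ} {w : ℕ → ℝ} (hw : ∀ j < n, 0 ≤ w j) {j l : ℕ} (hj : j < n) (hl : l < n) :
    0 ≤ ratio n w j l ∧ ratio n w j l ≤ 1 := by
  have h0 : ∀ k ∈ Finset.range n, 0 ≤ w k := fun k hk => hw k (Finset.mem_range.1 hk)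
  have h1 : w j ≤ ∑ k ∈ Finset.range n, w k := Finset.single_le_sum h0 (Finset.mem_range.2 hj)
  have h2 : w l ≤ ∑ k ∈ Finset.range n, w k := Finset.single_le_sum h0 (Finset.mem_range.2 hl)
  refine ⟨div_nonneg (mul_nonneg (hw j hj) (hw l hl)) (sq_nonneg _), ?_⟩
  refine div_le_one_of_le₀ ?_ (sq_nonneg _)
  rw [sq]
  exact mul_le_mul h1 h2 (hw l hl) ((hw j hj).trans h1)

/-- Numerator and squared normalization both lie within the factors (1 ± κ)² of their true values,
and the ratio is at most one; for κ ≤ 1/4 this gives additive error 8κ. -/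
theorem abs_ratio_sub_le {n : ℕ} {v d : ℕ → ℝ} {κ : ℝ} (hκ0 : 0 ≤ κ) (hκ : κ ≤ 1 / 4)
    (hv : ∀ j < n, 0 ≤ v j) (hd : ∀ j < n, (1 - κ) * v j ≤ d j ∧ d j ≤ (1 + κ) * v j) {j l : ℕ}
    (hj : j < n) (hl : l < n) : |ratio n d j l - ratio n v j l| ≤ 8 * κ := by
  have hk1 : 0 < 1 - κ := by linarith
  have hd0 : ∀ k < n, 0 ≤ d k := fun k hk => (mul_nonneg hk1.le (hv k hk)).trans (hd k hk).1
  set S := ∑ k ∈ Finset.range n, v k with hS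
  set D := ∑ k ∈ Finset.range n, d k with hD
  have hS0 : 0 ≤ S := Finset.sum_nonneg fun k hk => hv k (Finset.mem_range.1 hk)
  have hD1 : (1 - κ) * S ≤ D := by
    rw [hS, Finset.mul_sum]
    exact Finset.sum_le_sum fun k hk => (hd k (Finset.mem_range.1 hk)).1
  have hD2 : D ≤ (1 + κ) * S := by
    rw [hS, Finset.mul_sum]
    exact Finset.sum_le_sum fun k hk => (hd k (Finset.mem_range.1 hk)).2
  rcases hS0.eq_or_lt with h0 | hpos
  · have hD0 : D = 0 := by
      rw [← h0] at hD1 hD2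
      linarith
    simp only [ratio, ← hS, ← hD, hD0, ← h0]
    simpa using hκ0
  have hDpos : 0 < D := lt_of_lt_of_le (mul_pos hk1 hpos) hD1
  have hX := ratio_mem hv hj hl
  set X := ratio n v j l with hXdef
  have hXS : v j * v l = X * S ^ 2 := by
    rw [hXdef, ratio, ← hS, div_mul_cancel₀ _ (by positivity)]
  have hY : ratio n d j l = d j * d l / D ^ 2 := rfl
  have hjv := hv j hj
  have hlv := hv l hl
  have hup : d j * d l ≤ (1 + κ) ^ 2 * (X * S ^ 2) := by
    rw [← hXS]
    calc d j * d l ≤ ((1 + κ) * v j) * ((1 + κ) * v l) :=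
          mul_le_mul (hd j hj).2 (hd l hl).2 (hd0 l hl) (by positivity)
      _ = _ := by ring
  have hlow : (1 - κ) ^ 2 * (X * S ^ 2) ≤ d j * d l := by
    rw [← hXS]
    calc (1 - κ) ^ 2 * (v j * v l) = ((1 - κ) * v j) * ((1 - κ) * v l) := by ring
      _ ≤ d j * d l := mul_le_mul (hd j hj).1 (hd l hl).1 (by positivity) (hd0 j hj)
  have hDsq1 : (1 - κ) ^ 2 * S ^ 2 ≤ D ^ 2 := by
    rw [← mul_pow]
    exact pow_le_pow_left₀ (by positivity) hD1 2
  have hDsq2 : D ^ 2 ≤ (1 + κ) ^ 2 * S ^ 2 := by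
    rw [← mul_pow]
    exact pow_le_pow_left₀ hDpos.le hD2 2
  rw [hY, abs_le]
  constructor
  · rw [le_sub_iff_add_le, le_div_iff₀ (by positivity)]
    refine le_trans ?_ hlow
    have h1 : -(8 * κ) + X ≤ X * (1 - 8 * κ) := by nlinarith
    rcases le_or_gt (1 - 8 * κ) 0 with hneg | hposi
    · have : (-(8 * κ) + X) * D ^ 2 ≤ 0 :=
        mul_nonpos_of_nonpos_of_nonneg (h1.trans (mul_nonpos_of_nonneg_of_nonpos hX.1 hneg))
          (by positivity)
      have h2 : 0 ≤ (1 - κ) ^ 2 * (X * S ^ 2) := mul_nonneg (by positivity)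
        (mul_nonneg hX.1 (by positivity))
      linarith
    · calc (-(8 * κ) + X) * D ^ 2 ≤ X * (1 - 8 * κ) * D ^ 2 := by gcongr
        _ ≤ X * (1 - 8 * κ) * ((1 + κ) ^ 2 * S ^ 2) :=
            mul_le_mul_of_nonneg_left hDsq2 (mul_nonneg hX.1 hposi.le)
        _ = ((1 - 8 * κ) * (1 + κ) ^ 2) * (X * S ^ 2) := by ring
        _ ≤ (1 - κ) ^ 2 * (X * S ^ 2) := by
            refine mul_le_mul_of_nonneg_right ?_ (mul_nonneg hX.1 (by positivity))
            nlinarith [mul_nonneg hκ0 hκ0, mul_nonneg hκ0 (mul_nonneg hκ0 hκ0)]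
  · rw [sub_le_iff_le_add, div_le_iff₀ (by positivity)]
    refine hup.trans ?_
    calc (1 + κ) ^ 2 * (X * S ^ 2) = X * ((1 + κ) ^ 2 * S ^ 2) := by ring
      _ ≤ X * ((1 + 8 * κ) * ((1 - κ) ^ 2 * S ^ 2)) := by
          refine mul_le_mul_of_nonneg_left ?_ hX.1
          rw [← mul_assoc]
          refine mul_le_mul_of_nonneg_right ?_ (by positivity)
          nlinarith [mul_nonneg hκ0 hκ0, mul_nonneg hκ0 (mul_nonneg hκ0 hκ0)]
      _ ≤ X * ((1 + 8 * κ) * D ^ 2) := by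
          refine mul_le_mul_of_nonneg_left ?_ hX.1
          exact mul_le_mul_of_nonneg_left hDsq1 (by positivity)
      _ = (8 * κ * X + X) * D ^ 2 := by ring
      _ ≤ (8 * κ + X) * D ^ 2 := by
          refine mul_le_mul_of_nonneg_right ?_ (by positivity)
          nlinarith [hX.2]

/-- Bernoulli's inequality from below, the exponential from above. -/
theorem Within.of_le {η κ : ℝ} {k : ℕ} {v d : ℝ} (hη : 0 ≤ η) (hη1 : η ≤ 1) (hv : 0 ≤ v)
    (hk : 2 * (k * η) ≤ κ) (hκ : κ ≤ 1) (h : Within η k v d) :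
    (1 - κ) * v ≤ d ∧ d ≤ (1 + κ) * v := by
  have hkη : 0 ≤ k * η := by positivity
  constructor
  · refine le_trans (mul_le_mul_of_nonneg_right ?_ hv) h.1
    have := one_add_mul_le_pow (a := -η) (by linarith) k
    rw [← sub_eq_add_neg] at this
    linarith
  · refine h.2.trans (mul_le_mul_of_nonneg_right ?_ hv)
    have h1 : (1 + η) ^ k ≤ Real.exp (k * η) := by
      rw [Real.exp_nat_mul]
      exact pow_le_pow_left₀ (by positivity) (by linarith [Real.add_one_le_exp η]) k
    have h2 := Real.abs_exp_sub_one_sub_id_le (x := k * η) (by rw [abs_of_nonneg hkη]; linarith)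
    have h3 := (abs_le.1 h2).2
    nlinarith

/-- The exponential potential of the deviations of a matrix from `c`. -/
def pot (n : ℕ) (θ : ℝ) (G c : ℕ → ℕ → ℝ) : ℝ :=
  ∑ j ∈ Finset.range n, ∑ l ∈ Finset.range n,
    (Real.exp (θ * (G j l - c j l)) + Real.exp (-θ * (G j l - c j l)))

theorem pot_nonneg (n : ℕ) (θ : ℝ) (G c : ℕ → ℕ → ℝ) : 0 ≤ pot n θ G c :=
  Finset.sum_nonneg fun _ _ => Finset.sum_nonneg fun _ _ => by positivity

theorem pot_le {n : ℕ} {θ x : ℝ} (hθ : 0 ≤ θ) {G G' c : ℕ → ℕ → ℝ}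
    (h : ∀ j < n, ∀ l < n, |G' j l - G j l| ≤ x) :
    pot n θ G' c ≤ Real.exp (θ * x) * pot n θ G c := by
  simp only [pot, Finset.mul_sum]
  refine Finset.sum_le_sum fun j hj => Finset.sum_le_sum fun l hl => ?_
  have h1 := abs_le.1 (h j (Finset.mem_range.1 hj) l (Finset.mem_range.1 hl))
  rw [mul_add, ← Real.exp_add, ← Real.exp_add]
  refine add_le_add (Real.exp_le_exp.2 ?_) (Real.exp_le_exp.2 ?_) <;> nlinarith

/-- From e^x ≤ 1 + x + x² for |x| ≤ 1; the linear term has mean zero. -/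
theorem sum_mul_exp_le {F : Type} [Fintype F] {w X : F → ℝ} (hw : ∀ f, 0 ≤ w f)
    (hsum : ∑ f, w f = 1) (hX : ∀ f, 0 ≤ X f ∧ X f ≤ 1) {θ : ℝ} (hθ : |θ| ≤ 1) :
    ∑ f, w f * Real.exp (θ * (X f - ∑ g, w g * X g)) ≤ Real.exp (θ ^ 2) := by
  set μ := ∑ g, w g * X g with hμ
  have hμ0 : 0 ≤ μ := Finset.sum_nonneg fun f _ => mul_nonneg (hw f) (hX f).1
  have hμ1 : μ ≤ 1 := by
    rw [← hsum]
    exact Finset.sum_le_sum fun f _ => mul_le_of_le_one_right (hw f) (hX f).2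
  have hd : ∀ f, |X f - μ| ≤ 1 := fun f => by
    have := hX f
    rw [abs_le]
    constructor <;> linarith
  calc ∑ f, w f * Real.exp (θ * (X f - μ))
      ≤ ∑ f, w f * (1 + θ * (X f - μ) + θ ^ 2) := by
        refine Finset.sum_le_sum fun f _ => mul_le_mul_of_nonneg_left ?_ (hw f)
        have h1 : |θ * (X f - μ)| ≤ 1 := by
          rw [abs_mul]
          exact mul_le_one₀ hθ (abs_nonneg _) (hd f)
        have h2 := (abs_le.1 (Real.abs_exp_sub_one_sub_id_le h1)).2
        have h3 : (θ * (X f - μ)) ^ 2 ≤ θ ^ 2 := by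
          rw [mul_pow]
          refine mul_le_of_le_one_right (sq_nonneg _) ?_
          rw [← sq_abs]
          exact pow_le_one₀ (abs_nonneg _) (hd f)
        linarith
    _ = 1 + θ ^ 2 := by
        have h1 : ∀ f, w f * (1 + θ * (X f - μ) + θ ^ 2) =
            (1 - θ * μ + θ ^ 2) * w f + θ * (w f * X f) := fun f => by ring
        simp only [h1, Finset.sum_add_distrib, ← Finset.mul_sum, hsum, ← hμ]
        ring
    _ ≤ Real.exp (θ ^ 2) := by linarith [Real.add_one_le_exp (θ ^ 2)]

theorem sum_mul_pot_le {F : Type} [Fintype F] {w : F → ℝ} (hw : ∀ f, 0 ≤ w f)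
    (hsum : ∑ f, w f = 1) {n : ℕ} {X : F → ℕ → ℕ → ℝ}
    (hX : ∀ f, ∀ j < n, ∀ l < n, 0 ≤ X f j l ∧ X f j l ≤ 1) {θ : ℝ} (hθ : |θ| ≤ 1)
    (G c : ℕ → ℕ → ℝ) :
    ∑ f, w f * pot n θ (fun j l => G j l + X f j l) (fun j l => c j l + ∑ g, w g * X g j l) ≤
      Real.exp (θ ^ 2) * pot n θ G c := by
  simp only [pot, Finset.mul_sum]
  rw [Finset.sum_comm]
  refine Finset.sum_le_sum fun j hj => ?_
  rw [Finset.sum_comm]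
  refine Finset.sum_le_sum fun l hl => ?_
  have hX' := fun f => hX f j (Finset.mem_range.1 hj) l (Finset.mem_range.1 hl)
  have key : ∀ τ : ℝ, |τ| ≤ 1 → ∑ f, w f * Real.exp (τ * (G j l + X f j l -
      (c j l + ∑ g, w g * X g j l))) ≤ Real.exp (τ ^ 2) * Real.exp (τ * (G j l - c j l)) := by
    intro τ hτ
    have h1 := sum_mul_exp_le hw hsum (X := fun f => X f j l) hX' hτ
    calc ∑ f, w f * Real.exp (τ * (G j l + X f j l - (c j l + ∑ g, w g * X g j l)))
        = (∑ f, w f * Real.exp (τ * (X f j l - ∑ g, w g * X g j l))) *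
            Real.exp (τ * (G j l - c j l)) := by
          rw [Finset.sum_mul]
          refine Finset.sum_congr rfl fun f _ => ?_
          rw [mul_assoc, ← Real.exp_add]
          congr 2
          ring
      _ ≤ _ := by gcongr
  simp only [mul_add, Finset.sum_add_distrib]
  refine add_le_add (key θ hθ) ?_
  have := key (-θ) (by rwa [abs_neg])
  rwa [neg_sq] at this

theorem quad_add_ratio (n : ℕ) (G : ℕ → ℕ → ℝ) (d w : ℕ → ℝ) :
    quad n (fun j l => G j l + ratio n d j l) w = quad n G w +
      (∑ j ∈ Finset.range n, w j * d j) ^ 2 / (∑ k ∈ Finset.range n, d k) ^ 2 := by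
  rw [sq (∑ j ∈ Finset.range n, w j * d j), Finset.sum_mul_sum, Finset.sum_div]
  simp only [quad, ratio, Finset.sum_div, ← Finset.sum_add_distrib]
  exact Finset.sum_congr rfl fun j _ => Finset.sum_congr rfl fun l _ => by ring

theorem quad_congr {n : ℕ} {G G' : ℕ → ℕ → ℝ} (h : ∀ j < n, ∀ l < n, G j l = G' j l) (w : ℕ → ℝ) :
    quad n G w = quad n G' w :=
  Finset.sum_congr rfl fun j hj => Finset.sum_congr rfl fun l hl => by
    rw [h j (Finset.mem_range.1 hj) l (Finset.mem_range.1 hl)]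

theorem pot_congr {n : ℕ} {θ : ℝ} {G G' c c' : ℕ → ℕ → ℝ} (h : ∀ j < n, ∀ l < n, G j l = G' j l)
    (h' : ∀ j < n, ∀ l < n, c j l = c' j l) : pot n θ G c = pot n θ G' c' :=
  Finset.sum_congr rfl fun j hj => Finset.sum_congr rfl fun l hl => by
    rw [h j (Finset.mem_range.1 hj) l (Finset.mem_range.1 hl),
      h' j (Finset.mem_range.1 hj) l (Finset.mem_range.1 hl)]

/-- The first `n` rows and columns form a symmetric positive semidefinite matrix. -/
structure IsGram (n : ℕ) (G : ℕ → ℕ → ℝ) : Prop where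
  symm : ∀ j < n, ∀ l < n, G j l = G l j
  psd : ∀ w, 0 ≤ quad n G w

theorem IsGram.congr {n : ℕ} {G G' : ℕ → ℕ → ℝ} (h : IsGram n G)
    (h' : ∀ j < n, ∀ l < n, G' j l = G j l) : IsGram n G' :=
  ⟨fun j hj l hl => by rw [h' j hj l hl, h' l hl j hj, h.symm j hj l hl],
    fun w => by rw [quad_congr h']; exact h.psd w⟩

/-- A sample adds the rank-one matrix d dᵀ/(∑ d)², whatever the estimates d are. The estimated
matrix is therefore exactly positive semidefinite, as the elimination lemmas require. -/
theorem IsGram.add_ratio {n : ℕ} {G : ℕ → ℕ → ℝ} (h : IsGram n G) (d : ℕ → ℝ) :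
    IsGram n fun j l => G j l + ratio n d j l :=
  ⟨fun j hj l hl => by rw [h.symm j hj l hl, ratio, ratio, mul_comm (d j)],
    fun w => by rw [quad_add_ratio]; exact add_nonneg (h.psd w) (by positivity)⟩

end Concentration

/-! ### Importance sampling of the weighted Gram matrix. -/

section GramEstimate

variable {O : ℕ} {p : List (Fin O) → PMF (Fin O)} {T t P : ℕ} {ε : ℝ} {s : Store}

/-- The mean of the normalized products when the future is drawn after history `y`. -/
def meanRatio {F : Type} [Fintype F] (n : ℕ) (v : ℕ → F → ℝ) (y j l : ℕ) : ℝ :=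
  ∑ f, v y f * ratio n (fun k => v k f) j l

/-- Drawing the future after each row in turn gives the sampling weight ∑_y v_y(f), which cancels
one factor of the squared normalization. -/
theorem sum_meanRatio {F : Type} [Fintype F] (n : ℕ) (v : ℕ → F → ℝ) (j l : ℕ) :
    ∑ y ∈ Finset.range n, meanRatio n v y j l = gram n v j l := by
  simp only [meanRatio, gram]
  rw [Finset.sum_comm]
  refine Finset.sum_congr rfl fun f _ => ?_
  rw [← Finset.sum_mul, ratio]
  by_cases h : ∑ k ∈ Finset.range n, v k f = 0
  · rw [h]
    simp
  · field_simp

/-- The number of steps of `sampleProg`. -/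
def sampleSteps (T t m W : ℕ) : ℕ :=
  ((m + 1) * (densSteps T t W + 3) + 3) + ((m + 1) * 4 + 5) + ((m + 1) * ((m + 1) * 4 + 6) + 3) + 4

/-- Smallness of the parameters of the estimation. -/
structure Params (T t m : ℕ) (α W η κ θ : ℝ) : Prop where
  eta_pos : 0 < η
  eta_le : η ≤ 1
  eta_kappa : 2 * ((T - t : ℕ) * η) ≤ κ
  kappa_le : κ ≤ 1 / 4
  kappa_theta : 8 * κ ≤ θ
  theta_le : θ ≤ 1
  fail_le : 3 * ((m + 1 : ℕ) * ((T - t : ℕ) * (1 / (W * (α * η) ^ 2)))) ≤ θ ^ 2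

/-- One factor exp(θ²) pays for the centred fluctuation of the ideal sample. With accurate densities
the error 8κ ≤ θ costs another exp(θ²). Otherwise entries in [0, 1] change by at most one, costing a
factor e < 3, and three times the failure probability is at most θ². In total (exp(θ²) + θ²) exp(θ²)
≤ exp(3θ²). -/
theorem runs_sample {α : ℝ} (hp : IsRegular p T α) (hα : 0 < α) (ht : t ≤ T)
    (hc : Ctx T t P ε s) {m : ℕ} (hm : s.nat 1 0 0 = m) (bs : ℕ → Fin t → Fin O)
    (hbs : ∀ j < m + 1, ∀ i : Fin t, s.nat 2 j i = bs j i) {y : ℕ} (hy : s.nat 8 0 0 = y)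
    (hym : y < m + 1) (hG : IsGram (m + 1) (s.real 1)) (kW : ℕ) (hP : 0 < P) {η κ θ : ℝ}
    (hpar : Params T t m α ((P : ℝ) ^ kW) η κ θ) (c : ℕ → ℕ → ℝ) :
    Runs p T (sampleProg kW) (sampleSteps T t m (P ^ kW)) s
      (fun s' => Frame [3, 4, 5, 10, 11, 12, 13, 14, 15] [1, 2, 3] s s' ∧
        IsGram (m + 1) (s'.real 1))
      (fun s' => ENNReal.ofReal (pot (m + 1) θ (s'.real 1)
        fun j l => c j l + meanRatio (m + 1) (fun k => fut p T t (bs k)) y j l))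
      (ENNReal.ofReal (Real.exp (3 * θ ^ 2) * pot (m + 1) θ (s.real 1) c)) := by
  obtain ⟨hη, hη1, hηκ, hκ, hκθ, hθ1, hfail⟩ := hpar
  have hκ0 : 0 ≤ κ := le_trans (by positivity) hηκ
  have hθ0 : 0 ≤ θ := le_trans (by positivity) hκθ
  have hP' : (0 : ℝ) < P := by exact_mod_cast hP
  set v : ℕ → (Fin (T - t) → Fin O) → ℝ := fun k => fut p T t (bs k) with hv
  set cm : ℕ → ℕ → ℝ := fun j l => c j l + meanRatio (m + 1) v y j l with hcm
  set δ : ℝ := (m + 1 : ℕ) * ((T - t : ℕ) * (1 / ((P : ℝ) ^ kW * (α * η) ^ 2))) with hδ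
  have hδ0 : 0 ≤ δ := by positivity
  set X : (Fin (T - t) → Fin O) → ℕ → ℕ → ℝ := fun f => ratio (m + 1) fun k => v k f with hX
  set id : (Fin (T - t) → Fin O) → ℝ := fun f =>
    pot (m + 1) θ (fun j l => s.real 1 j l + X f j l) cm with hid
  have hid0 : ∀ f, 0 ≤ id f := fun f => pot_nonneg _ _ _ _
  have hv0 : ∀ k f, 0 ≤ v k f := fun k f => fut_nonneg _ _
  refine (Runs.query_seq (k := T - t) (List.ofFn (bs y)) ?_ ?_ ?_ (by simp)
    (N := 1 + ((m + 1) * (densSteps T t (P ^ kW) + 3) + 3) +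
      (1 + ((m + 1) * 4 + 5) + ((m + 1) * ((m + 1) * 4 + 6) + 3)))
    (B := fun f => ENNReal.ofReal ((Real.exp (θ ^ 2) + θ ^ 2) * id f)) (fun f _ => ?_) ?_).conseq
    (by simp only [sampleSteps]; omega) (fun _ h => h) (fun _ _ => le_rfl) le_rfl
  · simp [NExpr.eval, cutE, hc.cut]
  · simpa using ht
  · intro i hi
    have := hbs y hym ⟨i, by simpa using hi⟩
    simpa [NExpr.eval, nv, hy] using this
  · set s1 := s.writeSeq 3 (NExpr.eval s (.lit 0)) (List.ofFn f) with hs1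
    have hf1 : Frame [3] [] s s1 := (Frame.refl _ _ _).writeSeq (by decide) _ _
    have hrow : ∀ i : Fin (T - t), s1.nat 3 0 i = f i := by
      intro i
      have := Store.writeSeq_nat_row s 3 0 (List.ofFn f) i (by simp)
      simpa [hs1, NExpr.eval] using this
    have hm1 : s1.nat 1 0 0 = m := by rw [hf1.nat 1 (by decide)]; exact hm
    have hdens := runs_allDens hp hα ht (hc.frame hf1 (by decide) (by decide) (by decide)) hm1 bs
      (fun j hj i => by rw [hf1.nat 2 (by decide)]; exact hbs j hj i) f hrow kW hP hη hη1
    have h1 := hdens.mono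
      (f' := fun s2 => ENNReal.ofReal (Real.exp (θ ^ 2) * id f) + ENNReal.ofReal (3 * id f) *
        ind (¬ ∀ j < m + 1, Within η (T - t) (fut p T t (bs j) f) (s2.real 2 0 j)))
      (b' := ENNReal.ofReal ((Real.exp (θ ^ 2) + θ ^ 2) * id f)) _ _ le_rfl (fun _ h => h)
      (fun _ _ => le_rfl) (by
        rw [← ENNReal.ofReal_mul (by linarith [hid0 f]), ← ENNReal.ofReal_add
          (mul_nonneg (Real.exp_nonneg _) (hid0 f))
          (mul_nonneg (by linarith [hid0 f]) (by positivity))]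
        refine ENNReal.ofReal_le_ofReal ?_
        rw [← hδ]
        nlinarith [mul_le_mul_of_nonneg_right hfail (hid0 f)])
    refine Runs.seq h1 fun s2 hs2 => ?_
    obtain ⟨hf2, hd0⟩ := hs2
    have hm2 : s2.nat 1 0 0 = m := by rw [hf2.nat 1 (by decide)]; exact hm1
    set b2 := ENNReal.ofReal (Real.exp (θ ^ 2) * id f) + ENNReal.ofReal (3 * id f) *
        ind (¬ ∀ j < m + 1, Within η (T - t) (fut p T t (bs j) f) (s2.real 2 0 j)) with hb2
    refine Runs.seq ((runs_sum hm2).ofPost (f' := fun _ => b2) (b' := b2) le_rfl (fun _ h => h)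
      fun _ _ => le_rfl) fun s3 hs3 => ?_
    obtain ⟨hf3, hsum3⟩ := hs3
    have hm3 : s3.nat 1 0 0 = m := by rw [hf3.nat 1 (by decide)]; exact hm2
    have hd3 : s3.real 2 = s2.real 2 := hf3.real 2 (by decide)
    have hG3 : s3.real 1 = s.real 1 := by
      rw [hf3.real 1 (by decide), hf2.real 1 (by decide), hf1.real 1 (by decide)]
    refine (runs_entries (p := p) (T := T) hm3 _
      (fun j l => s.real 1 j l + ratio (m + 1) (s2.real 2 0) j l) ?_).ofPost le_rfl ?_ ?_
    · intro j hj l hl s4 hf4 h10 h15 h4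
      simp only [RExpr.eval, entryE, NExpr.eval, nv, h10, h15]
      rw [h4, hf4.real 2 (by decide), hf4.real 3 (by decide), hsum3, hd3, hG3, ratio, sq]
    · rintro s4 ⟨hf4, h4⟩
      refine ⟨?_, (hG.add_ratio (s2.real 2 0)).congr h4⟩
      exact (((hf1.mono (by decide) (by decide)).trans (hf2.mono (by decide) (by decide))).trans
        (hf3.mono (by decide) (by decide))).trans (hf4.mono (by decide) (by decide))
    · rintro s4 ⟨hf4, h4⟩
      rw [pot_congr h4 (fun _ _ _ _ => rfl)]
      have hclose : ∀ x, (∀ j < m + 1, ∀ l < m + 1,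
          |ratio (m + 1) (s2.real 2 0) j l - X f j l| ≤ x) →
          pot (m + 1) θ (fun j l => s.real 1 j l + ratio (m + 1) (s2.real 2 0) j l) cm ≤
            Real.exp (θ * x) * id f := fun x hx => pot_le hθ0 fun j hj l hl => by
        have := hx j hj l hl
        rwa [add_sub_add_left_eq_sub]
      by_cases hgood : ∀ j < m + 1, Within η (T - t) (fut p T t (bs j) f) (s2.real 2 0 j)
      · rw [hb2, ind_of_not (not_not.2 hgood), mul_zero, add_zero]
        refine ENNReal.ofReal_le_ofReal ((hclose (8 * κ) fun j hj l hl => ?_).trans ?_)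
        · exact abs_ratio_sub_le hκ0 hκ (fun k _ => hv0 k f)
            (fun k hk => (hgood k hk).of_le hη.le hη1 (hv0 k f) hηκ (by linarith)) hj hl
        · refine mul_le_mul_of_nonneg_right (Real.exp_le_exp.2 ?_) (hid0 f)
          rw [sq]
          exact mul_le_mul_of_nonneg_left hκθ hθ0
      · rw [hb2, ind_of hgood, mul_one]
        refine le_trans (ENNReal.ofReal_le_ofReal ((hclose 1 fun j hj l hl => ?_).trans ?_))
          le_add_self
        · have h5 := ratio_mem hd0 hj hl
          have h6 := ratio_mem (w := fun k => v k f) (n := m + 1) (fun k _ => hv0 k f) hj hl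
          rw [abs_le]
          constructor <;> linarith [h5.1, h5.2, h6.1, h6.2]
        · refine mul_le_mul_of_nonneg_right ?_ (hid0 f)
          have h5 : Real.exp (θ * 1) ≤ Real.exp 1 := Real.exp_le_exp.2 (by linarith)
          linarith [Real.exp_one_lt_d9]
  · simp only [← ENNReal.ofReal_mul (condProb_nonneg p _ _)]
    rw [← ENNReal.ofReal_sum_of_nonneg fun f _ => mul_nonneg (condProb_nonneg p _ _)
      (mul_nonneg (by positivity) (hid0 f))]
    refine ENNReal.ofReal_le_ofReal ?_
    have h1 := sum_mul_pot_le (w := v y) (hv0 y) (sum_fut (bs y)) (n := m + 1) (X := X)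
      (fun f j hj l hl => ratio_mem (fun k _ => hv0 k f) hj hl) (θ := θ)
      (by rwa [abs_of_nonneg hθ0]) (s.real 1) c
    calc ∑ f, condProb p (List.ofFn (bs y)) (List.ofFn f) * ((Real.exp (θ ^ 2) + θ ^ 2) * id f)
        = (Real.exp (θ ^ 2) + θ ^ 2) * ∑ f, v y f * id f := by
          rw [Finset.mul_sum]
          refine Finset.sum_congr rfl fun f _ => ?_
          simp only [hv, fut]
          ring
      _ ≤ Real.exp (2 * θ ^ 2) * (Real.exp (θ ^ 2) * pot (m + 1) θ (s.real 1) c) := by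
          refine mul_le_mul ?_ h1 (Finset.sum_nonneg fun f _ => mul_nonneg (hv0 y f) (hid0 f))
            (Real.exp_nonneg _)
          have h2 : Real.exp (2 * θ ^ 2) = Real.exp (θ ^ 2) * Real.exp (θ ^ 2) := by
            rw [← Real.exp_add]
            ring_nf
          have h3 : θ ^ 2 + 1 ≤ Real.exp (θ ^ 2) := Real.add_one_le_exp _
          have h4 : 1 ≤ Real.exp (θ ^ 2) := Real.one_le_exp (sq_nonneg _)
          rw [h2]
          nlinarith [sq_nonneg θ]
      _ = _ := by
          rw [← mul_assoc, ← Real.exp_add]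
          ring_nf

/-- The number of steps of `gramProg`. -/
def gramSteps (T t m M W : ℕ) : ℕ :=
  ((m + 1) * ((m + 1) * 4 + 6) + 3) + ((m + 1) * (M * (sampleSteps T t m W + 3) + 6) + 3) + 1

/-- Chernoff's method: the potential reserves a factor exp(3θ²) for each sample still to come, while
the centre moves with the samples already drawn. Initially each of the (m+1)² entries contributes 2;
a deviation beyond Me in any entry forces the final potential above exp(θMe). -/
theorem runs_gram {α : ℝ} (hp : IsRegular p T α) (hα : 0 < α) (ht : t ≤ T)
    (hc : Ctx T t P ε s) {m : ℕ} (hm : s.nat 1 0 0 = m) (bs : ℕ → Fin t → Fin O)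
    (hbs : ∀ j < m + 1, ∀ i : Fin t, s.nat 2 j i = bs j i) (kM kW : ℕ) (hP : 0 < P) {η κ θ : ℝ}
    (hpar : Params T t m α ((P : ℝ) ^ kW) η κ θ) (e : ℝ) :
    Runs p T (gramProg kM kW) (gramSteps T t m (P ^ kM) (P ^ kW)) s
      (fun s' => Frame [3, 4, 5, 8, 9, 10, 11, 12, 13, 14, 15] [1, 2, 3] s s' ∧
        IsGram (m + 1) (s'.real 1))
      (fun s' => ind (¬ ∀ j < m + 1, ∀ l < m + 1,
        |s'.real 1 j l - (P : ℝ) ^ kM * gram (m + 1) (fun k => fut p T t (bs k)) j l| ≤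
          (P : ℝ) ^ kM * e))
      (ENNReal.ofReal (Real.exp (-(θ * ((P : ℝ) ^ kM * e))) *
        (Real.exp (3 * θ ^ 2 * ((m + 1 : ℕ) * (P : ℝ) ^ kM)) * (2 * ((m + 1 : ℕ) : ℝ) ^ 2)))) := by
  have hθ0 : 0 ≤ θ := by
    have h1 : 0 ≤ κ := le_trans (mul_nonneg (by norm_num)
      (mul_nonneg (Nat.cast_nonneg _) hpar.eta_pos.le)) hpar.eta_kappa
    exact le_trans (by positivity) hpar.kappa_theta
  set v : ℕ → (Fin (T - t) → Fin O) → ℝ := fun k => fut p T t (bs k) with hv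
  set M : ℕ := P ^ kM with hM
  have hMr : (P : ℝ) ^ kM = (M : ℝ) := by rw [hM]; push_cast; rfl
  rw [hMr]
  let cen : ℕ → ℕ → ℕ → ℝ := fun y j l => M * ∑ k ∈ Finset.range y, meanRatio (m + 1) v k j l
  let val : ℝ → (ℕ → ℕ → ℝ) → (ℕ → ℕ → ℝ) → ENNReal := fun R G c =>
    ENNReal.ofReal (Real.exp (3 * θ ^ 2 * R) * pot (m + 1) θ G c)
  have hzero := runs_entries (p := p) (T := T) hm (.ofNExpr (.lit 0)) (fun _ _ => 0)
    (fun j hj l hl s1 _ _ _ _ => by simp [RExpr.eval, NExpr.eval])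
  have hloop : ∀ s1, (Frame [10, 15] [1] s s1 ∧ ∀ j < m + 1, ∀ l < m + 1, s1.real 1 j l = 0) →
      Runs p T (forLoop 8 (ltRows 8) (forLoop 9 (ltPow 9 kM) (sampleProg kW)))
        ((m + 1) * (M * (sampleSteps T t m (P ^ kW) + 3) + 6) + 3) s1
        (fun s' => Frame [3, 4, 5, 8, 9, 10, 11, 12, 13, 14, 15] [1, 2, 3] s s' ∧
          IsGram (m + 1) (s'.real 1))
        (fun s' => ENNReal.ofReal (pot (m + 1) θ (s'.real 1)
          fun j l => M * gram (m + 1) v j l))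
        (ENNReal.ofReal (Real.exp (3 * θ ^ 2 * ((m + 1 : ℕ) * M)) *
          (2 * ((m + 1 : ℕ) : ℝ) ^ 2))) := by
    rintro s1 ⟨hf1, h1⟩
    refine (Runs.forLoop (n := M * (sampleSteps T t m (P ^ kW) + 3) + 3) (K := m + 1)
      (I := fun _ s' => Frame [3, 4, 5, 8, 9, 10, 11, 12, 13, 14, 15] [1, 2, 3] s s' ∧
          IsGram (m + 1) (s'.real 1))
      (g := fun y s' => val ((m + 1 - y : ℕ) * M) (s'.real 1) (cen y))
      ?_ ?_ ?_ ?_ ?_).conseq le_rfl (fun _ h => h.1) ?_ ?_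
    · intro y s2 _ hI hy
      exact ltRows_eval hy (by rw [hI.1.nat 1 (by decide)]; exact hm)
    · intro y s2 x hI
      exact ⟨hI.1.setNat (by decide) _ _ _, hI.2⟩
    · intros; rfl
    · refine ⟨hf1.mono (by decide) (by decide), fun j hj l hl => by rw [h1 j hj l hl, h1 l hl j hj],
        fun w => ?_⟩
      rw [quad_congr h1]
      simp [quad]
    · intro y s2 hy hI hy2
      refine (Runs.forLoop (n := sampleSteps T t m (P ^ kW)) (K := M)
        (I := fun _ s' => (Frame [3, 4, 5, 8, 9, 10, 11, 12, 13, 14, 15] [1, 2, 3] s s' ∧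
          s'.nat 8 0 0 = y) ∧ IsGram (m + 1) (s'.real 1))
        (g := fun i s' => val ((m + 1 - (y + 1) : ℕ) * M + (M - i : ℕ)) (s'.real 1)
          (fun j l => cen y j l + i * meanRatio (m + 1) v y j l))
        ?_ ?_ ?_ ?_ ?_).conseq le_rfl (fun _ h => ⟨⟨h.1.1.1, h.1.2⟩, h.1.1.2⟩) ?_ ?_
      · intro i s3 _ hI3 hi
        exact (hc.frame hI3.1.1 (by decide) (by decide) (by decide)).ltPow hi
      · intro i s3 x hI3
        exact ⟨⟨hI3.1.1.setNat (by decide) _ _ _, by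
          rw [Store.setNat_nat_of_ne _ (by decide)]; exact hI3.1.2⟩, hI3.2⟩
      · intros; rfl
      · exact ⟨⟨hI.1, hy2⟩, hI.2⟩
      · intro i s3 hi hI3 hi3
        have hf3 := hI3.1.1
        have hs := runs_sample hp hα ht (hc.frame hf3 (by decide) (by decide) (by decide))
          (by rw [hf3.nat 1 (by decide)]; exact hm) bs
          (fun j hj k => by rw [hf3.nat 2 (by decide)]; exact hbs j hj k) hI3.1.2 hy hI3.2 kW hP
          hpar (fun j l => cen y j l + i * meanRatio (m + 1) v y j l)
        refine hs.mono 0 (ENNReal.ofReal (Real.exp (3 * θ ^ 2 *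
          ((m + 1 - (y + 1) : ℕ) * M + (M - (i + 1) : ℕ))))) le_rfl ?_ ?_ ?_
        · rintro s4 ⟨hf4, hG4⟩
          refine ⟨⟨⟨hf3.trans (hf4.mono (by decide) (by decide)), ?_⟩, hG4⟩, ?_⟩
          · rw [hf4.nat 8 (by decide)]
            exact hI3.1.2
          · rw [hf4.nat 9 (by decide)]
            exact hi3
        · rintro s4 -
          rw [zero_add, ← ENNReal.ofReal_mul (Real.exp_nonneg _)]
          refine ENNReal.ofReal_le_ofReal (le_of_eq ?_)
          congr 1
          refine pot_congr (fun _ _ _ _ => rfl) fun j _ l _ => ?_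
          push_cast
          ring
        · rw [zero_add, ← ENNReal.ofReal_mul (Real.exp_nonneg _), ← mul_assoc, ← Real.exp_add]
          refine ENNReal.ofReal_le_ofReal (le_of_eq ?_)
          congr 2
          have : M - i = (M - (i + 1)) + 1 := by omega
          rw [this]
          push_cast
          ring
      · rintro s3 -
        refine ENNReal.ofReal_le_ofReal (le_of_eq ?_)
        rw [Nat.sub_self, Nat.cast_zero, add_zero]
        congr 1
        refine pot_congr (fun _ _ _ _ => rfl) fun j _ l _ => ?_
        simp only [cen]
        rw [Finset.sum_range_succ]
        ring
      · refine ENNReal.ofReal_le_ofReal (le_of_eq ?_)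
        rw [Nat.sub_zero]
        have : m + 1 - y = (m + 1 - (y + 1)) + 1 := by omega
        rw [this]
        congr 1
        · push_cast
          ring_nf
        · refine pot_congr (fun _ _ _ _ => rfl) fun j _ l _ => ?_
          simp
    · rintro s2 -
      refine ENNReal.ofReal_le_ofReal (le_of_eq ?_)
      rw [Nat.sub_self, Nat.cast_zero, zero_mul, mul_zero, Real.exp_zero, one_mul]
      refine pot_congr (fun _ _ _ _ => rfl) fun j _ l _ => ?_
      simp only [cen, sum_meanRatio]
    · refine ENNReal.ofReal_le_ofReal (le_of_eq ?_)
      rw [Nat.sub_zero]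
      congr 1
      rw [pot_congr (G' := fun _ _ => 0) (c' := fun _ _ => 0) h1 (fun j _ l _ => by simp [cen])]
      simp [pot]
      ring
  have h2 := Runs.seq (hzero.ofPost (f' := fun _ => _) le_rfl (fun _ h => h) fun _ _ => le_rfl)
    hloop
  refine h2.mono 0 (ENNReal.ofReal (Real.exp (-(θ * (M * e))))) (by simp only [gramSteps]; omega)
    (fun _ h => h) ?_ ?_
  · rintro s' -
    rw [zero_add, ← ENNReal.ofReal_mul (Real.exp_nonneg _)]
    refine ind_le fun hbad => ?_
    rw [ENNReal.one_le_ofReal]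
    push Not at hbad
    obtain ⟨j, hj, l, hl, hjl⟩ := hbad
    have h3 : Real.exp (θ * (M * e)) ≤ pot (m + 1) θ (s'.real 1)
        fun j l => M * gram (m + 1) v j l := by
      have h4 : Real.exp (θ * (M * e)) ≤
          Real.exp (θ * (s'.real 1 j l - M * gram (m + 1) v j l)) +
            Real.exp (-θ * (s'.real 1 j l - M * gram (m + 1) v j l)) := by
        rcases lt_abs.1 hjl with h | h
        · refine le_trans (Real.exp_le_exp.2 ?_) (le_add_of_nonneg_right (Real.exp_nonneg _))
          exact mul_le_mul_of_nonneg_left h.le hθ0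
        · refine le_trans (Real.exp_le_exp.2 ?_) (le_add_of_nonneg_left (Real.exp_nonneg _))
          rw [neg_mul, ← mul_neg]
          exact mul_le_mul_of_nonneg_left h.le hθ0
      refine h4.trans (le_trans ?_ (Finset.single_le_sum (fun j _ =>
        Finset.sum_nonneg fun l _ => by positivity) (Finset.mem_range.2 hj)))
      exact Finset.single_le_sum (f := fun l =>
        Real.exp (θ * (s'.real 1 j l - M * gram (m + 1) v j l)) +
          Real.exp (-θ * (s'.real 1 j l - M * gram (m + 1) v j l)))
        (fun l _ => by positivity) (Finset.mem_range.2 hl)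
    calc (1 : ℝ) = Real.exp (-(θ * (M * e))) * Real.exp (θ * (M * e)) := by
          rw [← Real.exp_add]
          simp
      _ ≤ _ := by gcongr
  · rw [zero_add, ← ENNReal.ofReal_mul (Real.exp_nonneg _)]

end GramEstimate

/-! ### One round of the algorithm -/

section Round

variable {O : ℕ} {p : List (Fin O) → PMF (Fin O)} {T t P : ℕ} {ε : ℝ} {s : Store}

/-- The regularization parameter for `m` rows. -/
def ridge (ε M : ℝ) (m : ℕ) : ℝ := ε ^ 2 / 48 * (M / (m + 1))

theorem Ctx.ridgeE (hc : Ctx T t P ε s) {m : ℕ} (hm : s.nat 1 0 0 = m) (kM : ℕ) :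
    (ridgeE kM).eval s = ridge ε ((P : ℝ) ^ kM) m := by
  simp only [CondSampling.ridgeE, RExpr.eval, NExpr.eval, nv, hc.eps, hc.sizePow, hm, ridge]
  push_cast
  ring

/-- The number of steps of `elimProg`. -/
def elimSteps (m : ℕ) : ℕ := m * (((m + 1) * 4 + 3) + ((m + 1) * ((m + 1) * 4 + 6) + 3) + 6) + 3

theorem runs_elim (hc : Ctx T t P ε s) {m : ℕ} (hm : s.nat 1 0 0 = m) (kM : ℕ) :
    Runs p T (elimProg kM) (elimSteps m) s
      (fun s' => Frame [10, 15, 16] [1, 5, 6] s s' ∧ ∀ j < m + 1, ∀ l < m + 1,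
        s'.real 1 j l = elim (ridge ε ((P : ℝ) ^ kM) m) (s.real 1) m j l) (fun _ => 0) 0 := by
  set c := ridge ε ((P : ℝ) ^ kM) m with hcdef
  refine (Runs.forLoop (n := ((m + 1) * 4 + 3) + ((m + 1) * ((m + 1) * 4 + 6) + 3) + 3) (K := m)
    (I := fun i s' => Frame [10, 15, 16] [1, 5, 6] s s' ∧ ∀ j < m + 1, ∀ l < m + 1,
      s'.real 1 j l = elim c (s.real 1) i j l)
    (g := fun _ _ => 0) ?_ ?_ ?_ ?_ ?_).conseq le_rfl (fun _ h => h.1) (fun _ _ => le_rfl) le_rfl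
  · intro i s1 _ hI hi
    have : s1.nat 1 0 0 = m := by rw [hI.1.nat 1 (by decide)]; exact hm
    simp [Test.eval, nv, NExpr.eval, hi, this]
  · intro i s1 v hI
    exact ⟨hI.1.setNat (by decide) _ _ _, hI.2⟩
  · intros; rfl
  · exact ⟨Frame.refl _ _ _, fun _ _ _ _ => rfl⟩
  · intro i s1 hi hI hi1
    have hc1 := hc.frame hI.1 (by decide) (by decide) (by decide)
    have hm1 : s1.nat 1 0 0 = m := by rw [hI.1.nat 1 (by decide)]; exact hm
    have hpiv : RExpr.eval s1 (.plus (CondSampling.ridgeE kM) (.cell 1 (nv 16) (nv 16))) =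
        c + elim c (s.real 1) i i i := by
      simp only [RExpr.eval, hc1.ridgeE hm1, nv, NExpr.eval, hi1]
      rw [hI.2 i (by omega) i (by omega)]
    refine (Runs.setReal_seq (n := 1 + ((m + 1) * 4 + 3) + ((m + 1) * ((m + 1) * 4 + 6) + 3))
      ?_).conseq (by omega) (fun _ h => h) (fun _ _ => le_rfl) le_rfl
    rw [hpiv]
    set s2 := s1.setReal 6 (NExpr.eval s1 (.lit 0)) (NExpr.eval s1 (.lit 0))
      (c + elim c (s.real 1) i i i) with hs2
    have hf2 : Frame [] [6] s1 s2 := (Frame.refl _ _ _).setReal (by decide) _ _ _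
    have h62 : s2.real 6 0 0 = c + elim c (s.real 1) i i i := by
      simp [hs2, Store.setReal_real, NExpr.eval]
    have hm2 : s2.nat 1 0 0 = m := hm1
    have hcol : Runs p T (forLoop 10 (ltRows 10)
        (.setReal 5 (.lit 0) (nv 10) (.cell 1 (nv 10) (nv 16)))) ((m + 1) * 4 + 3) s2
        (fun s' => Frame [10] [5] s2 s' ∧ ∀ j < m + 1, s'.real 5 0 j = s2.real 1 j i)
        (fun _ => 0) 0 := by
      refine (Runs.forLoop (n := 1) (K := m + 1)
        (I := fun k s' => Frame [10] [5] s2 s' ∧ ∀ j < k, s'.real 5 0 j = s2.real 1 j i)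
        (g := fun _ _ => 0) ?_ ?_ ?_ ?_ ?_).conseq le_rfl (fun _ h => h.1) (fun _ _ => le_rfl) le_rfl
      · intro k s3 _ hI3 hk
        exact ltRows_eval hk (by rw [hI3.1.nat 1 (by decide)]; exact hm2)
      · intro k s3 v hI3
        exact ⟨hI3.1.setNat (by decide) _ _ _, hI3.2⟩
      · intros; rfl
      · exact ⟨Frame.refl _ _ _, by omega⟩
      · intro k s3 hk hI3 hk3
        have h16 : s3.nat 16 0 0 = i := by rw [hI3.1.nat 16 (by decide)]; exact hi1
        refine Runs.setReal ⟨⟨hI3.1.setReal (by decide) _ _ _, fun j hj => ?_⟩, hk3⟩ le_rfl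
        simp only [NExpr.eval, RExpr.eval, nv, hk3, h16, Store.setReal_real, true_and]
        split_ifs with h
        · rw [h, hI3.1.real 1 (by decide)]
        · exact hI3.2 j (by omega)
    refine Runs.seq hcol fun s3 hs3 => ?_
    obtain ⟨hf3, h53⟩ := hs3
    have hm3 : s3.nat 1 0 0 = m := by rw [hf3.nat 1 (by decide)]; exact hm2
    refine (runs_entries (p := p) (T := T) hm3 _ (fun j l => elim c (s.real 1) (i + 1) j l)
      ?_).ofPost le_rfl ?_ (fun _ _ => le_rfl)
    · intro j hj l hl s4 hf4 h10 h15 h4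
      have h13 : s3.real 1 = s1.real 1 := by
        rw [hf3.real 1 (by decide), hf2.real 1 (by decide)]
      have h12 : s2.real 1 = s1.real 1 := hf2.real 1 (by decide)
      simp only [RExpr.eval, entryE, NExpr.eval, nv, h10, h15, h4]
      rw [hf4.real 5 (by decide), hf4.real 6 (by decide), h53 j hj, h53 l hl,
        hf3.real 6 (by decide), h62, h13, h12, hI.2 j hj l hl, hI.2 j hj i (by omega),
        hI.2 l hl i (by omega)]
      rfl
    · rintro s4 ⟨hf4, h4⟩
      refine ⟨⟨?_, h4⟩, ?_⟩
      · exact ((hI.1.trans (hf2.mono (by decide) (by decide))).trans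
          (hf3.mono (by decide) (by decide))).trans (hf4.mono (by decide) (by decide))
      · rw [hf4.nat 16 (by decide), hf3.nat 16 (by decide)]
        exact hi1

variable [NeZero O]

/-- The histories stored in the rows of the output array. -/
def hist (O t : ℕ) [NeZero O] (s : Store) (i : ℕ) (j : Fin t) : Fin O := Fin.ofNat O (s.nat 2 i j)

/-- Reduction modulo O only makes `hist` total; rows written by the oracle hold genuine
observations. -/
theorem hist_val {i : ℕ} {j : Fin t} (h : s.nat 2 i j < O) : (hist O t s i j : ℕ) = s.nat 2 i j := by
  simp [hist, Nat.mod_eq_of_lt h]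

variable (p T t) in
/-- The first `m` rows of the output array are prefixes of possible sequences. -/
def Rows (m : ℕ) (s : Store) : Prop :=
  ∀ i < m, ∃ l ∈ (futureLaw p [] T).support, ∀ j (hj : j < l.length), j < t → s.nat 2 i j = l[j]

omit [NeZero O] in
theorem Rows.lt {m : ℕ} (h : Rows p T t m s) (ht : t ≤ T) {i : ℕ} (hi : i < m) (j : Fin t) :
    s.nat 2 i j < O := by
  obtain ⟨l, hl, hrow⟩ := h i hi
  have hlen := length_of_mem_futureLaw p hl
  rw [hrow j (by omega) j.2]
  exact Fin.is_lt _

/-- The candidate is cut from a full sequence; this identifies its law with the law of a random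
history of length t. -/
theorem sum_prefix (p : List (Fin O) → PMF (Fin O)) (ht : t ≤ T) (φ : (Fin t → Fin O) → ENNReal) :
    ∑ f : Fin T → Fin O, ENNReal.ofReal (condProb p [] (List.ofFn f)) *
        φ (fun j => f (Fin.castLE ht j)) =
      ∑ x : Fin t → Fin O, ENNReal.ofReal (condProb p [] (List.ofFn x)) * φ x := by
  have h1 := ex_futureLaw_take p [] t (T - t) fun l => φ fun j => l.getD j 0
  rw [Nat.add_sub_cancel' ht, ex_futureLaw, ex_futureLaw] at h1
  convert h1 using 4 with f _ x _
  · funext j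
    simp [List.getD, j.2, List.getElem?_ofFn]
    rw [dif_pos (by omega)]
    rfl
  · funext j
    simp [List.getD]

variable (p T t ε) in
/-- The family `bs` misses a random history with more than the allowed probability. -/
def Bad (m : ℕ) (bs : ℕ → Fin t → Fin O) : Prop := ε / 2 < missProb p T t ε m bs

omit [NeZero O] in
open Classical in
theorem sum_half_le {m : ℕ} {bs : ℕ → Fin t → Fin O} (hbad : Bad p T t ε m bs) :
    ∑ x : Fin t → Fin O, ENNReal.ofReal (condProb p [] (List.ofFn x)) *
      ENNReal.ofReal (if Good p T t ε m bs x then 1 else 1 / 2) ≤ ENNReal.ofReal (1 - ε / 4) := by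
  have h0 : ∀ x : Fin t → Fin O, (0 : ℝ) ≤ if Good p T t ε m bs x then 1 else 1 / 2 := fun x => by
    split_ifs <;> norm_num
  simp only [← ENNReal.ofReal_mul (condProb_nonneg p _ _)]
  rw [← ENNReal.ofReal_sum_of_nonneg fun x _ => mul_nonneg (condProb_nonneg p _ _) (h0 x)]
  refine ENNReal.ofReal_le_ofReal ?_
  have h1 : ∑ x : Fin t → Fin O, condProb p [] (List.ofFn x) *
      (if Good p T t ε m bs x then 1 else 1 / 2) = 1 - missProb p T t ε m bs / 2 := by
    rw [missProb, eq_sub_iff_add_eq, Finset.sum_div, ← Finset.sum_add_distrib]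
    refine Eq.trans ?_ (sum_condProb p [] t)
    refine Finset.sum_congr rfl fun x _ => ?_
    split_ifs <;> ring
  rw [h1]
  have : ε / 2 < missProb p T t ε m bs := hbad
  linarith

/-- The number of steps of `roundProg`. -/
def roundSteps (T t m M W : ℕ) : ℕ := gramSteps T t m M W + elimSteps m + 6

variable (p T ε) in
/-- The loss of a state of the main loop. -/
def loss (t : ℕ) (α A : ℝ) (s : Store) : ENNReal :=
  -- A wrongly kept row costs one outright. A spread family has bounded size, so for large A the
  -- second term is at least one when too much is missed.
  ind (¬ Spread p T t α ε (s.nat 1 0 0) (hist O t s)) +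
    ENNReal.ofReal (A * (1 / 2) ^ s.nat 1 0 0) * ind (Bad p T t ε (s.nat 1 0 0) (hist O t s))

/-- If the Gram estimate is accurate, a rejected candidate was approximated, so a candidate that is
not approximated is kept and halves the weight; any kept candidate preserves `Spread`. -/
theorem runs_round {α : ℝ} (hp : IsRegular p T α) (hα : 0 < α) (hα1 : α ≤ 1) (ht : t ≤ T)
    (hε : 0 < ε) (hε1 : ε ≤ 1)
    (hc : Ctx T t P ε s) {m : ℕ} (hm : s.nat 1 0 0 = m) (hrows : Rows p T t m s)
    (kM kW : ℕ) (hP : 0 < P) {η κ θ e : ℝ}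
    (hpar : Params T t m α ((P : ℝ) ^ kW) η κ θ) (he : 3 * (m + 1 : ℝ) ^ 2 * e ≤ ε ^ 3 / 768)
    {δ : ℝ} (hδ : Real.exp (-(θ * ((P : ℝ) ^ kM * e))) *
        (Real.exp (3 * θ ^ 2 * ((m + 1 : ℕ) * (P : ℝ) ^ kM)) * (2 * ((m + 1 : ℕ) : ℝ) ^ 2)) ≤ δ)
    {A : ℝ} (hA : 0 ≤ A) :
    Runs p T (roundProg kM kW) (roundSteps T t m (P ^ kM) (P ^ kW)) s
      (fun s' => Ctx T t P ε s' ∧ s'.nat 7 = s.nat 7 ∧ s'.nat 1 0 0 ≤ m + 1 ∧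
        Rows p T t (s'.nat 1 0 0) s')
      (loss p T ε t α A)
      (loss p T ε t α (A * (1 - ε / 4)) s + ENNReal.ofReal ((1 + A) * δ)) := by
  classical
  have hδ0 : 0 ≤ δ := le_trans (by positivity) hδ
  have hP' : (0 : ℝ) < P := by exact_mod_cast hP
  set bs := hist O t s with hbs
  set C0 : ENNReal := ind (¬ Spread p T t α ε m bs) with hC0
  set C1 : ENNReal := ENNReal.ofReal (A * (1 / 2) ^ m) * ind (Bad p T t ε m bs) with hC1
  -- The guaranteed factor on the weight given the candidate; when the family is bad its mean is at
  -- most 1 - ε/4 by `sum_half_le`.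
  let w : (Fin t → Fin O) → ENNReal := fun x =>
    ENNReal.ofReal (if Good p T t ε m bs x then 1 else 1 / 2)
  refine (Runs.query_seq (k := T) [] (by simp [NExpr.eval]) (by simp) (by simp) (by simp)
    (N := 1 + gramSteps T t m (P ^ kM) (P ^ kW) + (1 + elimSteps m + 2))
    (B := fun f => (C0 + ENNReal.ofReal ((1 + A) * δ)) + C1 * w fun j => f (Fin.castLE ht j))
    (fun f hf => ?_) ?_).conseq
    (by simp only [roundSteps]; omega) (fun _ h => h) (fun _ _ => le_rfl) le_rfl
  · set x : Fin t → Fin O := fun j => f (Fin.castLE ht j) with hx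
    have hmE : NExpr.eval s (nv 1) = m := by simp [NExpr.eval, nv, hm]
    rw [hmE]
    set s1 := s.writeSeq 2 m (List.ofFn f) with hs1
    have hf1 : Frame [2] [] s s1 := (Frame.refl _ _ _).writeSeq (by decide) _ _
    have hm1 : s1.nat 1 0 0 = m := by rw [hf1.nat 1 (by decide)]; exact hm
    have hold : ∀ i < m, s1.nat 2 i = s.nat 2 i := fun i hi =>
      Store.writeSeq_nat_of_row_ne _ _ hi.ne _
    have hrows1 : Rows p T t (m + 1) s1 := by
      intro i hi
      rcases Nat.lt_succ_iff_lt_or_eq.1 hi with hi | rfl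
      · obtain ⟨l, hl, hrow⟩ := hrows i hi
        exact ⟨l, hl, fun j hj hjt => by rw [hold i hi]; exact hrow j hj hjt⟩
      · exact ⟨_, hf, fun j hj _ => Store.writeSeq_nat_row _ _ _ _ _ hj⟩
    set bs1 := hist O t s1 with hbs1
    have hbb : ∀ j < m, bs1 j = bs j := fun j hj => by
      funext i
      simp only [hbs1, hbs, hist, hold j hj]
    have hbm : bs1 m = x := by
      funext i
      refine Fin.ext ?_
      rw [hbs1, hist_val (hrows1.lt ht (Nat.lt_succ_self m) i)]
      have := Store.writeSeq_nat_row s 2 m (List.ofFn f) i (by simp; omega)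
      rw [← hs1] at this
      rw [this]
      simp [hx]
      rfl
    have hgram := runs_gram hp hα ht (hc.frame hf1 (by decide) (by decide) (by decide)) hm1 bs1
      (fun j hj i => (hist_val (hrows1.lt ht hj i)).symm) kM kW hP hpar e
    have h1 := hgram.mono
      (f' := fun s2 => (C0 + C1 * w x) + ENNReal.ofReal (1 + A) * ind (¬ ∀ j < m + 1, ∀ l < m + 1,
        |s2.real 1 j l - (P : ℝ) ^ kM * gram (m + 1) (fun k => fut p T t (bs1 k)) j l| ≤
          (P : ℝ) ^ kM * e))
      (b' := (C0 + ENNReal.ofReal ((1 + A) * δ)) + C1 * w x) _ _ le_rfl (fun _ h => h)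
      (fun _ _ => le_rfl) (by
        rw [← ENNReal.ofReal_mul (by positivity), add_right_comm]
        refine add_le_add (add_le_add le_rfl (ENNReal.ofReal_le_ofReal ?_)) le_rfl
        exact mul_le_mul_of_nonneg_left hδ (by positivity))
    refine Runs.seq h1 fun s2 hs2 => ?_
    obtain ⟨hf2, hG2⟩ := hs2
    have hf12 : Frame [2, 3, 4, 5, 8, 9, 10, 11, 12, 13, 14, 15] [1, 2, 3] s s2 :=
      (hf1.mono (by decide) (by decide)).trans (hf2.mono (by decide) (by decide))
    have hc2 := hc.frame hf12 (by decide) (by decide) (by decide)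
    have hm2 : s2.nat 1 0 0 = m := by rw [hf2.nat 1 (by decide)]; exact hm1
    set b2 := (C0 + C1 * w x) + ENNReal.ofReal (1 + A) * ind (¬ ∀ j < m + 1, ∀ l < m + 1,
        |s2.real 1 j l - (P : ℝ) ^ kM * gram (m + 1) (fun k => fut p T t (bs1 k)) j l| ≤
          (P : ℝ) ^ kM * e) with hb2
    refine Runs.seq ((runs_elim hc2 hm2 kM).ofPost (f' := fun _ => b2) (b' := b2) le_rfl
      (fun _ h => h) fun _ _ => le_rfl) fun s3 hs3 => ?_
    obtain ⟨hf3, hG3⟩ := hs3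
    have hc3 := hc2.frame hf3 (by decide) (by decide) (by decide)
    have hm3 : s3.nat 1 0 0 = m := by rw [hf3.nat 1 (by decide)]; exact hm2
    have h23 : s3.nat 2 = s1.nat 2 := by rw [hf3.nat 2 (by decide), hf2.nat 2 (by decide)]
    have h73 : s3.nat 7 = s.nat 7 := by rw [hf3.nat 7 (by decide), hf12.nat 7 (by decide)]
    have hh3 : hist O t s3 = bs1 := by
      funext i j
      simp only [hist, h23, hbs1]
    have hrows3 : Rows p T t (m + 1) s3 := by
      intro i hi
      rw [h23]
      exact hrows1 i hi
    set q := elim (ridge ε ((P : ℝ) ^ kM) m) (s2.real 1) m m m with hq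
    have htest : Test.eval s3 (.realLT
        (.times (.plus (.ofNExpr (.lit 1))
          (.over (.cell 0 (.lit 0) (.lit 0)) (.ofNExpr (.lit 8)))) (CondSampling.ridgeE kM))
        (.cell 1 (nv 1) (nv 1))) ↔ (1 + ε / 8) * ridge ε ((P : ℝ) ^ kM) m < q := by
      simp only [Test.eval, RExpr.eval, hc3.ridgeE hm3, NExpr.eval, nv, hm3, hc3.eps,
        hG3 m (Nat.lt_succ_self m) m (Nat.lt_succ_self m)]
      norm_num
      exact Iff.rfl
    have hw1 : w x ≤ 1 := by
      simp only [w]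
      rw [← ENNReal.ofReal_one]
      refine ENNReal.ofReal_le_ofReal ?_
      split_ifs <;> norm_num
    -- When the estimate fails nothing is known about the decision, hence the term (1 + A)δ in the
    -- bound.
    have hcrude : ∀ s4 : Store, loss p T ε t α A s4 ≤ ENNReal.ofReal (1 + A) := by
      intro s4
      rw [loss, ENNReal.ofReal_add zero_le_one hA, ENNReal.ofReal_one]
      refine add_le_add (ind_le_one _) ?_
      calc ENNReal.ofReal (A * (1 / 2) ^ s4.nat 1 0 0) * ind _ ≤ ENNReal.ofReal A * 1 := by
            refine mul_le_mul' (ENNReal.ofReal_le_ofReal ?_) (ind_le_one _)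
            exact mul_le_of_le_one_right hA (pow_le_one₀ (by norm_num) (by norm_num))
        _ = _ := mul_one _
    by_cases hclose : ∀ j < m + 1, ∀ l < m + 1,
        |s2.real 1 j l - (P : ℝ) ^ kM * gram (m + 1) (fun k => fut p T t (bs1 k)) j l| ≤
          (P : ℝ) ^ kM * e
    · rw [ind_of_not (not_not.2 hclose), mul_zero, add_zero] at hb2
      refine Runs.ite (fun hb => ?_) (fun hb => ?_)
      · rw [htest] at hb
        have hapart := apart_of_lt_elim (v := fun k => fut p T t (bs1 k)) (a := α ^ T)
          (fun j _ f => fut_eq_zero_or hp hα.le hα1 ht (bs1 j) f) (by positivity) hG2.symm hG2.psd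
          hε (by positivity) he rfl hclose hb
        set s4 := s3.setNat 1 (NExpr.eval s3 (.lit 0)) (NExpr.eval s3 (.lit 0))
          (NExpr.eval s3 (.plus (nv 1) (.lit 1))) with hs4
        have hm4 : s4.nat 1 0 0 = m + 1 := by
          simp [hs4, NExpr.eval, Store.setNat_nat, nv, hm3]
        have hf4 : Frame [1] [] s3 s4 := (Frame.refl _ _ _).setNat (by decide) _ _ _
        have h24 : s4.nat 2 = s3.nat 2 := hf4.nat 2 (by decide)
        refine Runs.setNat ⟨hc3.frame hf4 (by decide) (by decide) (by decide), ?_, hm4.le, ?_⟩ ?_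
        · rw [← hs4, hf4.nat 7 (by decide), h73]
        · rw [← hs4, hm4]
          intro i hi
          rw [h24]
          exact hrows3 i hi
        · rw [← hs4, loss, hm4, hb2]
          have hh4 : hist O t s4 = bs1 := by
            rw [← hh3]
            funext i j
            simp only [hist, h24]
          rw [hh4]
          refine add_le_add (ind_mono fun h hsp => h ((hsp.congr hbb).succ hapart)) ?_
          rw [hC1, mul_right_comm, pow_succ, ← mul_assoc, ENNReal.ofReal_mul (by positivity)]
          refine mul_le_mul' (mul_le_mul' le_rfl ?_) (ind_mono fun h => ?_)
          · simp only [w]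
            refine ENNReal.ofReal_le_ofReal ?_
            split_ifs <;> norm_num
          · exact lt_of_lt_of_le (show ε / 2 < missProb p T t ε (m + 1) bs1 from h)
              (missProb_succ_le hbb)
      · rw [htest, not_lt] at hb
        have hnear := near_of_elim_le (v := fun k => fut p T t (bs1 k))
          (fun j _ f => fut_nonneg _ _) (fun j _ => sum_fut _) hG2.symm hG2.psd
          hε hε1 (by positivity) he rfl hclose hb
        have hgood : Good p T t ε m bs x := by
          rw [← Good.congr hbb, ← hbm]
          exact hnear
        refine Runs.skip ⟨hc3, h73, by omega, ?_⟩ ?_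
        · rw [hm3]
          exact fun i hi => hrows3 i (by omega)
        · rw [loss, hm3, hb2, hh3]
          refine add_le_add (ind_mono fun h hsp => h (hsp.congr hbb)) ?_
          have : w x = 1 := by simp [w, hgood]
          rw [this, mul_one, hC1]
          refine mul_le_mul' le_rfl (ind_mono fun h => ?_)
          rw [Bad, missProb_congr hbb] at h
          exact h
    · rw [ind_of hclose, mul_one] at hb2
      have hle : ∀ s4 : Store, loss p T ε t α A s4 ≤ b2 := fun s4 =>
        (hcrude s4).trans (by rw [hb2]; exact le_add_self)
      refine Runs.ite (fun _ => ?_) (fun _ => ?_)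
      · set s4 := s3.setNat 1 (NExpr.eval s3 (.lit 0)) (NExpr.eval s3 (.lit 0))
          (NExpr.eval s3 (.plus (nv 1) (.lit 1))) with hs4
        have hm4 : s4.nat 1 0 0 = m + 1 := by
          simp [hs4, NExpr.eval, Store.setNat_nat, nv, hm3]
        have hf4 : Frame [1] [] s3 s4 := (Frame.refl _ _ _).setNat (by decide) _ _ _
        have h24 : s4.nat 2 = s3.nat 2 := hf4.nat 2 (by decide)
        refine Runs.setNat ⟨hc3.frame hf4 (by decide) (by decide) (by decide), ?_, hm4.le, ?_⟩
          (hle _)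
        · rw [← hs4, hf4.nat 7 (by decide), h73]
        · rw [← hs4, hm4]
          intro i hi
          rw [h24]
          exact hrows3 i hi
      · refine Runs.skip ⟨hc3, h73, by omega, ?_⟩ (hle _)
        rw [hm3]
        exact fun i hi => hrows3 i (by omega)
  · simp only [mul_add, Finset.sum_add_distrib, ← Finset.sum_mul]
    have hone : ∑ f : Fin T → Fin O, ENNReal.ofReal (condProb p [] (List.ofFn f)) = 1 := by
      rw [← ENNReal.ofReal_sum_of_nonneg fun f _ => condProb_nonneg p _ _, sum_condProb,
        ENNReal.ofReal_one]
    have hsw : ∑ f : Fin T → Fin O, ENNReal.ofReal (condProb p [] (List.ofFn f)) *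
        (C1 * w fun j => f (Fin.castLE ht j)) =
        C1 * ∑ x : Fin t → Fin O, ENNReal.ofReal (condProb p [] (List.ofFn x)) * w x := by
      rw [← sum_prefix p ht w, Finset.mul_sum]
      exact Finset.sum_congr rfl fun f _ => mul_left_comm _ _ _
    rw [hone, one_mul, one_mul, hsw, loss, hm, ← hbs, ← hC0, add_right_comm]
    refine add_le_add (add_le_add le_rfl ?_) le_rfl
    by_cases hbad : Bad p T t ε m bs
    · rw [hC1, ind_of hbad, mul_one, mul_one]
      refine (mul_le_mul' le_rfl (sum_half_le hbad)).trans (le_of_eq ?_)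
      rw [← ENNReal.ofReal_mul (by positivity)]
      congr 1
      ring
    · rw [hC1, ind_of_not hbad]
      simp

end Round

/-! ### The main loop -/

section Main

variable {O : ℕ} {p : List (Fin O) → PMF (Fin O)} {T t P r : ℕ} {ε α δ : ℝ} {s : Store}

/-- The size parameter. -/
def sizeParam (n T r : ℕ) (ε α δ : ℝ) : ℕ :=
  ⌈1 / ε + 1 / α⌉₊ + ⌈Real.logb 2 (1 / δ)⌉₊ + (T + r + n)

theorem runs_size (p : List (Fin O) → PMF (Fin O)) (T t r n : ℕ) (ε α : ℝ) (hδ : 0 < δ) :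
    Runs p T (sizeProg n) (4 * sizeParam n T r ε α δ + 7) (inputStore T t r ε α δ)
      (fun s' => Ctx T t (sizeParam n T r ε α δ) ε s' ∧ s'.nat 1 0 0 = 0) (fun _ => 0) 0 := by
  set K₁ := ⌈1 / ε + 1 / α⌉₊ with hK₁
  set K₂ := ⌈Real.logb 2 (1 / δ)⌉₊ with hK₂
  set s₀ := inputStore T t r ε α δ with hs₀
  have hlt : ∀ i : ℕ, 2 ^ i * δ < 1 ↔ i < K₂ := fun i => by
    rw [hK₂, Nat.lt_ceil, Real.lt_logb_iff_rpow_lt one_lt_two (by positivity), Real.rpow_natCast,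
      lt_div_iff₀ hδ]
  have h1 : Runs p T (.loop (.realLT (.ofNExpr (nv 6))
        (.plus (.over (.ofNExpr (.lit 1)) (.cell 0 (.lit 0) (.lit 0)))
          (.over (.ofNExpr (.lit 1)) (.cell 0 (.lit 0) (.lit 1)))))
      (.setNat 6 (.lit 0) (.lit 0) (.plus (nv 6) (.lit 1)))) ((K₁ - 0) * (1 + 1) + 1) s₀
      (fun s' => Frame [6] [] s₀ s' ∧ s'.nat 6 0 0 = K₁) (fun _ => 0) 0 := by
    refine Runs.loop (I := fun i s' => Frame [6] [] s₀ s' ∧ s'.nat 6 0 0 = i)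
      (g := fun _ _ => 0) (fun i s1 _ hI => ?_) (fun i s1 _ hI => ?_) 0 (Nat.zero_le _) s₀
      ⟨Frame.refl _ _ _, by simp [hs₀, inputStore]⟩
    · simp [Test.eval, RExpr.eval, NExpr.eval, nv, hI.2, hI.1.real 0 (by decide), hs₀, inputStore,
        hK₁, Nat.lt_ceil]
    · refine Runs.setNat ⟨hI.1.setNat (by decide) _ _ _, ?_⟩ le_rfl
      simp [NExpr.eval, nv, Store.setNat_nat, hI.2]
  refine (Runs.seq h1 (n₂ := (1 + (K₂ * (3 + 1) + 1) + 1) + 2) (f := fun _ => 0)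
    (S₂ := fun s' => Ctx T t (sizeParam n T r ε α δ) ε s' ∧ s'.nat 1 0 0 = 0)
    (fun s1 hs1 => Runs.setReal_seq ?_)).conseq
    (by simp only [sizeParam]; omega) (fun _ h => h) (fun _ _ => le_rfl) le_rfl
  refine Runs.seq (S₁ := fun s' => Frame [6] [4] s₀ s' ∧ s'.nat 6 0 0 = K₁ + K₂)
    (g := fun _ => 0) ?_ ?_
  · refine (Runs.loop (K := K₂)
      (I := fun i s' => Frame [6] [4] s₀ s' ∧ s'.nat 6 0 0 = K₁ + i ∧ s'.real 4 0 0 = 2 ^ i * δ)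
      (g := fun _ _ => 0) (fun i s2 _ hI => ?_) (fun i s2 _ hI => ?_) 0 (Nat.zero_le _) _ ?_).conseq
      le_rfl (fun _ h => ⟨h.1, h.2.1⟩) (fun _ _ => le_rfl) le_rfl
    · rw [← hlt i]
      simp [Test.eval, RExpr.eval, NExpr.eval, hI.2.2]
    · refine Runs.setReal_seq (Runs.setNat ⟨?_, ?_, ?_⟩ le_rfl)
      · exact (hI.1.setReal (by decide) _ _ _).setNat (by decide) _ _ _
      · simp [NExpr.eval, nv, Store.setNat_nat, hI.2.1, add_assoc]
      · simp [NExpr.eval, RExpr.eval, Store.setReal_real, hI.2.2]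
        ring
    · refine ⟨(hs1.1.mono (by decide) (by decide)).setReal (by decide) _ _ _, ?_, ?_⟩
      · simp [hs1.2]
      · simp [NExpr.eval, RExpr.eval, Store.setReal_real, hs1.1.real 0 (by decide), hs₀, inputStore]
  · rintro s2 ⟨hf, h6⟩
    have hf' := hf.setNat (a := 6) (by decide) (NExpr.eval s2 (.lit 0)) (NExpr.eval s2 (.lit 0))
      (NExpr.eval s2 (.plus (nv 6) (.plus (.plus lenE (.cell 0 (.lit 0) (.lit 2))) (.lit n))))
    refine Runs.setNat ⟨⟨?_, ?_, ?_, ?_⟩, ?_⟩ le_rfl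
    · rw [hf'.nat 0 (by decide)]; simp [hs₀, inputStore]
    · rw [hf'.nat 0 (by decide)]; simp [hs₀, inputStore]
    · simp [NExpr.eval, nv, Store.setNat_nat, lenE, h6, hf.nat 0 (by decide), hs₀, inputStore,
        sizeParam, hK₁, hK₂]
    · rw [hf'.real 0 (by decide)]; simp [hs₀, inputStore]
    · rw [hf'.nat 1 (by decide)]; simp [hs₀, inputStore]

theorem roundSteps_mono {m m' : ℕ} (h : m ≤ m') (M W : ℕ) :
    roundSteps T t m M W ≤ roundSteps T t m' M W := by
  unfold roundSteps gramSteps elimSteps sampleSteps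
  gcongr

theorem Rows.setNat {m : ℕ} (h : Rows p T t m s) (i j v : ℕ) :
    Rows p T t m (s.setNat 7 i j v) := by
  have h2 : (s.setNat 7 i j v).nat 2 = s.nat 2 := Store.setNat_nat_of_ne _ (by decide) _ _ _
  unfold Rows
  rw [h2]
  exact h

variable [NeZero O]

theorem loss_setNat (A : ℝ) (i j v : ℕ) :
    loss p T ε t α A (s.setNat 7 i j v) = loss p T ε t α A s := by
  have h1 : (s.setNat 7 i j v).nat 1 = s.nat 1 := Store.setNat_nat_of_ne _ (by decide) _ _ _
  have h2 : (s.setNat 7 i j v).nat 2 = s.nat 2 := Store.setNat_nat_of_ne _ (by decide) _ _ _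
  have h3 : hist O t (s.setNat 7 i j v) = hist O t s := by
    funext a b
    simp only [hist, h2]
  rw [loss, loss, h1, h3]

/-- The rounds are unrolled backwards: the weight A ρ^(N-i) carries the contraction of the remaining
rounds in advance, and the additive term their estimation failures. -/
theorem runs_main (hp : IsRegular p T α) (hα : 0 < α) (hα1 : α ≤ 1) (ht : t ≤ T)
    (hε : 0 < ε) (hε1 : ε ≤ 1) (hc : Ctx T t P ε s) (h0 : s.nat 1 0 0 = 0) (hP : 0 < P)
    (kN kM kW : ℕ) {η κ θ e : ℝ}
    (hpar : ∀ m < P ^ kN, Params T t m α ((P : ℝ) ^ kW) η κ θ)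
    (he : ∀ m < P ^ kN, 3 * (m + 1 : ℝ) ^ 2 * e ≤ ε ^ 3 / 768) {δ : ℝ}
    (hδ : ∀ m < P ^ kN, Real.exp (-(θ * ((P : ℝ) ^ kM * e))) *
        (Real.exp (3 * θ ^ 2 * ((m + 1 : ℕ) * (P : ℝ) ^ kM)) * (2 * ((m + 1 : ℕ) : ℝ) ^ 2)) ≤ δ)
    {A : ℝ} (hA : 0 ≤ A) :
    Runs p T (forLoop 7 (ltPow 7 kN) (roundProg kM kW))
      (P ^ kN * (roundSteps T t (P ^ kN) (P ^ kM) (P ^ kW) + 3) + 3) s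
      (fun s' => Rows p T t (s'.nat 1 0 0) s') (loss p T ε t α A)
      (ENNReal.ofReal (A * (1 - ε / 4) ^ P ^ kN + (P ^ kN : ℕ) * ((1 + A) * δ))) := by
  set N := P ^ kN with hN
  have hNpos : 0 < N := pow_pos hP _
  have hδ0 : 0 ≤ δ := le_trans (by positivity) (hδ 0 hNpos)
  set ρ := 1 - ε / 4 with hρ
  have hρ0 : 0 ≤ ρ := by linarith
  have hρ1 : ρ ≤ 1 := by linarith
  refine (Runs.forLoop (n := roundSteps T t N (P ^ kM) (P ^ kW)) (K := N)
    -- At most one row is added per round, so m < N in every round and the parameter hypotheses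
    -- apply.
    (I := fun i s' => Ctx T t P ε s' ∧ s'.nat 1 0 0 ≤ i ∧ Rows p T t (s'.nat 1 0 0) s')
    (g := fun i s' => loss p T ε t α (A * ρ ^ (N - i)) s' +
      ENNReal.ofReal ((N - i : ℕ) * ((1 + A) * δ))) ?_ ?_ ?_ ?_ ?_).conseq le_rfl
      (fun _ h => h.1.2.2) (fun _ _ => ?_) ?_
  · intro i s1 _ hI hi
    exact hI.1.ltPow hi
  · intro i s1 v ⟨h1, h2, h3⟩
    have hf : Frame [7] [] s1 (s1.setNat 7 0 0 v) := (Frame.refl _ _ _).setNat (by decide) _ _ _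
    refine ⟨h1.frame hf (by decide) (by decide) (by decide), ?_, ?_⟩
    · rw [hf.nat 1 (by decide)]; exact h2
    · rw [hf.nat 1 (by decide)]; exact h3.setNat _ _ _
  · intro i s1 v
    rw [loss_setNat]
  · refine ⟨hc, h0.le, ?_⟩
    rw [h0]
    exact fun i hi => absurd hi (Nat.not_lt_zero _)
  · rintro i s1 hi ⟨h1, h2, h3⟩ h7
    have hmN : s1.nat 1 0 0 < N := lt_of_le_of_lt h2 hi
    set A' := A * ρ ^ (N - (i + 1)) with hA'
    have hA'0 : 0 ≤ A' := by positivity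
    have hA'1 : A' ≤ A := mul_le_of_le_one_right hA (pow_le_one₀ hρ0 hρ1)
    have hmono := roundSteps_mono (T := T) (t := t) hmN.le (P ^ kM) (P ^ kW)
    refine (runs_round hp hα hα1 ht hε hε1 h1 rfl h3 kM kW hP (hpar _ hmN) (he _ hmN)
      (hδ _ hmN) hA'0).mono (ENNReal.ofReal ((N - (i + 1) : ℕ) * ((1 + A) * δ))) 1 hmono ?_ ?_ ?_
    · rintro s2 ⟨h21, h22, h23, h24⟩
      exact ⟨⟨h21, by omega, h24⟩, by rw [h22]; exact h7⟩
    · intro s2 _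
      rw [one_mul, add_comm]
    · have hNi : N - i = N - (i + 1) + 1 := by omega
      have : A * ρ ^ (N - i) = A' * (1 - ε / 4) := by rw [hNi, pow_succ, hA']; ring
      rw [one_mul, this, add_left_comm, ← ENNReal.ofReal_add (by positivity) (by positivity)]
      refine add_le_add le_rfl (ENNReal.ofReal_le_ofReal ?_)
      rw [hNi]
      push_cast
      have : (1 + A') * δ ≤ (1 + A) * δ := mul_le_mul_of_nonneg_right (by linarith) hδ0
      linarith
  · simp
  · have hsp : Spread p T t α ε 0 (hist O t s) := fun i hi => absurd hi (Nat.not_lt_zero _)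
    rw [ENNReal.ofReal_add (by positivity) (by positivity), loss, h0, ind_of_not (not_not.2 hsp)]
    simp only [Nat.sub_zero, pow_zero, mul_one, zero_add]
    exact add_le_add (mul_le_of_le_one_right' (ind_le_one _)) le_rfl

end Main

/-! ### The choice of the parameters -/

section Numerics

variable {T t m P : ℕ} {α ε δ : ℝ}

/-- The exponents are chosen backwards. There are P^7 rounds, so m < P^7; the entry error e =
P^{-18} then meets the requirement of the ridge test. With θ = P^{-26} and M = P^50, the gain θMe =
P^6 beats the cost 3θ²(m+1)M ≤ 3P^5. Finally κ and η follow from θ, and W = P^117 makes density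
failures smaller than θ²/3. -/
theorem params_of_size (hP : 3000 ≤ P) (hT : T ≤ P) (hα : 0 < α) (hαP : 1 / α ≤ P)
    (hm : m < P ^ 7) :
    Params T t m α ((P : ℝ) ^ 117) (1 / (16 * (P : ℝ) ^ 27)) (1 / (8 * (P : ℝ) ^ 26))
      (1 / (P : ℝ) ^ 26) := by
  have hP' : (3000 : ℝ) ≤ P := by exact_mod_cast hP
  have hP0 : (0 : ℝ) < P := by linarith
  have hTt : ((T - t : ℕ) : ℝ) ≤ P := by exact_mod_cast (Nat.sub_le _ _).trans hT
  have hm' : ((m + 1 : ℕ) : ℝ) ≤ (P : ℝ) ^ 7 := by exact_mod_cast hm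
  have h26 : (1 : ℝ) ≤ (P : ℝ) ^ 26 := one_le_pow₀ (by linarith)
  have h27 : (1 : ℝ) ≤ (P : ℝ) ^ 27 := one_le_pow₀ (by linarith)
  have hα1 : 1 ≤ P * α := by rwa [div_le_iff₀ hα] at hαP
  refine ⟨by positivity, ?_, ?_, ?_, ?_, ?_, ?_⟩
  · rw [div_le_one (by positivity)]; linarith
  · calc 2 * (((T - t : ℕ) : ℝ) * (1 / (16 * (P : ℝ) ^ 27))) ≤
          2 * (P * (1 / (16 * (P : ℝ) ^ 27))) := by gcongr
      _ = _ := by field_simp; norm_num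
  · rw [div_le_div_iff₀ (by positivity) (by norm_num)]; linarith
  · exact le_of_eq (by field_simp)
  · rw [div_le_one (by positivity)]; linarith
  · have h1 : 1 / ((P : ℝ) ^ 117 * (α * (1 / (16 * (P : ℝ) ^ 27))) ^ 2) ≤ 256 / (P : ℝ) ^ 61 := by
      have h2 : 1 / ((P : ℝ) ^ 117 * (α * (1 / (16 * (P : ℝ) ^ 27))) ^ 2) =
          256 / (P : ℝ) ^ 61 * (1 / (P * α) ^ 2) := by
        field_simp; norm_num
      rw [h2]
      refine mul_le_of_le_one_right (by positivity) ?_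
      rw [div_le_one (by positivity)]
      exact one_le_pow₀ hα1
    calc 3 * (((m + 1 : ℕ) : ℝ) * (((T - t : ℕ) : ℝ) *
          (1 / ((P : ℝ) ^ 117 * (α * (1 / (16 * (P : ℝ) ^ 27))) ^ 2)))) ≤
          3 * ((P : ℝ) ^ 7 * (P * (256 / (P : ℝ) ^ 61))) := by gcongr
      _ = 768 / P * (1 / (P : ℝ) ^ 26) ^ 2 := by field_simp; norm_num
      _ ≤ 1 * (1 / (P : ℝ) ^ 26) ^ 2 := by
        gcongr
        rw [div_le_one hP0]; linarith
      _ = _ := one_mul _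

theorem error_le_of_size (hP : 3000 ≤ P) (hε : 0 < ε) (hεP : 1 / ε ≤ P) (hm : m < P ^ 7) :
    3 * (m + 1 : ℝ) ^ 2 * (1 / (P : ℝ) ^ 18) ≤ ε ^ 3 / 768 := by
  have hP' : (3000 : ℝ) ≤ P := by exact_mod_cast hP
  have hP0 : (0 : ℝ) < P := by linarith
  have hm' : (m + 1 : ℝ) ≤ (P : ℝ) ^ 7 := by exact_mod_cast hm
  have hε1 : 1 / (P : ℝ) ≤ ε := by
    rw [div_le_iff₀ hε] at hεP
    rw [div_le_iff₀ hP0]; linarith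
  calc 3 * (m + 1 : ℝ) ^ 2 * (1 / (P : ℝ) ^ 18) ≤ 3 * ((P : ℝ) ^ 7) ^ 2 * (1 / (P : ℝ) ^ 18) := by
        gcongr
    _ = 2304 / P * ((1 / (P : ℝ)) ^ 3 / 768) := by field_simp; norm_num
    _ ≤ 1 * ((1 / (P : ℝ)) ^ 3 / 768) := by
        gcongr
        rw [div_le_one hP0]; linarith
    _ ≤ _ := by rw [one_mul]; gcongr

theorem tail_le_of_size (hP : 3000 ≤ P) (hm : m < P ^ 7) :
    Real.exp (-(1 / (P : ℝ) ^ 26 * ((P : ℝ) ^ 50 * (1 / (P : ℝ) ^ 18)))) *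
        (Real.exp (3 * (1 / (P : ℝ) ^ 26) ^ 2 * ((m + 1 : ℕ) * (P : ℝ) ^ 50)) *
          (2 * ((m + 1 : ℕ) : ℝ) ^ 2)) ≤ Real.exp (-((P : ℝ) ^ 6 / 2)) * (2 * (P : ℝ) ^ 14) := by
  have hP' : (3000 : ℝ) ≤ P := by exact_mod_cast hP
  have hP0 : (0 : ℝ) < P := by linarith
  have hm' : ((m + 1 : ℕ) : ℝ) ≤ (P : ℝ) ^ 7 := by exact_mod_cast hm
  have h1 : 3 * (1 / (P : ℝ) ^ 26) ^ 2 * (((m + 1 : ℕ) : ℝ) * (P : ℝ) ^ 50) ≤ (P : ℝ) ^ 6 / 2 := by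
    calc 3 * (1 / (P : ℝ) ^ 26) ^ 2 * (((m + 1 : ℕ) : ℝ) * (P : ℝ) ^ 50) ≤
          3 * (1 / (P : ℝ) ^ 26) ^ 2 * ((P : ℝ) ^ 7 * (P : ℝ) ^ 50) := by gcongr
      _ = 3 * (P : ℝ) ^ 5 := by field_simp
      _ ≤ (P / 2) * (P : ℝ) ^ 5 := by gcongr; linarith
      _ = _ := by ring
  have h2 : 1 / (P : ℝ) ^ 26 * ((P : ℝ) ^ 50 * (1 / (P : ℝ) ^ 18)) = (P : ℝ) ^ 6 := by field_simp
  rw [h2, ← mul_assoc, ← Real.exp_add]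
  refine mul_le_mul (Real.exp_le_exp.2 (by linarith)) ?_ (by positivity) (by positivity)
  calc 2 * ((m + 1 : ℕ) : ℝ) ^ 2 ≤ 2 * ((P : ℝ) ^ 7) ^ 2 := by gcongr
    _ = _ := by ring

/-- The contraction contributes exp(-P^6/4) and an estimation failure exp(-P^6/2) up to powers of P;
both overwhelm the weight 2^(P^4). Each term is at most e^{-P-1}, and e^{-P} ≤ δ because 2^P ≥ 1/δ.
-/
theorem loss_le_of_size (hP : 3000 ≤ P) (hε : 0 < ε) (hε1 : ε ≤ 1) (hεP : 1 / ε ≤ P) (hδ : 0 < δ)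
    (hδP : Real.logb 2 (1 / δ) ≤ P) :
    2 ^ P ^ 4 * (1 - ε / 4) ^ P ^ 7 + (P ^ 7 : ℕ) *
      ((1 + 2 ^ P ^ 4) * (Real.exp (-((P : ℝ) ^ 6 / 2)) * (2 * (P : ℝ) ^ 14))) ≤ δ := by
  have hP' : (3000 : ℝ) ≤ P := by exact_mod_cast hP
  have hP0 : (0 : ℝ) < P := by linarith
  have he2 : (2 : ℝ) ≤ Real.exp 1 := by have := Real.add_one_le_exp (1 : ℝ); linarith
  have hεi : 1 / (P : ℝ) ≤ ε := by
    rw [div_le_iff₀ hε] at hεP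
    rw [div_le_iff₀ hP0]; linarith
  have hδ1 : Real.exp (-P) ≤ δ := by
    rw [Real.logb_le_iff_le_rpow one_lt_two (by positivity), Real.rpow_natCast,
      div_le_iff₀ hδ] at hδP
    rw [Real.exp_neg, inv_le_iff_one_le_mul₀ (Real.exp_pos _), mul_comm]
    refine hδP.trans (mul_le_mul_of_nonneg_right ?_ hδ.le)
    calc (2 : ℝ) ^ P ≤ Real.exp 1 ^ P := by gcongr
      _ = _ := by rw [← Real.exp_nat_mul, mul_one]
  have hA : (2 : ℝ) ^ P ^ 4 ≤ Real.exp ((P : ℝ) ^ 4) := by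
    calc (2 : ℝ) ^ P ^ 4 ≤ Real.exp 1 ^ P ^ 4 := by gcongr
      _ = _ := by rw [← Real.exp_nat_mul]; push_cast; rw [mul_one]
  have h46 : 24 * (P : ℝ) + (P : ℝ) ^ 4 + 4 ≤ (P : ℝ) ^ 6 / 4 := by
    have h1 : (P : ℝ) ≤ (P : ℝ) ^ 4 := le_self_pow₀ (by linarith) (by norm_num)
    have h2 : (P : ℝ) ^ 6 = P ^ 2 * P ^ 4 := by ring
    have h3 : (120 : ℝ) * P ^ 4 ≤ P ^ 2 * P ^ 4 := by gcongr; nlinarith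
    linarith
  have h1 : (2 : ℝ) ^ P ^ 4 * (1 - ε / 4) ^ P ^ 7 ≤ Real.exp (-P - 1) := by
    calc (2 : ℝ) ^ P ^ 4 * (1 - ε / 4) ^ P ^ 7 ≤
          Real.exp ((P : ℝ) ^ 4) * Real.exp (-((1 / (P : ℝ)) / 4)) ^ P ^ 7 := by
          refine mul_le_mul hA (pow_le_pow_left₀ (by linarith) ?_ _)
            (pow_nonneg (by linarith) _) (by positivity)
          refine (by linarith : (1 : ℝ) - ε / 4 ≤ -((1 / (P : ℝ)) / 4) + 1).trans
            (Real.add_one_le_exp _)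
      _ = Real.exp ((P : ℝ) ^ 4 - (P : ℝ) ^ 6 / 4) := by
          rw [← Real.exp_nat_mul, ← Real.exp_add]
          congr 1
          push_cast
          field_simp
          ring
      _ ≤ _ := Real.exp_le_exp.2 (by linarith)
  have hpow : (P : ℝ) ^ 21 ≤ Real.exp (21 * P) := by
    have := Real.add_one_le_exp (P : ℝ)
    calc (P : ℝ) ^ 21 ≤ Real.exp P ^ 21 := by gcongr; linarith
      _ = _ := by rw [← Real.exp_nat_mul]; norm_num
  have h2 : ((P ^ 7 : ℕ) : ℝ) * ((1 + 2 ^ P ^ 4) *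
      (Real.exp (-((P : ℝ) ^ 6 / 2)) * (2 * (P : ℝ) ^ 14))) ≤ Real.exp (-P - 1) := by
    have h3 : (1 : ℝ) + 2 ^ P ^ 4 ≤ 2 * Real.exp ((P : ℝ) ^ 4) := by
      have : (1 : ℝ) ≤ 2 ^ P ^ 4 := one_le_pow₀ (by norm_num)
      linarith
    calc ((P ^ 7 : ℕ) : ℝ) * ((1 + 2 ^ P ^ 4) *
          (Real.exp (-((P : ℝ) ^ 6 / 2)) * (2 * (P : ℝ) ^ 14))) =
          2 * (P : ℝ) ^ 21 * (1 + 2 ^ P ^ 4) * Real.exp (-((P : ℝ) ^ 6 / 2)) := by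
          push_cast; ring
      _ ≤ 2 * Real.exp (21 * P) * (2 * Real.exp ((P : ℝ) ^ 4)) * Real.exp (-((P : ℝ) ^ 6 / 2)) := by
          gcongr
      _ = 2 ^ 2 * Real.exp (21 * P + (P : ℝ) ^ 4 - (P : ℝ) ^ 6 / 2) := by
          rw [sub_eq_add_neg, Real.exp_add, Real.exp_add]; ring
      _ ≤ Real.exp 1 ^ 2 * Real.exp (21 * P + (P : ℝ) ^ 4 - (P : ℝ) ^ 6 / 2) := by gcongr
      _ = Real.exp (2 + (21 * P + (P : ℝ) ^ 4 - (P : ℝ) ^ 6 / 2)) := by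
          rw [← Real.exp_nat_mul, ← Real.exp_add]; norm_num
      _ ≤ _ := Real.exp_le_exp.2 (by have : (0 : ℝ) ≤ P ^ 6 := by positivity
                                     linarith)
  have h3 : Real.exp (-P - 1) + Real.exp (-P - 1) ≤ Real.exp (-P) := by
    have : Real.exp (-P : ℝ) = Real.exp (-P - 1) * Real.exp 1 := by
      rw [← Real.exp_add]; congr 1; ring
    rw [this]
    have := Real.exp_pos (-P - 1 : ℝ)
    nlinarith
  linarith

theorem le_sizeParam (n T r : ℕ) (ε α δ : ℝ) :
    1 / ε + 1 / α ≤ sizeParam n T r ε α δ ∧ Real.logb 2 (1 / δ) ≤ sizeParam n T r ε α δ ∧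
      T + r + n ≤ sizeParam n T r ε α δ := by
  have h1 := Nat.le_ceil (1 / ε + 1 / α)
  have h2 := Nat.le_ceil (Real.logb 2 (1 / δ))
  refine ⟨h1.trans ?_, h2.trans ?_, by unfold sizeParam; omega⟩ <;>
  · unfold sizeParam
    exact_mod_cast by omega

theorem sizeParam_le (n T r : ℕ) (hε : 0 < ε) (hα : 0 < α) (hδ : 0 < δ) (hδ1 : δ < 1) :
    (sizeParam n T r ε α δ : ℝ) ≤
      r + T + 1 / ε + 1 / α + 2 * Real.log (1 / δ) + (n + 2 : ℕ) := by
  have hL : 0 ≤ Real.log (1 / δ) := Real.log_nonneg (by rw [le_div_iff₀ hδ]; linarith)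
  have hl2 := Real.log_two_gt_d9
  have hlogb : Real.logb 2 (1 / δ) ≤ 2 * Real.log (1 / δ) := by
    rw [← Real.log_div_log, div_le_iff₀ (by linarith)]
    nlinarith
  have h1 := Nat.ceil_lt_add_one (a := 1 / ε + 1 / α) (by positivity)
  have h2 := Nat.ceil_lt_add_one (a := Real.logb 2 (1 / δ))
    (div_nonneg hL (by linarith))
  unfold sizeParam
  push_cast
  linarith

end Numerics

/-! ### Running time and correctness -/

section Correctness

/-- The running time of the algorithm with the size parameter `P`. -/
def basisSteps (T t P : ℕ) : ℕ :=
  1 + (4 * P + 7) + (P ^ 7 * (roundSteps T t (P ^ 7) (P ^ 50) (P ^ 117) + 3) + 3)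

theorem exists_basisSteps_le :
    ∃ d : ℕ, ∀ P T t : ℕ, 3000 ≤ P → T ≤ P → t ≤ P → basisSteps T t P ≤ P ^ d := by
  -- The exponent stays a metavariable created before P, T and t, and is assembled by unification
  -- from `hadd` and `hmul` along the syntax of the step count.
  apply Exists.intro
  intro P T t hP hT ht
  have hlit : ∀ c, c ≤ 3000 → c ≤ P ^ 1 := fun c hc => by rw [pow_one]; omega
  have hadd : ∀ {j k x y : ℕ}, x ≤ P ^ j → y ≤ P ^ k → x + y ≤ P ^ (j + k + 1) := by
    intro j k x y hx hy
    have h1 : 1 ≤ P ^ j := Nat.one_le_pow _ _ (by omega)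
    have h2 : 1 ≤ P ^ k := Nat.one_le_pow _ _ (by omega)
    calc x + y ≤ P ^ j + P ^ k := add_le_add hx hy
      _ ≤ P ^ j * P ^ k * 2 := by nlinarith
      _ ≤ P ^ j * P ^ k * P := Nat.mul_le_mul_left _ (by omega)
      _ = _ := by ring
  have hmul : ∀ {j k x y : ℕ}, x ≤ P ^ j → y ≤ P ^ k → x * y ≤ P ^ (j + k) :=
    fun hx hy => (Nat.mul_le_mul hx hy).trans_eq (pow_add _ _ _).symm
  have hP1 : P ≤ P ^ 1 := (pow_one P).ge
  have hT1 : T - t ≤ P ^ 1 := ((Nat.sub_le _ _).trans hT).trans hP1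
  have ht1 : t ≤ P ^ 1 := ht.trans hP1
  simp only [basisSteps, roundSteps, gramSteps, elimSteps, sampleSteps, densSteps]
  repeat' first
    | with_reducible exact hP1
    | with_reducible exact hT1
    | with_reducible exact ht1
    | with_reducible exact le_rfl
    | with_reducible apply hadd
    | with_reducible apply hmul
    | exact hlit _ (by norm_num)

variable {O : ℕ} {p : List (Fin O) → PMF (Fin O)} {T t r : ℕ} {ε α δ : ℝ} {s : Store}

theorem Spread.le_log {m : ℕ} {bs : ℕ → Fin t → Fin O} (hs : Spread p T t α ε m bs)
    (hrank : HasRank p T r) (ht1 : 1 ≤ t) (ht : t ≤ T) (hr : 1 ≤ r) (hα : 0 < α) (hα1 : α ≤ 1)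
    (hε : 0 < ε) (hε1 : ε ≤ 1) (hεα : ε < α / (T * r)) :
    (m : ℝ) ≤ 23 * (r * T * (1 + Real.log (1 / (α * ε)))) := by
  have hL : 0 ≤ Real.log (1 / (α * ε)) := Real.log_nonneg (by
    rw [le_div_iff₀ (by positivity), one_mul]
    exact mul_le_one₀ hα1 hε.le hε1)
  rcases Nat.eq_zero_or_pos m with rfl | hm
  · rw [Nat.cast_zero]; positivity
  · exact le_of_two_pow_le hr (ht1.trans ht) hm hα hα1 hε hεα
      (hs.two_pow_le hrank ht1 ht hα hε hm)

variable [NeZero O]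

theorem exists_basis (hp : IsRegular p T α) (hrank : HasRank p T r) (ht1 : 1 ≤ t) (ht : t ≤ T)
    (hr : 1 ≤ r) (hα : 0 < α) (hα1 : α ≤ 1) (hε : 0 < ε) (hε1 : ε ≤ 1) (hεα : ε < α / (T * r))
    {m : ℕ} (hm : s.nat 1 0 0 = m) (hrows : Rows p T t m s)
    (hs : Spread p T t α ε m (hist O t s)) (hbad : ¬ Bad p T t ε m (hist O t s)) :
    ∃ B : Finset (Fin t → Fin O), Outputs s B ∧ IsApproxBasis p T t ε B ∧
      (B.card : ℝ) ≤ max 1 (46 * r ^ 2 * T ^ 3 * Real.log (1 / (α * ε))) := by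
  classical
  have hval : ∀ i < m, ∀ j : Fin t, s.nat 2 i j = (hist O t s i j : ℕ) := fun i hi j =>
    (hist_val (hrows.lt ht hi j)).symm
  refine ⟨(Finset.range m).image (hist O t s), ⟨fun i hi => ?_, fun b hb => ?_⟩,
    isApproxBasis_image (hs.injOn hα hε) (not_lt.1 hbad) hε, ?_⟩
  · rw [hm] at hi
    exact ⟨_, Finset.mem_image_of_mem _ (Finset.mem_range.2 hi), hval i hi⟩
  · obtain ⟨i, hi, rfl⟩ := Finset.mem_image.1 hb
    rw [Finset.mem_range] at hi
    exact ⟨i, hm ▸ hi, hval i hi⟩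
  -- For α ≤ 1/2 the logarithm is at least one and absorbs the 1 in `Spread.le_log`, which doubles
  -- 23 to 46. For α > 1/2 it can be arbitrarily small, but then the law is deterministic and all
  -- rows coincide.
  · rcases le_or_gt α (1 / 2) with h2 | h2
    · refine le_max_of_le_right ?_
      have hr1 : (1 : ℝ) ≤ r := by exact_mod_cast hr
      have hT1 : (1 : ℝ) ≤ T := by exact_mod_cast ht1.trans ht
      have hε2 : ε ≤ 1 / 2 := by
        refine hεα.le.trans ((div_le_self hα.le ?_).trans h2)
        exact one_le_mul_of_one_le_of_one_le hT1 hr1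
      have hL : 1 ≤ Real.log (1 / (α * ε)) := by
        rw [Real.le_log_iff_exp_le (by positivity), le_div_iff₀ (by positivity)]
        have := Real.exp_one_lt_d9
        have : α * ε ≤ 1 / 2 * (1 / 2) := by gcongr
        nlinarith [Real.exp_pos 1]
      have hcard : (((Finset.range m).image (hist O t s)).card : ℝ) ≤ m := by
        exact_mod_cast Finset.card_image_le.trans_eq (Finset.card_range m)
      calc (((Finset.range m).image (hist O t s)).card : ℝ) ≤ m := hcard
        _ ≤ 23 * (r * T * (1 + Real.log (1 / (α * ε)))) :=
          hs.le_log hrank ht1 ht hr hα hα1 hε hε1 hεα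
        _ ≤ 23 * (r ^ 2 * T ^ 3 * (2 * Real.log (1 / (α * ε)))) := by
          gcongr
          · exact le_self_pow₀ hr1 (by norm_num)
          · exact le_self_pow₀ hT1 (by norm_num)
          · linarith
        _ = _ := by ring
    · refine le_max_of_le_left ?_
      rw [Nat.cast_le_one, Finset.card_le_one]
      intro a ha b hb
      obtain ⟨i, hi, rfl⟩ := Finset.mem_image.1 ha
      obtain ⟨k, hk, rfl⟩ := Finset.mem_image.1 hb
      rw [Finset.mem_range] at hi hk
      obtain ⟨l, hl, hli⟩ := hrows i hi
      obtain ⟨l', hl', hlk⟩ := hrows k hk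
      obtain rfl := hp.futureLaw_unique h2 (by simp) hl hl'
      have hlen := length_of_mem_futureLaw p hl
      funext j
      refine Fin.ext ?_
      rw [← hval i hi, ← hval k hk, hli j (by omega) j.2, hlk j (by omega) j.2]

theorem runs_basis (hp : IsRegular p T α) (hrank : HasRank p T r) (ht1 : 1 ≤ t) (ht : t ≤ T)
    (hr : 1 ≤ r) (hα : 0 < α) (hα1 : α ≤ 1) (hε : 0 < ε) (hε1 : ε ≤ 1) (hεα : ε < α / (T * r))
    (hδ : 0 < δ) :
    ∃ (S : Store → Prop) (f : Store → ENNReal),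
      Runs p T (basisProg 3000 7 50 117) (basisSteps T t (sizeParam 3000 T r ε α δ))
        (inputStore T t r ε α δ) S f (ENNReal.ofReal δ) ∧
      ∀ s', S s' → s' ∉ {s | ∃ B : Finset (Fin t → Fin O), Outputs s B ∧ IsApproxBasis p T t ε B ∧
        (B.card : ℝ) ≤ max 1 (46 * r ^ 2 * T ^ 3 * Real.log (1 / (α * ε)))} → 1 ≤ f s' := by
  obtain ⟨hP1, hP2, hP3⟩ := le_sizeParam 3000 T r ε α δ
  set P := sizeParam 3000 T r ε α δ with hP
  have hα0 : 0 < 1 / α := by positivity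
  have hε0 : 0 < 1 / ε := by positivity
  have hPn : 3000 ≤ P := by omega
  have hαP : 1 / α ≤ P := by linarith
  have hεP : 1 / ε ≤ P := by linarith
  refine ⟨fun s' => Rows p T t (s'.nat 1 0 0) s', loss p T ε t α (2 ^ P ^ 4),
    Runs.seq ((runs_size p T t r 3000 ε α hδ).ofPost (f' := fun _ => ENNReal.ofReal δ) le_rfl
      (fun _ h => h) fun _ _ => le_rfl) fun s1 hs1 => ?_, fun s1 hs1 hE => ?_⟩
  · refine (runs_main hp hα hα1 ht hε hε1 hs1.1 hs1.2 (by omega) 7 50 117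
      (fun m hm => params_of_size hPn (by omega) hα hαP hm)
      (fun m hm => error_le_of_size hPn hε hεP hm)
      (fun m hm => tail_le_of_size hPn hm) (by positivity)).conseq le_rfl (fun _ h => h)
      (fun _ _ => le_rfl) (ENNReal.ofReal_le_ofReal ?_)
    exact loss_le_of_size hPn hε hε1 hεP hδ hP2
  · by_cases hs : Spread p T t α ε (s1.nat 1 0 0) (hist O t s1)
    · have hbad : Bad p T t ε (s1.nat 1 0 0) (hist O t s1) := by
        by_contra hbad
        exact hE (exists_basis hp hrank ht1 ht hr hα hα1 hε hε1 hεα rfl hs1 hs hbad)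
      -- A spread family has at most P^4 members; this is why the weight 2^(P^4) suffices.
      have hle : s1.nat 1 0 0 ≤ P ^ 4 := by
        have h1 := hs.le_log hrank ht1 ht hr hα hα1 hε hε1 hεα
        have hP' : (3000 : ℝ) ≤ P := by exact_mod_cast hPn
        have hL : Real.log (1 / (α * ε)) ≤ P := by
          rw [← one_div_mul_one_div, Real.log_mul hα0.ne' hε0.ne']
          have := Real.log_le_sub_one_of_pos hα0
          have := Real.log_le_sub_one_of_pos hε0
          linarith
        have hrP : (r : ℝ) ≤ P := by exact_mod_cast (by omega : r ≤ P)
        have hTP : (T : ℝ) ≤ P := by exact_mod_cast (by omega : T ≤ P)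
        have h2 : 23 * ((r : ℝ) * T * (1 + Real.log (1 / (α * ε)))) ≤ (P : ℝ) ^ 4 := by
          calc 23 * ((r : ℝ) * T * (1 + Real.log (1 / (α * ε)))) ≤ 23 * ((P : ℝ) * P * (P + P)) := by
                refine mul_le_mul_of_nonneg_left ?_ (by norm_num)
                refine mul_le_mul_of_nonneg (by gcongr) (by linarith) (by positivity) (by positivity)
            _ = 46 * (P : ℝ) ^ 3 := by ring
            _ ≤ P * (P : ℝ) ^ 3 := by gcongr; linarith
            _ = _ := by ring
        exact_mod_cast h1.trans h2
      rw [loss, ind_of hbad, mul_one]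
      refine le_add_left ?_
      rw [← ENNReal.ofReal_one]
      refine ENNReal.ofReal_le_ofReal ?_
      rw [one_div, inv_pow, ← div_eq_mul_inv, le_div_iff₀ (by positivity), one_mul]
      exact pow_le_pow_right₀ one_le_two hle
    · rw [loss, ind_of hs]
      exact le_self_add

end Correctness

end

end CondSampling

theorem mainTheorem6 :
    ∃ (c : CondSampling.Prog) (Q : MvPolynomial (Fin 5) ℝ) (K : ℝ),
      ∀ (O T r t : ℕ) (p : List (Fin O) → PMF (Fin O)) (α ε δ : ℝ),
        1 ≤ t → t ≤ T →
        CondSampling.HasRank p T r →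
        CondSampling.IsRegular p T α →
        0 < ε → ε < α / (T * r) →
        0 < δ → δ < 1 →
        ∃ n : ℕ,
          (n : ℝ) ≤ MvPolynomial.eval ![(r : ℝ), (T : ℝ), 1 / ε, 1 / α, Real.log (1 / δ)] Q ∧
          CondSampling.HaltsWithin p T c (CondSampling.inputStore T t r ε α δ) n ∧
          ENNReal.ofReal (1 - δ) ≤
            CondSampling.haltProb p T c (CondSampling.inputStore T t r ε α δ) n
              {s | ∃ B : Finset (Fin t → Fin O),
                CondSampling.Outputs s B ∧
                CondSampling.IsApproxBasis p T t ε B ∧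
                (B.card : ℝ) ≤ max 1 (K * r ^ 2 * T ^ 3 * Real.log (1 / (α * ε)))} := by
  obtain ⟨d, hd⟩ := CondSampling.exists_basisSteps_le
  refine ⟨CondSampling.basisProg 3000 7 50 117,
    (MvPolynomial.X 0 + MvPolynomial.X 1 + MvPolynomial.X 2 + MvPolynomial.X 3 +
      MvPolynomial.C 2 * MvPolynomial.X 4 + MvPolynomial.C ((3000 + 2 : ℕ) : ℝ)) ^ d, 46, ?_⟩
  intro O T r t p α ε δ ht1 ht hrank hp hε hεα hδ hδ1
  obtain ⟨o, ho⟩ := (p []).support_nonempty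
  have : NeZero O := ⟨fun h => absurd o.2 (by omega)⟩
  have hr : 1 ≤ r := by
    by_contra hr
    obtain rfl : r = 0 := by omega
    -- For r = 0 the quotient α / (T * r) is zero by convention, contradicting 0 < ε.
    simp only [Nat.cast_zero, mul_zero, div_zero] at hεα
    linarith
  have hTr : (1 : ℝ) ≤ (T : ℝ) * r := by exact_mod_cast Nat.mul_pos (ht1.trans ht) hr
  have hα : 0 < α := by
    rw [lt_div_iff₀ (by linarith)] at hεα
    nlinarith
  -- Some observation has positive probability after the empty history, and that probability is at
  -- least α.
  have hα1 : α ≤ 1 :=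
    (hp [] (ht1.trans ht) o ho).trans (CondSampling.toReal_pmf_le_one _ _)
  have hε1 : ε ≤ 1 := (hεα.le.trans (div_le_self hα.le hTr)).trans hα1
  obtain ⟨S, f, hrun, hf⟩ :=
    CondSampling.runs_basis hp hrank ht1 ht hr hα hα1 hε hε1 hεα hδ
  refine ⟨_, ?_, hrun.halts, ?_⟩
  · have h1 := CondSampling.le_sizeParam 3000 T r ε α δ
    have h2 := CondSampling.sizeParam_le 3000 T r hε hα hδ hδ1
    have h3 := hd (CondSampling.sizeParam 3000 T r ε α δ) T t (by omega) (by omega) (by omega)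
    calc _ ≤ ((CondSampling.sizeParam 3000 T r ε α δ : ℕ) : ℝ) ^ d := by exact_mod_cast h3
      _ ≤ _ := pow_le_pow_left₀ (Nat.cast_nonneg _) h2 d
      _ = _ := by simp
  · rw [ENNReal.ofReal_sub _ hδ.le, ENNReal.ofReal_one]
    exact hrun.le_haltProb hf
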